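/- Let $k$ be a field of characteristic zero. For a Hopf algebra $A$ over $k$ let $\mathrm{Aut}_{\mathrm{Hopf}}(A)$ be its group of Hopf algebra automorphisms. For a Hopf algebra $A$ and group-like $g\in A$, an element $y$ is called $(g,1)$-primitive if $\Delta(y)=y\otimes g+1\otimes y$. For $m,n\ge 2$, a primitive $m$-th root of unity $q\in k$, a primitive $n$-th root of unity $\overline q\in k$ and $\sigma\in k$ with $\sigma^{\gcd(m,n)}=1$, let $\mathrm T^{\sigma}_{n,m}(\overline q,q)$ be the Hopf algebra generated by $h,x,H,X$ subject to $$h^m=H^n=1,\quad x^m=X^n=0,\quad xh=q\,hx,\quad XH=\overline q\,HX,$$ $$xH=\sigma Hx,\quad hX=\sigma Xh,\quad xX=\sigma Xx,\quad hH=Hh,$$ where $h,H$ are group-like, $x$ is $(h,1)$-primitive and $X$ is $(H,1)$-primitive. For a primitive $n$-th root of unity $q\in k$, $n\ge2$, let $\mathrm Q^{1}_n(q)$ be the Hopf algebra generated by $h,x,H,X$ subject to $$h^n=H^n=1,\quad x^n=X^n=0,\quad xh=q\,hx,\quad XH=q^{n-1}HX,$$ $$xH=q\,Hx,\quad hX=q\,Xh,\quad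 xX-q\,Xx=1-Hh,\quad hH=Hh,$$ with $h,H$ group-like, $x$ $(h,1)$-primitive and $X$ $(H,1)$-primitive. Let $T_{n^2}(q)$ be the Taft Hopf algebra generated by $h,x$ with $h^n=1$, $x^n=0$, $xh=q\,hx$, $h$ group-like and $x$ $(h,1)$-primitive. Let $D(T_{n^2}(q))$ be its Drinfeld double: for a finite-dimensional Hopf algebra $A$ with bijective antipode $S$, $D(A)=(A^*)^{\mathrm{cop}}\bowtie A$ is the space $A^*\otimes A$ with unit $\varepsilon\otimes 1$, the tensor product coalgebra structure of $(A^*)^{\mathrm{cop}}\otimes A$ and the multiplication $(f\otimes a)(g\otimes b)=f\,g\bigl(S^{-1}(a_{(3)})\,?\,a_{(1)}\bigr)\otimes a_{(2)}b$. **Theorem.** 1) If $m,n\ge2$, $m\ne n$, then for all primitive roots of unity $q,\overline q\in k$ of orders $m,n$ and all $\sigma\in k$ with $\sigma^{\gcd(m,n)}=1$, $\mathrm{Aut}_{\mathrm{Hopf}}(\mathrm T^{\sigma}_{n,m}(\overline q,q))\cong k^*\times k^*$. If $n\ge2$ and $q\neq\overline q$ are primitive $n$-th roots of unity in $k$, then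 $\mathrm{Aut}_{\mathrm{Hopf}}(\mathrm T^{\sigma}_{n,n}(\overline q,q))\cong k^*\times k^*$ for all $\sigma\in k$ with $\sigma^n=1$. 2) If $n\ge2$, $q\in k$ is a primitive $n$-th root of unity and $\sigma\in k$, $\sigma^n=1$, then $$\mathrm{Aut}_{\mathrm{Hopf}}(\mathrm T^{\sigma}_{n,n}(q,q))\cong\begin{cases}k^*\times k^*&\text{if }\sigma^2\ne1,\\ (k^*\times k^*)\rtimes_{\tau}\mathbb Z_2&\text{if }\sigma^2=1,\end{cases}$$ where $\tau(\overline 1)(a,b)=(b,a)$ for all $a,b\in k^*$. 3) If $n\ge2$ and $q\in k$ is a primitive $n$-th root of unity, then $$\mathrm{Aut}_{\mathrm{Hopf}}(\mathrm Q^{1}_n(q))\cong\begin{cases}k^*&\text{if }n\ge3,\\ k^*\rtimes_{\kappa}\mathbb Z_2&\text{if }n=2,\end{cases}$$ where $\kappa(\overline 1)(a)=a^{-1}$ for all $a\in k^*$. 4) If $n\ge2$ and $q\in k$ is a primitive $n$-th root of unity, then $\mathrm{Aut}_{\mathrm{Hopf}}(D(T_{n^2}(q)))\cong k^*$ if $n\ge3$,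 and $\mathrm{Aut}_{\mathrm{Hopf}}(D(T_{n^2}(q)))\cong k^*\rtimes_{\kappa}\mathbb Z_2$ if $n=2$, with $\kappa$ as in 3). -/

import Mathlib

open scoped TensorProduct

namespace TaftBicrossed

universe u v w

set_option linter.unusedSectionVars false
set_option linter.unusedSimpArgs false

section QBinomial

/-- The Gaussian binomial coefficients, evaluated at `q`. -/
def qBinom {k : Type u} [Field k] (q : k) : ℕ → ℕ → k
  | _, 0 => 1
  | 0, _ + 1 => 0
  | n + 1, i + 1 => qBinom q n i + q ^ (i + 1) * qBinom q n (i + 1)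

variable {k : Type u} [Field k] {R : Type v} [Ring R] [Algebra k R]

theorem qBinom_zero (q : k) (n : ℕ) : qBinom q n 0 = 1 := by
  cases n <;> rfl

theorem qBinom_of_lt (q : k) (n i : ℕ) (h : n < i) : qBinom q n i = 0 := by
  induction n generalizing i with
  | zero => cases i with
    | zero => omega
    | succ i => rfl
  | succ n ih => cases i with
    | zero => omega
    | succ i => simp [qBinom, ih i (by omega), ih (i + 1) (by omega)]

theorem qBinom_self (q : k) (n : ℕ) : qBinom q n n = 1 := by
  induction n with
  | zero => rfl
  | succ n ih => simp [qBinom, ih, qBinom_of_lt q n (n + 1) (by omega)]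

theorem qBinom_step (q : k) (n i : ℕ) (hi : i ≤ n) :
    (1 - q ^ (i + 1)) * qBinom q n (i + 1) = (1 - q ^ (n - i)) * qBinom q n i := by
  induction n generalizing i with
  | zero =>
    obtain rfl : i = 0 := by omega
    simp [qBinom]
  | succ n ih =>
    have key : ∀ j, j ≤ n → (1 - q ^ (j + 1)) * qBinom q (n + 1) (j + 1)
        = (1 - q ^ (n + 1)) * qBinom q n j := by
      intro j hj
      have h1 := ih j hj
      have h2 : q ^ (j + 1) * q ^ (n - j) = q ^ (n + 1) := by
        rw [← pow_add]; congr 1; omega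
      simp only [qBinom]
      linear_combination q ^ (j + 1) * h1 - qBinom q n j * h2
    rcases Nat.lt_or_ge n i with h | h
    · obtain rfl : i = n + 1 := by omega
      simp [qBinom_of_lt q (n + 1) (n + 2) (by omega)]
    · rw [key i h]
      cases i with
      | zero => simp [qBinom_zero]
      | succ i =>
        have h1 := ih i (by omega)
        have h2 : q ^ (i + 1) * q ^ (n - i) = q ^ (n + 1) := by
          rw [← pow_add]; congr 1; omega
        have h3 : n + 1 - (i + 1) = n - i := by omega
        rw [h3]
        simp only [qBinom]
        linear_combination h1 + qBinom q n (i + 1) * h2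

theorem qBinom_eq_zero {q : k} {m : ℕ} (hq : IsPrimitiveRoot q m) (i : ℕ) (h0 : 0 < i)
    (hi : i < m) : qBinom q m i = 0 := by
  induction i with
  | zero => omega
  | succ i ih =>
    have h1 := qBinom_step q m i (by omega)
    have h2 : (1 - q ^ (m - i)) * qBinom q m i = 0 := by
      rcases Nat.eq_zero_or_pos i with rfl | h
      · simp [hq.pow_eq_one]
      · simp [ih h (by omega)]
    rw [h2, mul_eq_zero] at h1
    rcases h1 with h1 | h1
    · exact absurd (sub_eq_zero.1 h1).symm (hq.pow_ne_one_of_pos_of_lt (by omega) hi)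
    · exact h1

theorem mul_pow_of_qcomm {q : k} {a b : R} (h : b * a = q • (a * b)) (i : ℕ) :
    b * a ^ i = q ^ i • (a ^ i * b) := by
  induction i with
  | zero => simp
  | succ i ih =>
    rw [pow_succ a, ← mul_assoc, ih, smul_mul_assoc, mul_assoc, h, mul_smul_comm, smul_smul,
      mul_assoc, pow_succ q]

theorem pow_mul_of_qcomm {q : k} {a b : R} (h : b * a = q • (a * b)) (i : ℕ) :
    b ^ i * a = q ^ i • (a * b ^ i) := by
  induction i with
  | zero => simp
  | succ i ih =>
    rw [pow_succ' b, mul_assoc, ih, mul_smul_comm, ← mul_assoc, h, smul_mul_assoc, smul_smul,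
      mul_assoc, pow_succ q]

theorem add_pow_of_qcomm {q : k} {a b : R} (h : b * a = q • (a * b)) (n : ℕ) :
    (a + b) ^ n = ∑ i ∈ Finset.range (n + 1), qBinom q n i • (a ^ i * b ^ (n - i)) := by
  induction n with
  | zero => simp [qBinom]
  | succ n ih =>
    have e1 : ∀ i ∈ Finset.range (n + 1), (a + b) * (qBinom q n i • (a ^ i * b ^ (n - i))) =
        qBinom q n i • (a ^ (i + 1) * b ^ (n - i)) +
          (q ^ i * qBinom q n i) • (a ^ i * b ^ (n + 1 - i)) := by
      intro i hi
      have hi' : n + 1 - i = (n - i) + 1 := by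
        have := Finset.mem_range.1 hi; omega
      rw [add_mul, mul_smul_comm, mul_smul_comm, ← mul_assoc, ← mul_assoc, mul_pow_of_qcomm h,
        ← pow_succ', smul_mul_assoc, smul_smul, mul_assoc, ← pow_succ', hi', mul_comm (q ^ i)]
    rw [pow_succ' (a + b), ih, Finset.mul_sum, Finset.sum_congr rfl e1, Finset.sum_add_distrib,
      Finset.sum_range_succ' _ (n + 1)]
    have e2 : ∑ i ∈ Finset.range (n + 1), (q ^ i * qBinom q n i) • (a ^ i * b ^ (n + 1 - i)) =
        ∑ i ∈ Finset.range (n + 1),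
          (q ^ (i + 1) * qBinom q n (i + 1)) • (a ^ (i + 1) * b ^ (n - i)) + b ^ (n + 1) := by
      have := Finset.sum_range_succ' (fun i => (q ^ i * qBinom q n i) • (a ^ i * b ^ (n + 1 - i)))
        (n + 1)
      rw [Finset.sum_range_succ, qBinom_of_lt q n (n + 1) (by omega)] at this
      simpa [qBinom_zero] using this
    rw [e2, ← add_assoc, ← Finset.sum_add_distrib]
    simp [qBinom, add_smul]

/-- For a primitive `m`-th root of unity `q` and `b a = q a b` one has `(a + b)^m = a^m + b^m`. -/
theorem add_pow_of_primitive {q : k} {m : ℕ} [NeZero m] (hq : IsPrimitiveRoot q m) {a b : R}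
    (h : b * a = q • (a * b)) : (a + b) ^ m = a ^ m + b ^ m := by
  obtain ⟨m, rfl⟩ := Nat.exists_eq_succ_of_ne_zero (NeZero.ne m)
  rw [add_pow_of_qcomm h, Finset.sum_range_succ, Finset.sum_range_succ', Finset.sum_eq_zero]
  · simp [qBinom_zero, qBinom_self, add_comm]
  · intro i hi
    rw [qBinom_eq_zero hq _ (by omega) (by have := Finset.mem_range.1 hi; omega), zero_smul]

theorem mul_pow_eq_zero_of_qcomm {q : k} {a b : R} (h : b * a = q • (a * b)) {m : ℕ}
    (ha : a ^ m = 0) : (a * b) ^ m = 0 := by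
  have : ∀ n : ℕ, ∃ c : k, (a * b) ^ n = c • (a ^ n * b ^ n) := by
    intro n
    induction n with
    | zero => exact ⟨1, by simp⟩
    | succ n ih =>
      obtain ⟨c, hc⟩ := ih
      refine ⟨c * q ^ n, ?_⟩
      rw [pow_succ (a * b), hc, smul_mul_assoc, mul_assoc, ← mul_assoc (b ^ n), pow_mul_of_qcomm h,
        smul_mul_assoc, mul_smul_comm, smul_smul, pow_succ a, pow_succ b]
      simp only [mul_assoc]
  obtain ⟨c, hc⟩ := this m
  simp [hc, ha]

end QBinomial

section Generation

variable {k : Type u} [Field k] {A : Type v} [Ring A]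

/-- An algebra map `A → Aᵐᵒᵖ` seen as a linear endomorphism of `A`. -/
def unopLinear [Algebra k A] (S : A →ₐ[k] Aᵐᵒᵖ) : A →ₗ[k] A :=
  (MulOpposite.opLinearEquiv k).symm.toLinearMap ∘ₗ S.toLinearMap

theorem unopLinear_apply [Algebra k A] (S : A →ₐ[k] Aᵐᵒᵖ) (a : A) :
    unopLinear S a = (S a).unop := rfl

theorem unopLinear_mul [Algebra k A] (S : A →ₐ[k] Aᵐᵒᵖ) (a b : A) :
    unopLinear S (a * b) = unopLinear S b * unopLinear S a := by
  simp [unopLinear_apply]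

variable [Bialgebra k A]

/-- The left antipode identity only has to be checked on algebra generators. -/
theorem antipode_left_of_adjoin (S : A →ₐ[k] Aᵐᵒᵖ) {s : Set A} (hs : Algebra.adjoin k s = ⊤)
    (h : ∀ a ∈ s, LinearMap.mul' k A ((unopLinear S).rTensor A (Coalgebra.comul a)) =
      algebraMap k A (Coalgebra.counit a)) :
    LinearMap.mul' k A ∘ₗ (unopLinear S).rTensor A ∘ₗ Coalgebra.comul =
      (Algebra.linearMap k A) ∘ₗ Coalgebra.counit := by
  have key : ∀ t b b', LinearMap.mul' k A ((unopLinear S).rTensor A (t * (b ⊗ₜ[k] b'))) =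
      unopLinear S b * LinearMap.mul' k A ((unopLinear S).rTensor A t) * b' := by
    intro t b b'
    induction t with
    | zero => simp
    | add x y hx hy => simp only [add_mul, map_add, hx, hy, mul_add]
    | tmul x y => simp [unopLinear_mul, mul_assoc]
  ext a
  have ha : a ∈ Algebra.adjoin k s := hs ▸ Algebra.mem_top
  simp only [LinearMap.comp_apply, Algebra.linearMap_apply]
  induction ha using Algebra.adjoin_induction with
  | mem x hx => exact h x hx
  | algebraMap r => simp [Algebra.TensorProduct.algebraMap_apply, unopLinear_apply]
  | add x y _ _ hx hy => simp only [map_add, hx, hy]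
  | mul x y _ _ hx hy =>
    rw [Bialgebra.comul_mul, Bialgebra.counit_mul, map_mul (algebraMap k A), ← hy]
    induction (Coalgebra.comul (R := k) y) with
    | zero => simp
    | add u v hu hv => simp only [mul_add, map_add, hu, hv]
    | tmul b b' =>
      rw [key, hx, ← Algebra.commutes]
      simp [mul_assoc]

/-- The right antipode identity only has to be checked on algebra generators. -/
theorem antipode_right_of_adjoin (S : A →ₐ[k] Aᵐᵒᵖ) {s : Set A} (hs : Algebra.adjoin k s = ⊤)
    (h : ∀ a ∈ s, LinearMap.mul' k A ((unopLinear S).lTensor A (Coalgebra.comul a)) =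
      algebraMap k A (Coalgebra.counit a)) :
    LinearMap.mul' k A ∘ₗ (unopLinear S).lTensor A ∘ₗ Coalgebra.comul =
      (Algebra.linearMap k A) ∘ₗ Coalgebra.counit := by
  have key : ∀ t b b', LinearMap.mul' k A ((unopLinear S).lTensor A ((b ⊗ₜ[k] b') * t)) =
      b * LinearMap.mul' k A ((unopLinear S).lTensor A t) * unopLinear S b' := by
    intro t b b'
    induction t with
    | zero => simp
    | add x y hx hy => simp only [add_mul, map_add, hx, hy, mul_add]
    | tmul x y => simp [unopLinear_mul, mul_assoc]
  ext a
  have ha : a ∈ Algebra.adjoin k s := hs ▸ Algebra.mem_top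
  simp only [LinearMap.comp_apply, Algebra.linearMap_apply]
  induction ha using Algebra.adjoin_induction with
  | mem x hx => exact h x hx
  | algebraMap r => simp [Algebra.TensorProduct.algebraMap_apply, unopLinear_apply]
  | add x y _ _ hx hy => simp only [map_add, hx, hy]
  | mul x y _ _ hx hy =>
    rw [Bialgebra.comul_mul, Bialgebra.counit_mul, map_mul (algebraMap k A), ← hx]
    induction (Coalgebra.comul (R := k) x) with
    | zero => simp
    | add u v hu hv => simp only [add_mul, map_add, hu, hv]
    | tmul b b' =>
      rw [key, hy, ← Algebra.commutes]
      rw [mul_assoc, Algebra.commutes]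
      simp [mul_assoc]

end Generation

/-! ### The Taft algebra -/

/-- Names of the generators of a Taft algebra. -/
inductive TaftGen
  | h
  | x

section Taft

variable {k : Type u} [Field k]

/-- The defining relations `h^m = 1`, `x^m = 0`, `x h = q h x`. -/
inductive TaftRel (m : ℕ) (q : k) : FreeAlgebra k TaftGen → FreeAlgebra k TaftGen → Prop
  | h_pow : TaftRel m q (FreeAlgebra.ι k .h ^ m) 1
  | x_pow : TaftRel m q (FreeAlgebra.ι k .x ^ m) 0
  | xh : TaftRel m q (FreeAlgebra.ι k .x * FreeAlgebra.ι k .h)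
      (q • (FreeAlgebra.ι k .h * FreeAlgebra.ι k .x))

/-- The Taft algebra `T_{m²}(q)`, where `q` is a primitive `m`-th root of unity. -/
def Taft {m : ℕ} {q : k} (_hq : IsPrimitiveRoot q m) : Type u :=
  RingQuot (TaftRel m q)

namespace Taft

variable {m : ℕ} {q : k} (hq : IsPrimitiveRoot q m)

noncomputable instance : Ring (Taft hq) := inferInstanceAs (Ring (RingQuot (TaftRel m q)))

noncomputable instance : Algebra k (Taft hq) :=
  inferInstanceAs (Algebra k (RingQuot (TaftRel m q)))

/-- The image of a generator in the Taft algebra. -/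
noncomputable def gen (i : TaftGen) : Taft hq :=
  RingQuot.mkAlgHom k (TaftRel m q) (FreeAlgebra.ι k i)

/-- The generator `h`. -/
noncomputable abbrev h : Taft hq := gen hq .h

/-- The generator `x`. -/
noncomputable abbrev x : Taft hq := gen hq .x

theorem h_pow : h hq ^ m = 1 := by
  have := RingQuot.mkAlgHom_rel k (TaftRel.h_pow (m := m) (q := q))
  rw [map_pow, map_one] at this
  exact this

theorem x_pow : x hq ^ m = 0 := by
  have := RingQuot.mkAlgHom_rel k (TaftRel.x_pow (m := m) (q := q))
  rw [map_pow, map_zero] at this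
  exact this

theorem xh : x hq * h hq = q • (h hq * x hq) := by
  have := RingQuot.mkAlgHom_rel k (TaftRel.xh (m := m) (q := q))
  rw [map_mul, map_smul, map_mul] at this
  exact this

variable {hq}

/-- The universal property of the Taft algebra. -/
noncomputable def lift {B : Type v} [Ring B] [Algebra k B] (h' x' : B) (h1 : h' ^ m = 1)
    (h2 : x' ^ m = 0) (h3 : x' * h' = q • (h' * x')) : Taft hq →ₐ[k] B :=
  RingQuot.liftAlgHom k ⟨FreeAlgebra.lift k (fun | .h => h' | .x => x'), by
    rintro _ _ (_ | _ | _) <;> simp [h1, h2, h3]⟩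

section
variable {B : Type v} [Ring B] [Algebra k B] (h' x' : B) (h1 : h' ^ m = 1)
    (h2 : x' ^ m = 0) (h3 : x' * h' = q • (h' * x'))

@[simp] theorem lift_h : lift (hq := hq) h' x' h1 h2 h3 (gen hq .h) = h' := by
  unfold lift gen
  exact (RingQuot.liftAlgHom_mkAlgHom_apply ..).trans (by simp)

@[simp] theorem lift_x : lift (hq := hq) h' x' h1 h2 h3 (gen hq .x) = x' := by
  unfold lift gen
  exact (RingQuot.liftAlgHom_mkAlgHom_apply ..).trans (by simp)
end

theorem algHom_ext {B : Type v} [Ring B] [Algebra k B] {f g : Taft hq →ₐ[k] B}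
    (hh : f (h hq) = g (h hq)) (hx : f (x hq) = g (x hq)) : f = g := by
  refine RingQuot.ringQuot_ext' k f g (FreeAlgebra.hom_ext (funext fun i => ?_))
  cases i
  · exact hh
  · exact hx

variable (hq)

theorem adjoin_eq_top : Algebra.adjoin k {h hq, x hq} = ⊤ := by
  let S := Algebra.adjoin k {h hq, x hq}
  let f : Taft hq →ₐ[k] S := lift
    ⟨h hq, Algebra.subset_adjoin (by simp)⟩ ⟨x hq, Algebra.subset_adjoin (by simp)⟩
    (Subtype.ext (h_pow hq)) (Subtype.ext (x_pow hq)) (Subtype.ext (xh hq))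
  have hf : S.val.comp f = AlgHom.id k _ := algHom_ext (by simp [f]) (by simp [f])
  refine eq_top_iff.2 fun a _ => ?_
  have : S.val (f a) = a := DFunLike.congr_fun hf a
  rw [← this]
  exact (f a).2

variable [NeZero m]

/-- `Δ(h) = h ⊗ h`, `Δ(x) = x ⊗ h + 1 ⊗ x`. -/
noncomputable def comulHom : Taft hq →ₐ[k] Taft hq ⊗[k] Taft hq :=
  lift (h hq ⊗ₜ h hq) (x hq ⊗ₜ h hq + 1 ⊗ₜ x hq)
    (by rw [Algebra.TensorProduct.tmul_pow, h_pow]; rfl)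
    (by
      rw [add_pow_of_primitive hq, Algebra.TensorProduct.tmul_pow, Algebra.TensorProduct.tmul_pow,
        x_pow, TensorProduct.zero_tmul, TensorProduct.tmul_zero, add_zero]
      simp [xh])
    (by
      simp only [add_mul, mul_add, Algebra.TensorProduct.tmul_mul_tmul, xh, one_mul, mul_one,
        smul_add, TensorProduct.smul_tmul', TensorProduct.tmul_smul])

/-- `ε(h) = 1`, `ε(x) = 0`. -/
noncomputable def counitHom : Taft hq →ₐ[k] k :=
  lift 1 0 (one_pow _) (zero_pow (NeZero.ne m)) (by simp)

noncomputable instance : Bialgebra k (Taft hq) :=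
  Bialgebra.ofAlgHom (comulHom hq) (counitHom hq)
    (algHom_ext (by simp [comulHom])
      (by simp [comulHom, TensorProduct.tmul_add, TensorProduct.add_tmul, add_assoc,
        Algebra.TensorProduct.one_def]))
    (algHom_ext (by simp [comulHom, counitHom]) (by simp [comulHom, counitHom]))
    (algHom_ext (by simp [comulHom, counitHom]) (by simp [comulHom, counitHom]))

theorem comul_h : Coalgebra.comul (R := k) (h hq) = h hq ⊗ₜ h hq :=
  lift_h ..

theorem comul_x : Coalgebra.comul (R := k) (x hq) = x hq ⊗ₜ h hq + 1 ⊗ₜ x hq :=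
  lift_x ..

theorem counit_h : Coalgebra.counit (R := k) (h hq) = 1 :=
  lift_h ..

theorem counit_x : Coalgebra.counit (R := k) (x hq) = 0 :=
  lift_x ..

theorem h_mul_inv : h hq * h hq ^ (m - 1) = 1 := by
  rw [← pow_succ', Nat.sub_add_cancel (NeZero.one_le), h_pow]

theorem inv_mul_h : h hq ^ (m - 1) * h hq = 1 := by
  rw [← pow_succ, Nat.sub_add_cancel (NeZero.one_le), h_pow]

end Taft
end Taft

/-- Moving an inverse through a commutation relation. -/
theorem inv_qcomm {k : Type u} [Field k] {R : Type v} [Ring R] [Algebra k R] {q : k} {a b g : R}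
    (hab : b * a = q • (a * b)) (h1 : a * g = 1) (h2 : g * a = 1) : g * b = q • (b * g) := by
  calc g * b = g * (b * a) * g := by rw [mul_assoc, mul_assoc, h1, mul_one]
    _ = q • (b * g) := by
      rw [hab, mul_smul_comm, smul_mul_assoc, ← mul_assoc, h2, one_mul]

section Taft
namespace Taft
variable {k : Type u} [Field k] {m : ℕ} {q : k} (hq : IsPrimitiveRoot q m) [NeZero m]

/-- The antipode `S(h) = h⁻¹`, `S(x) = - x h⁻¹`, as an algebra map to the opposite algebra. -/
noncomputable def antipodeHom : Taft hq →ₐ[k] (Taft hq)ᵐᵒᵖ :=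
  lift (MulOpposite.op (h hq ^ (m - 1))) (MulOpposite.op (-(x hq * h hq ^ (m - 1))))
    (by rw [← MulOpposite.op_pow, ← pow_mul, mul_comm, pow_mul, h_pow, one_pow]; rfl)
    (by
      rw [← MulOpposite.op_pow, neg_pow, mul_pow_eq_zero_of_qcomm (q := q)
        (inv_qcomm (xh hq) (h_mul_inv hq) (inv_mul_h hq)) (x_pow hq), mul_zero]; rfl)
    (by
      rw [← MulOpposite.op_mul, ← MulOpposite.op_mul, ← MulOpposite.op_smul, mul_neg, neg_mul,
        ← mul_assoc, inv_qcomm (xh hq) (h_mul_inv hq) (inv_mul_h hq), smul_mul_assoc, smul_neg])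

noncomputable instance : HopfAlgebra k (Taft hq) where
  antipode := unopLinear (antipodeHom hq)
  mul_antipode_rTensor_comul := antipode_left_of_adjoin _ (adjoin_eq_top hq) (by
    rintro a (rfl | rfl)
    · simp [comul_h, counit_h, unopLinear_apply, antipodeHom, inv_mul_h]
    · simp [comul_x, counit_x, unopLinear_apply, antipodeHom, mul_assoc, inv_mul_h])
  mul_antipode_lTensor_comul := antipode_right_of_adjoin _ (adjoin_eq_top hq) (by
    rintro a (rfl | rfl)
    · simp [comul_h, counit_h, unopLinear_apply, antipodeHom, h_mul_inv]
    · simp [comul_x, counit_x, unopLinear_apply, antipodeHom])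

theorem antipode_h : HopfAlgebra.antipode k (h hq) = h hq ^ (m - 1) :=
  congrArg MulOpposite.unop (lift_h ..)

theorem antipode_x : HopfAlgebra.antipode k (x hq) = -(x hq * h hq ^ (m - 1)) :=
  congrArg MulOpposite.unop (lift_x ..)

/-- `S²(h) = h` and `S²(x) = q⁻¹ x`, so the antipode has finite order. -/
theorem antipode_bijective : Function.Bijective (HopfAlgebra.antipode k (A := Taft hq)) := by
  have hm := NeZero.ne m
  let F : Taft hq →ₐ[k] Taft hq := AlgHom.ofLinearMap
    (HopfAlgebra.antipode k ∘ₗ HopfAlgebra.antipode k) (by simp)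
    (fun a b => by simp [HopfAlgebra.antipode_mul_antidistrib])
  have ginv : HopfAlgebra.antipode k (h hq ^ (m - 1)) = h hq := by
    have h1 : HopfAlgebra.antipode k (h hq ^ (m - 1)) * h hq ^ (m - 1) = 1 := by
      have := HopfAlgebra.antipode_mul_antidistrib (R := k) (h hq) (h hq ^ (m - 1))
      rw [h_mul_inv, HopfAlgebra.antipode_one, antipode_h] at this
      exact this.symm
    calc _ = HopfAlgebra.antipode k (h hq ^ (m - 1)) * (h hq ^ (m - 1) * h hq) := by
          rw [inv_mul_h, mul_one]
      _ = h hq := by rw [← mul_assoc, h1, one_mul]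
  have Fh : F (h hq) = h hq := by
    change HopfAlgebra.antipode k (HopfAlgebra.antipode k (h hq)) = _
    rw [antipode_h, ginv]
  have Fx : q • F (x hq) = x hq := by
    change q • HopfAlgebra.antipode k (HopfAlgebra.antipode k (x hq)) = _
    rw [antipode_x, map_neg, HopfAlgebra.antipode_mul_antidistrib, antipode_x, ginv, mul_neg,
      neg_neg, ← mul_assoc, ← smul_mul_assoc, ← xh, mul_assoc, h_mul_inv, mul_one]
  have Fpow : ∀ j, (F ^ j) (h hq) = h hq ∧ q ^ j • (F ^ j) (x hq) = x hq := by
    intro j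
    induction j with
    | zero => simp
    | succ j ih =>
      rw [pow_succ' F]
      refine ⟨by rw [AlgHom.mul_apply, ih.1, Fh], ?_⟩
      rw [AlgHom.mul_apply, pow_succ', mul_smul, ← map_smul F, ih.2, Fx]
  have Fm : F ^ m = 1 := algHom_ext (by simp [(Fpow m).1])
    (by simpa [hq.pow_eq_one] using (Fpow m).2)
  have hF : Function.Bijective F := by
    obtain ⟨j, hj⟩ : ∃ j, m = j + 1 := Nat.exists_eq_succ_of_ne_zero hm
    have hj1 : F ^ (j + 1) = 1 := (congrArg (F ^ ·) hj.symm).trans Fm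
    refine Function.bijective_iff_has_inverse.2 ⟨(F ^ j : Taft hq →ₐ[k] Taft hq), ?_, ?_⟩
    · intro a
      have := DFunLike.congr_fun hj1 a
      rwa [pow_succ] at this
    · intro a
      have := DFunLike.congr_fun hj1 a
      rwa [pow_succ'] at this
  exact ⟨Function.Injective.of_comp (f := HopfAlgebra.antipode k) hF.1,
    Function.Surjective.of_comp (g := HopfAlgebra.antipode k) hF.2⟩

instance : Module.Finite k (Taft hq) := by
  let M : Submodule k (Taft hq) := Submodule.span k
    (Set.range fun p : Fin m × Fin m => h hq ^ (p.1 : ℕ) * x hq ^ (p.2 : ℕ))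
  have mem : ∀ i j : ℕ, h hq ^ i * x hq ^ j ∈ M := by
    intro i j
    rcases Nat.lt_or_ge j m with hj | hj
    · refine Submodule.subset_span ⟨(⟨i % m, Nat.mod_lt _ (NeZero.pos m)⟩, ⟨j, hj⟩), ?_⟩
      simp only
      rw [← pow_mod_orderOf (h hq) i, ← pow_mod_orderOf (h hq) (i % m),
        Nat.mod_mod_of_dvd _ (orderOf_dvd_of_pow_eq_one (h_pow hq))]
    · rw [pow_eq_zero_of_le hj (x_pow hq), mul_zero]
      exact M.zero_mem
  have step : ∀ a b : Taft hq, b ∈ M → a * b ∈ M := by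
    intro a
    have ha : a ∈ Algebra.adjoin k {h hq, x hq} := adjoin_eq_top hq ▸ Algebra.mem_top
    induction ha using Algebra.adjoin_induction with
    | mem a ha =>
      intro b hb
      induction hb using Submodule.span_induction with
      | mem b hb =>
        obtain ⟨⟨i, j⟩, rfl⟩ := hb
        rcases ha with rfl | rfl
        · simp only
          rw [← mul_assoc, ← pow_succ']
          exact mem _ _
        · simp only
          rw [← mul_assoc, mul_pow_of_qcomm (xh hq), smul_mul_assoc, mul_assoc, ← pow_succ']
          exact M.smul_mem _ (mem _ _)
      | zero => rw [mul_zero]; exact M.zero_mem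
      | add b c _ _ hb hc => rw [mul_add]; exact M.add_mem hb hc
      | smul r b _ hb => rw [mul_smul_comm]; exact M.smul_mem _ hb
    | algebraMap r => intro b hb; rw [← Algebra.smul_def]; exact M.smul_mem _ hb
    | add a a' _ _ ha ha' =>
      intro b hb; rw [add_mul]; exact M.add_mem (ha b hb) (ha' b hb)
    | mul a a' _ _ ha ha' =>
      intro b hb; rw [mul_assoc]; exact ha _ (ha' b hb)
  have top : M = ⊤ := eq_top_iff.2 fun a _ => by
    have := step a 1 (by simpa using mem 0 0)
    rwa [mul_one] at this
  exact ⟨top ▸ Submodule.fg_span (Set.finite_range _)⟩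

end Taft
end Taft

/-! ### The bicrossed products of two Taft algebras -/

/-- Names of the generators of a bicrossed product of two Taft algebras. -/
inductive BicrossGen
  | h
  | x
  | H
  | X

section Bicross

variable {k : Type u} [Field k]

/-- The relations satisfied by elements `h, x, H, X` of an algebra: those of the Taft algebras
`T_{m²}(q) = ⟨h, x⟩` and `T_{n²}(q') = ⟨H, X⟩`, and the cross relations
`x H = σ H x`, `h X = σ X h`, `x X = σ X x + α (1 - H h)`, `h H = H h`. -/
structure BicrossRelations (m n : ℕ) (q q' σ α : k) {B : Type v} [Ring B] [Algebra k B]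
    (h x H X : B) : Prop where
  h_pow : h ^ m = 1
  H_pow : H ^ n = 1
  x_pow : x ^ m = 0
  X_pow : X ^ n = 0
  xh : x * h = q • (h * x)
  XH : X * H = q' • (H * X)
  xH : x * H = σ • (H * x)
  hX : h * X = σ • (X * h)
  xX : x * X = σ • (X * x) + α • (1 - H * h)
  hH : h * H = H * h

/-- The same relations as pairs of elements of the free algebra on `h, x, H, X`. -/
inductive BicrossRel (m n : ℕ) (q q' σ α : k) :
    FreeAlgebra k BicrossGen → FreeAlgebra k BicrossGen → Prop
  | h_pow : BicrossRel m n q q' σ α (FreeAlgebra.ι k .h ^ m) 1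
  | H_pow : BicrossRel m n q q' σ α (FreeAlgebra.ι k .H ^ n) 1
  | x_pow : BicrossRel m n q q' σ α (FreeAlgebra.ι k .x ^ m) 0
  | X_pow : BicrossRel m n q q' σ α (FreeAlgebra.ι k .X ^ n) 0
  | xh : BicrossRel m n q q' σ α (FreeAlgebra.ι k .x * FreeAlgebra.ι k .h)
      (q • (FreeAlgebra.ι k .h * FreeAlgebra.ι k .x))
  | XH : BicrossRel m n q q' σ α (FreeAlgebra.ι k .X * FreeAlgebra.ι k .H)
      (q' • (FreeAlgebra.ι k .H * FreeAlgebra.ι k .X))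
  | xH : BicrossRel m n q q' σ α (FreeAlgebra.ι k .x * FreeAlgebra.ι k .H)
      (σ • (FreeAlgebra.ι k .H * FreeAlgebra.ι k .x))
  | hX : BicrossRel m n q q' σ α (FreeAlgebra.ι k .h * FreeAlgebra.ι k .X)
      (σ • (FreeAlgebra.ι k .X * FreeAlgebra.ι k .h))
  | xX : BicrossRel m n q q' σ α (FreeAlgebra.ι k .x * FreeAlgebra.ι k .X)
      (σ • (FreeAlgebra.ι k .X * FreeAlgebra.ι k .x) +
        α • (1 - FreeAlgebra.ι k .H * FreeAlgebra.ι k .h))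
  | hH : BicrossRel m n q q' σ α (FreeAlgebra.ι k .h * FreeAlgebra.ι k .H)
      (FreeAlgebra.ι k .H * FreeAlgebra.ι k .h)

/-- The algebra generated by `h, x, H, X` subject to
`h^m = H^n = 1`, `x^m = X^n = 0`, `x h = q h x`, `X H = q' H X`,
`x H = σ H x`, `h X = σ X h`, `x X = σ X x + α (1 - H h)`, `h H = H h`,
where `q` and `q'` are primitive roots of unity of orders `m` and `n`. -/
def Bicross {m n : ℕ} {q q' : k} (_hq' : IsPrimitiveRoot q' n) (_hq : IsPrimitiveRoot q m)
    (σ α : k) : Type u :=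
  RingQuot (BicrossRel m n q q' σ α)

namespace Bicross

variable {m n : ℕ} {q q' : k} (hq' : IsPrimitiveRoot q' n) (hq : IsPrimitiveRoot q m) (σ α : k)

noncomputable instance : Ring (Bicross hq' hq σ α) :=
  inferInstanceAs (Ring (RingQuot (BicrossRel m n q q' σ α)))

noncomputable instance : Algebra k (Bicross hq' hq σ α) :=
  inferInstanceAs (Algebra k (RingQuot (BicrossRel m n q q' σ α)))

/-- The image of a generator in the bicrossed product. -/
noncomputable def gen (i : BicrossGen) : Bicross hq' hq σ α :=
  RingQuot.mkAlgHom k (BicrossRel m n q q' σ α) (FreeAlgebra.ι k i)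

theorem relations : BicrossRelations m n q q' σ α (gen hq' hq σ α .h) (gen hq' hq σ α .x)
    (gen hq' hq σ α .H) (gen hq' hq σ α .X) := by
  have key : ∀ {a b}, BicrossRel m n q q' σ α a b →
      (RingQuot.mkAlgHom k (BicrossRel m n q q' σ α) a : Bicross hq' hq σ α) =
        RingQuot.mkAlgHom k (BicrossRel m n q q' σ α) b :=
    fun r => RingQuot.mkAlgHom_rel k r
  constructor
  · have := key .h_pow; rw [map_pow, map_one] at this; exact this
  · have := key .H_pow; rw [map_pow, map_one] at this; exact this
  · have := key .x_pow; rw [map_pow, map_zero] at this; exact this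
  · have := key .X_pow; rw [map_pow, map_zero] at this; exact this
  · have := key .xh; rw [map_mul, map_smul, map_mul] at this; exact this
  · have := key .XH; rw [map_mul, map_smul, map_mul] at this; exact this
  · have := key .xH; rw [map_mul, map_smul, map_mul] at this; exact this
  · have := key .hX; rw [map_mul, map_smul, map_mul] at this; exact this
  · have := key .xX
    rw [map_mul, map_add, map_smul, map_smul, map_sub, map_mul, map_mul, map_one] at this
    exact this
  · have := key .hH; rw [map_mul, map_mul] at this; exact this

variable {hq' hq σ α}

/-- The universal property of the bicrossed product. -/
noncomputable def lift {B : Type v} [Ring B] [Algebra k B] {h' x' H' X' : B}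
    (r : BicrossRelations m n q q' σ α h' x' H' X') : Bicross hq' hq σ α →ₐ[k] B :=
  RingQuot.liftAlgHom k
    ⟨FreeAlgebra.lift k (fun | .h => h' | .x => x' | .H => H' | .X => X'), by
      rintro _ _ (_ | _ | _ | _ | _ | _ | _ | _ | _ | _)
      · simpa using r.h_pow
      · simpa using r.H_pow
      · simpa using r.x_pow
      · simpa using r.X_pow
      · simpa using r.xh
      · simpa using r.XH
      · simpa using r.xH
      · simpa using r.hX
      · simpa using r.xX
      · simpa using r.hH⟩

section
variable {B : Type v} [Ring B] [Algebra k B] {h' x' H' X' : B}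
    (r : BicrossRelations m n q q' σ α h' x' H' X')

@[simp] theorem lift_h : lift (hq' := hq') (hq := hq) r (gen hq' hq σ α .h) = h' := by
  unfold lift gen
  exact (RingQuot.liftAlgHom_mkAlgHom_apply ..).trans (by simp)

@[simp] theorem lift_x : lift (hq' := hq') (hq := hq) r (gen hq' hq σ α .x) = x' := by
  unfold lift gen
  exact (RingQuot.liftAlgHom_mkAlgHom_apply ..).trans (by simp)

@[simp] theorem lift_H : lift (hq' := hq') (hq := hq) r (gen hq' hq σ α .H) = H' := by
  unfold lift gen
  exact (RingQuot.liftAlgHom_mkAlgHom_apply ..).trans (by simp)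

@[simp] theorem lift_X : lift (hq' := hq') (hq := hq) r (gen hq' hq σ α .X) = X' := by
  unfold lift gen
  exact (RingQuot.liftAlgHom_mkAlgHom_apply ..).trans (by simp)
end

theorem algHom_ext {B : Type v} [Ring B] [Algebra k B] {f g : Bicross hq' hq σ α →ₐ[k] B}
    (hfg : ∀ i, f (gen hq' hq σ α i) = g (gen hq' hq σ α i)) : f = g :=
  RingQuot.ringQuot_ext' k f g (FreeAlgebra.hom_ext (funext fun i => hfg i))

variable (hq' hq σ α)

theorem adjoin_eq_top : Algebra.adjoin k (Set.range (gen hq' hq σ α)) = ⊤ := by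
  let S := Algebra.adjoin k (Set.range (gen hq' hq σ α))
  have hS : ∀ i, gen hq' hq σ α i ∈ S := fun i => Algebra.subset_adjoin ⟨i, rfl⟩
  have r := relations hq' hq σ α
  let f : Bicross hq' hq σ α →ₐ[k] S := lift (h' := ⟨_, hS .h⟩) (x' := ⟨_, hS .x⟩)
    (H' := ⟨_, hS .H⟩) (X' := ⟨_, hS .X⟩)
    ⟨Subtype.ext r.h_pow, Subtype.ext r.H_pow, Subtype.ext r.x_pow, Subtype.ext r.X_pow,
      Subtype.ext r.xh, Subtype.ext r.XH, Subtype.ext r.xH, Subtype.ext r.hX,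
      Subtype.ext r.xX, Subtype.ext r.hH⟩
  have hf : S.val.comp f = AlgHom.id k _ := algHom_ext (by rintro (_ | _ | _ | _) <;> simp [f])
  refine eq_top_iff.2 fun a _ => ?_
  have : S.val (f a) = a := DFunLike.congr_fun hf a
  rw [← this]
  exact (f a).2

variable [NeZero m] [NeZero n]

theorem comul_relations : BicrossRelations m n q q' σ α
    (gen hq' hq σ α .h ⊗ₜ[k] gen hq' hq σ α .h)
    (gen hq' hq σ α .x ⊗ₜ[k] gen hq' hq σ α .h + 1 ⊗ₜ[k] gen hq' hq σ α .x)
    (gen hq' hq σ α .H ⊗ₜ[k] gen hq' hq σ α .H)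
    (gen hq' hq σ α .X ⊗ₜ[k] gen hq' hq σ α .H + 1 ⊗ₜ[k] gen hq' hq σ α .X) := by
  have r := relations hq' hq σ α
  generalize gen hq' hq σ α .h = h at *
  generalize gen hq' hq σ α .x = x at *
  generalize gen hq' hq σ α .H = H at *
  generalize gen hq' hq σ α .X = X at *
  constructor
  · rw [Algebra.TensorProduct.tmul_pow, r.h_pow]; rfl
  · rw [Algebra.TensorProduct.tmul_pow, r.H_pow]; rfl
  · rw [add_pow_of_primitive hq, Algebra.TensorProduct.tmul_pow, Algebra.TensorProduct.tmul_pow,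
      r.x_pow, TensorProduct.zero_tmul, TensorProduct.tmul_zero, add_zero]
    simp [r.xh]
  · rw [add_pow_of_primitive hq', Algebra.TensorProduct.tmul_pow, Algebra.TensorProduct.tmul_pow,
      r.X_pow, TensorProduct.zero_tmul, TensorProduct.tmul_zero, add_zero]
    simp [r.XH]
  · simp only [add_mul, mul_add, Algebra.TensorProduct.tmul_mul_tmul, r.xh, one_mul, mul_one,
      smul_add, TensorProduct.smul_tmul', TensorProduct.tmul_smul]
  · simp only [add_mul, mul_add, Algebra.TensorProduct.tmul_mul_tmul, r.XH, one_mul, mul_one,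
      smul_add, TensorProduct.smul_tmul', TensorProduct.tmul_smul]
  · simp only [add_mul, mul_add, Algebra.TensorProduct.tmul_mul_tmul, r.xH, r.hH, one_mul, mul_one,
      smul_add, TensorProduct.smul_tmul', TensorProduct.tmul_smul]
  · simp only [add_mul, mul_add, Algebra.TensorProduct.tmul_mul_tmul, r.hX, r.hH, one_mul, mul_one,
      smul_add, TensorProduct.smul_tmul', TensorProduct.tmul_smul]
  · simp only [add_mul, mul_add, Algebra.TensorProduct.tmul_mul_tmul, r.xX, r.hX, r.xH, r.hH,
      one_mul, mul_one, smul_add, TensorProduct.smul_tmul', TensorProduct.tmul_smul,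
      TensorProduct.add_tmul, TensorProduct.tmul_add, TensorProduct.sub_tmul,
      TensorProduct.tmul_sub, smul_sub, Algebra.TensorProduct.one_def]
    abel
  · simp [r.hH]

/-- `Δ(h) = h ⊗ h`, `Δ(H) = H ⊗ H`, `Δ(x) = x ⊗ h + 1 ⊗ x`, `Δ(X) = X ⊗ H + 1 ⊗ X`. -/
noncomputable def comulHom :
    Bicross hq' hq σ α →ₐ[k] Bicross hq' hq σ α ⊗[k] Bicross hq' hq σ α :=
  lift (comul_relations hq' hq σ α)

/-- `ε(h) = ε(H) = 1`, `ε(x) = ε(X) = 0`. -/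
noncomputable def counitHom : Bicross hq' hq σ α →ₐ[k] k :=
  lift (h' := 1) (x' := 0) (H' := 1) (X' := 0)
    ⟨one_pow _, one_pow _, zero_pow (NeZero.ne m), zero_pow (NeZero.ne n), by simp, by simp,
      by simp, by simp, by simp, by simp⟩

noncomputable instance : Bialgebra k (Bicross hq' hq σ α) :=
  Bialgebra.ofAlgHom (comulHom hq' hq σ α) (counitHom hq' hq σ α)
    (algHom_ext (by
      rintro (_ | _ | _ | _) <;> simp [comulHom, TensorProduct.tmul_add, TensorProduct.add_tmul,
        add_assoc, Algebra.TensorProduct.one_def]))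
    (algHom_ext (by rintro (_ | _ | _ | _) <;> simp [comulHom, counitHom]))
    (algHom_ext (by rintro (_ | _ | _ | _) <;> simp [comulHom, counitHom]))

section
local notation "B" => Bicross hq' hq σ α
local notation "γ" => gen hq' hq σ α

theorem comul_h : Coalgebra.comul (R := k) (γ .h) = γ .h ⊗ₜ γ .h := lift_h _

theorem comul_x : Coalgebra.comul (R := k) (γ .x) = γ .x ⊗ₜ γ .h + 1 ⊗ₜ γ .x := lift_x _

theorem comul_H : Coalgebra.comul (R := k) (γ .H) = γ .H ⊗ₜ γ .H := lift_H _

theorem comul_X : Coalgebra.comul (R := k) (γ .X) = γ .X ⊗ₜ γ .H + 1 ⊗ₜ γ .X := lift_X _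

theorem counit_h : Coalgebra.counit (R := k) (γ .h) = 1 := lift_h _

theorem counit_x : Coalgebra.counit (R := k) (γ .x) = 0 := lift_x _

theorem counit_H : Coalgebra.counit (R := k) (γ .H) = 1 := lift_H _

theorem counit_X : Coalgebra.counit (R := k) (γ .X) = 0 := lift_X _

theorem h_mul_inv : γ .h * γ .h ^ (m - 1) = 1 := by
  rw [← pow_succ', Nat.sub_add_cancel NeZero.one_le, (relations hq' hq σ α).h_pow]

theorem inv_mul_h : γ .h ^ (m - 1) * γ .h = 1 := by
  rw [← pow_succ, Nat.sub_add_cancel NeZero.one_le, (relations hq' hq σ α).h_pow]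

theorem H_mul_inv : γ .H * γ .H ^ (n - 1) = 1 := by
  rw [← pow_succ', Nat.sub_add_cancel NeZero.one_le, (relations hq' hq σ α).H_pow]

theorem inv_mul_H : γ .H ^ (n - 1) * γ .H = 1 := by
  rw [← pow_succ, Nat.sub_add_cancel NeZero.one_le, (relations hq' hq σ α).H_pow]

theorem antipode_relations : BicrossRelations m n q q' σ α
    (MulOpposite.op (γ .h ^ (m - 1))) (MulOpposite.op (-(γ .x * γ .h ^ (m - 1))))
    (MulOpposite.op (γ .H ^ (n - 1))) (MulOpposite.op (-(γ .X * γ .H ^ (n - 1)))) := by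
  have r := relations hq' hq σ α
  have g1 := h_mul_inv hq' hq σ α
  have g2 := inv_mul_h hq' hq σ α
  have G1 := H_mul_inv hq' hq σ α
  have G2 := inv_mul_H hq' hq σ α
  have gm : (γ .h ^ (m - 1)) ^ m = 1 := by rw [← pow_mul, mul_comm, pow_mul, r.h_pow, one_pow]
  have Gn : (γ .H ^ (n - 1)) ^ n = 1 := by rw [← pow_mul, mul_comm, pow_mul, r.H_pow, one_pow]
  generalize γ .h ^ (m - 1) = g at *
  generalize γ .H ^ (n - 1) = G at *
  generalize γ .h = h at *
  generalize γ .x = x at *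
  generalize γ .H = H at *
  generalize γ .X = X at *
  have gx : g * x = q • (x * g) := inv_qcomm r.xh g1 g2
  have GX : G * X = q' • (X * G) := inv_qcomm r.XH G1 G2
  have Gx : G * x = σ • (x * G) := inv_qcomm r.xH G1 G2
  have Xg : X * g = σ • (g * X) := by
    calc X * g = g * (h * X) * g := by rw [← mul_assoc g, g2, one_mul]
      _ = σ • (g * X) := by
        rw [r.hX, mul_smul_comm, smul_mul_assoc, mul_assoc, mul_assoc, g1, mul_one]
  have gH : g * H = H * g := by
    simpa using inv_qcomm (q := (1 : k)) (by rw [one_smul, r.hH]) g1 g2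
  have Gg : G * g = g * G := by
    simpa using inv_qcomm (q := (1 : k)) (by rw [one_smul, gH]) G1 G2
  have Hh : g * G * (H * h) = 1 := by
    rw [mul_assoc, ← mul_assoc G, G2, one_mul, g2]
  constructor <;> apply MulOpposite.unop_injective <;>
    simp only [MulOpposite.unop_mul, MulOpposite.unop_pow, MulOpposite.unop_smul,
      MulOpposite.unop_op, MulOpposite.unop_one, MulOpposite.unop_zero, MulOpposite.unop_add,
      MulOpposite.unop_sub, mul_neg, neg_mul, neg_neg]
  · exact gm
  · exact Gn
  · rw [neg_pow, mul_pow_eq_zero_of_qcomm gx r.x_pow, mul_zero]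
  · rw [neg_pow, mul_pow_eq_zero_of_qcomm GX r.X_pow, mul_zero]
  · rw [← mul_assoc, gx, smul_mul_assoc, smul_neg]
  · rw [← mul_assoc, GX, smul_mul_assoc, smul_neg]
  · rw [← mul_assoc, Gx, smul_mul_assoc, mul_assoc, mul_assoc, Gg, smul_neg]
  · rw [mul_assoc, Gg, ← mul_assoc, Xg, smul_mul_assoc, mul_assoc, smul_neg]
  · have e1 : X * G * (x * g) = σ • (X * x * (g * G)) := by
      rw [mul_assoc, ← mul_assoc G, Gx, smul_mul_assoc, mul_smul_comm, mul_assoc x, Gg]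
      simp only [mul_assoc]
    have e2 : σ • (x * g * (X * G)) = x * X * (g * G) := by
      rw [mul_assoc, ← mul_assoc g, ← mul_smul_comm, ← smul_mul_assoc, ← Xg]
      simp only [mul_assoc]
    have e3 : H * h * (g * G) = 1 := by
      rw [mul_assoc, ← mul_assoc h, g1, one_mul, G1]
    rw [e1, e2, r.xX, add_mul, smul_mul_assoc, smul_mul_assoc, sub_mul, e3, add_assoc, ← smul_add]
    simp
  · exact Gg

/-- `S(h) = h⁻¹`, `S(H) = H⁻¹`, `S(x) = - x h⁻¹`, `S(X) = - X H⁻¹`, as an algebra map to the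
opposite algebra. Here `- x h⁻¹ = - q^{m-1} h^{m-1} x` and `- X H⁻¹ = - q'^{n-1} H^{n-1} X`. -/
noncomputable def antipodeHom : B →ₐ[k] Bᵐᵒᵖ :=
  lift (antipode_relations hq' hq σ α)

noncomputable instance : HopfAlgebra k B where
  antipode := unopLinear (antipodeHom hq' hq σ α)
  mul_antipode_rTensor_comul := antipode_left_of_adjoin _ (adjoin_eq_top hq' hq σ α) (by
    rintro _ ⟨_ | _ | _ | _, rfl⟩
    · simp [comul_h, counit_h, unopLinear_apply, antipodeHom, inv_mul_h]
    · simp [comul_x, counit_x, unopLinear_apply, antipodeHom, mul_assoc, inv_mul_h]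
    · simp [comul_H, counit_H, unopLinear_apply, antipodeHom, inv_mul_H]
    · simp [comul_X, counit_X, unopLinear_apply, antipodeHom, mul_assoc, inv_mul_H])
  mul_antipode_lTensor_comul := antipode_right_of_adjoin _ (adjoin_eq_top hq' hq σ α) (by
    rintro _ ⟨_ | _ | _ | _, rfl⟩
    · simp [comul_h, counit_h, unopLinear_apply, antipodeHom, h_mul_inv]
    · simp [comul_x, counit_x, unopLinear_apply, antipodeHom]
    · simp [comul_H, counit_H, unopLinear_apply, antipodeHom, H_mul_inv]
    · simp [comul_X, counit_X, unopLinear_apply, antipodeHom])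

end

end Bicross

/-- The Hopf algebra `T^σ_{n,m}(q', q)` generated by `h, x, H, X` subject to
`h^m = H^n = 1`, `x^m = X^n = 0`, `x h = q h x`, `X H = q' H X`,
`x H = σ H x`, `h X = σ X h`, `x X = σ X x`, `h H = H h`,
with `h, H` group-like, `x` an `(h, 1)`-primitive and `X` an `(H, 1)`-primitive element. -/
abbrev TaftT {m n : ℕ} {q q' : k} (hq' : IsPrimitiveRoot q' n) (hq : IsPrimitiveRoot q m)
    (σ : k) : Type u :=
  Bicross hq' hq σ 0

theorem isPrimitiveRoot_pow_sub_one {n : ℕ} [NeZero n] {q : k} (hq : IsPrimitiveRoot q n) :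
    IsPrimitiveRoot (q ^ (n - 1)) n :=
  hq.pow_of_coprime _ ((Nat.coprime_self_sub_left NeZero.one_le).2 (Nat.coprime_one_left n))

/-- The Hopf algebra `Q^α_n(q)` generated by `h, x, H, X` subject to
`h^n = H^n = 1`, `x^n = X^n = 0`, `x h = q h x`, `X H = q^{n-1} H X`,
`x H = q H x`, `h X = q X h`, `x X - q X x = α (1 - H h)`, `h H = H h`,
with `h, H` group-like, `x` an `(h, 1)`-primitive and `X` an `(H, 1)`-primitive element. -/
abbrev TaftQ {n : ℕ} [NeZero n] {q : k} (hq : IsPrimitiveRoot q n) (α : k) : Type u :=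
  Bicross (isPrimitiveRoot_pow_sub_one hq) hq q α

end Bicross

/-! ### The Drinfeld double -/

section Double

open Coalgebra HopfAlgebra WithConv

variable {k : Type u} [Field k] {H : Type v} [Ring H] [HopfAlgebra k H]

theorem coassoc_four : (TensorProduct.assoc k H H H).symm.toLinearMap.lTensor H ∘ₗ
      (TensorProduct.assoc k H H (H ⊗[k] H)).toLinearMap ∘ₗ TensorProduct.map comul comul ∘ₗ comul =
    (comul.rTensor H).lTensor H ∘ₗ (comul (R := k)).lTensor H ∘ₗ comul := by
  simp only [coassoc_simps]

theorem coassoc_five : (TensorProduct.assoc k H (H ⊗[k] H) H).symm.toLinearMap.lTensor H ∘ₗ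
      ((TensorProduct.assoc k H H H).symm.toLinearMap.lTensor H).lTensor H ∘ₗ
      (TensorProduct.assoc k H H (H ⊗[k] (H ⊗[k] H))).toLinearMap ∘ₗ
      TensorProduct.map comul (TensorProduct.map LinearMap.id comul) ∘ₗ comul.lTensor H ∘ₗ comul =
    ((comul.lTensor H ∘ₗ comul (R := k)).rTensor H).lTensor H ∘ₗ comul.lTensor H ∘ₗ comul := by
  simp only [coassoc_simps]

/-- The antipode is an anti-coalgebra map. -/
theorem comul_comp_antipode : comul ∘ₗ antipode k (A := H) =
    (TensorProduct.comm k H H).toLinearMap ∘ₗ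
      TensorProduct.map (antipode k) (antipode k) ∘ₗ comul := by
  apply WithConv.toConv_injective
  apply left_inv_eq_right_inv (a := toConv (comul (R := k) (A := H)))
  · have h1 := LinearMap.algHom_comp_convMul_distrib (Bialgebra.comulAlgHom k H)
      (toConv (antipode k (A := H))) (toConv LinearMap.id)
    rw [LinearMap.antipode_mul_id] at h1
    apply WithConv.ofConv_injective
    refine Eq.trans h1.symm ?_
    ext a
    simp [LinearMap.convOne_def]
  · let Ω : H ⊗[k] ((H ⊗[k] H) ⊗[k] H) →ₗ[k] H ⊗[k] H :=
      TensorProduct.map (LinearMap.mul' k H ∘ₗ (antipode k).lTensor H)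
        (LinearMap.mul' k H ∘ₗ (antipode k).lTensor H) ∘ₗ
      (TensorProduct.assoc k _ _ _).symm.toLinearMap ∘ₗ
      (TensorProduct.comm k (H ⊗[k] H) H).toLinearMap.lTensor H
    have e1 : LinearMap.mul' k (H ⊗[k] H) ∘ₗ TensorProduct.map LinearMap.id
        ((TensorProduct.comm k H H).toLinearMap ∘ₗ
          TensorProduct.map (antipode k) (antipode k)) =
        Ω ∘ₗ (TensorProduct.assoc k H H H).symm.toLinearMap.lTensor H ∘ₗ
          (TensorProduct.assoc k H H (H ⊗[k] H)).toLinearMap := by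
      ext x y z w
      simp [Ω]
    have e2 : Ω ∘ₗ (comul.rTensor H).lTensor H =
        TensorProduct.map (LinearMap.mul' k H ∘ₗ (antipode k).lTensor H) (Algebra.linearMap k H) ∘ₗ
        (TensorProduct.assoc k _ _ _).symm.toLinearMap ∘ₗ
        (TensorProduct.comm k k H).toLinearMap.lTensor H ∘ₗ (counit.rTensor H).lTensor H := by
      have e3 : LinearMap.mul' k H ∘ₗ (antipode k).lTensor H ∘ₗ comul =
        (Algebra.linearMap k H) ∘ₗ counit := mul_antipode_lTensor_comul
      have e4 : ∀ (x w : H) (t : H ⊗[k] H), Ω (x ⊗ₜ (t ⊗ₜ w)) = (x * antipode k w) ⊗ₜ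
          (LinearMap.mul' k H ((antipode k).lTensor H t)) := by
        intro x w t
        simp [Ω]
      ext x y w
      simp [e4]
    apply WithConv.ofConv_injective
    rw [LinearMap.convMul_def]
    ext a
    have e5 := LinearMap.congr_fun (coassoc_four (k := k) (H := H)) a
    have e6 := LinearMap.congr_fun e1 (TensorProduct.map comul comul (comul a))
    simp only [LinearMap.comp_apply] at e5 e6
    rw [e5] at e6
    have e7 := LinearMap.congr_fun e2 (comul.lTensor H (comul a))
    simp only [LinearMap.comp_apply] at e7
    rw [e7] at e6
    have e8 : ∀ t : H ⊗[k] H, (counit.rTensor H).lTensor H ((comul (R := k)).lTensor H t) =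
        (TensorProduct.mk k k H 1).lTensor H t := by
      intro t
      rw [← LinearMap.comp_apply, ← LinearMap.lTensor_comp, Coalgebra.rTensor_counit_comp_comul]
    rw [e8] at e6
    have e9 : ∀ t : H ⊗[k] H, TensorProduct.map (LinearMap.mul' k H ∘ₗ (antipode k).lTensor H)
        (Algebra.linearMap k H) ((TensorProduct.assoc k _ _ _).symm
        ((TensorProduct.comm k k H).toLinearMap.lTensor H ((TensorProduct.mk k k H 1).lTensor H t)))
        = (LinearMap.mul' k H ((antipode k).lTensor H t)) ⊗ₜ 1 := by
      intro t
      induction t with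
      | zero => simp
      | add x y hx hy => simp only [map_add, hx, hy, TensorProduct.add_tmul]
      | tmul x y => simp
    have e10 : TensorProduct.map LinearMap.id ((TensorProduct.comm k H H).toLinearMap ∘ₗ
          TensorProduct.map (antipode k) (antipode k)) (TensorProduct.map comul comul (comul a)) =
        TensorProduct.map comul ((TensorProduct.comm k H H).toLinearMap ∘ₗ
          TensorProduct.map (antipode k) (antipode k) ∘ₗ comul) (comul a) := by
      rw [← LinearMap.comp_apply, ← TensorProduct.map_comp]
      rfl
    rw [e10] at e6
    refine e6.trans ?_
    refine (e9 _).trans ?_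
    rw [mul_antipode_lTensor_comul_apply]
    rfl

/-- The inverse of the antipode. -/
noncomputable def antipodeInv (hS : Function.Bijective (antipode k (A := H))) : H →ₗ[k] H :=
  (LinearEquiv.ofBijective (antipode k) hS).symm.toLinearMap

section
variable (hS : Function.Bijective (antipode k (A := H)))

theorem antipode_antipodeInv (a : H) : antipode k (antipodeInv hS a) = a :=
  LinearEquiv.apply_symm_apply (LinearEquiv.ofBijective (antipode k) hS) a

theorem antipodeInv_antipode (a : H) : antipodeInv hS (antipode k a) = a :=
  LinearEquiv.symm_apply_apply (LinearEquiv.ofBijective (antipode k) hS) a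

theorem antipodeInv_one : antipodeInv hS 1 = 1 :=
  hS.1 (by rw [antipode_antipodeInv, antipode_one])

theorem antipodeInv_mul (a b : H) :
    antipodeInv hS (a * b) = antipodeInv hS b * antipodeInv hS a :=
  hS.1 (by simp only [antipode_antipodeInv, antipode_mul_antidistrib])

theorem counit_antipodeInv (a : H) : counit (R := k) (antipodeInv hS a) = counit (R := k) a := by
  rw [← counit_antipode, antipode_antipodeInv]

theorem comul_antipodeInv (a : H) : comul (R := k) (antipodeInv hS a) =
    TensorProduct.comm k H H (TensorProduct.map (antipodeInv hS) (antipodeInv hS) (comul a)) := by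
  have h1 := LinearMap.congr_fun (comul_comp_antipode (k := k) (H := H)) (antipodeInv hS a)
  simp only [LinearMap.comp_apply, antipode_antipodeInv] at h1
  rw [h1]
  generalize comul (R := k) (antipodeInv hS a) = t
  induction t with
  | zero => simp
  | add x y hx hy => simp only [map_add]; exact congrArg₂ _ hx hy
  | tmul x y => simp [antipodeInv_antipode]

end

variable (k H) in
/-- The dual space `H*` of a coalgebra with the convolution product
`(f g)(a) = f(a₍₁₎) g(a₍₂₎)` and unit `ε`. -/
abbrev ConvDual : Type (max u v) := WithConv (H →ₗ[k] k)

/-- `Δ²(h) = h₍₁₎ ⊗ h₍₂₎ ⊗ h₍₃₎`. -/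
noncomputable def comulTwo : H →ₐ[k] H ⊗[k] (H ⊗[k] H) :=
  (Algebra.TensorProduct.map (AlgHom.id k H) (Bialgebra.comulAlgHom k H)).comp
    (Bialgebra.comulAlgHom k H)

theorem comulTwo_apply (a : H) : comulTwo (k := k) a = comul.lTensor H (comul a) := rfl

variable (hS : Function.Bijective (antipode k (A := H)))

/-- The functional `f(S⁻¹(y) ? x)`. -/
noncomputable def coadj (x y : H) : ConvDual k H →ₗ[k] ConvDual k H where
  toFun f := toConv (f.ofConv ∘ₗ LinearMap.mulLeft k (antipodeInv hS y) ∘ₗ LinearMap.mulRight k x)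
  map_add' _ _ := rfl
  map_smul' _ _ := rfl

theorem coadj_apply (x y : H) (f : ConvDual k H) (a : H) :
    coadj hS x y f a = f (antipodeInv hS y * (a * x)) := rfl

theorem coadj_add_left (x x' y : H) : coadj hS (x + x') y = coadj hS x y + coadj hS x' y := by
  ext f a
  simp [coadj_apply, mul_add]

theorem coadj_smul_left (c : k) (x y : H) : coadj hS (c • x) y = c • coadj hS x y := by
  ext f a
  simp [coadj_apply]

theorem coadj_add_right (x y y' : H) : coadj hS x (y + y') = coadj hS x y + coadj hS x y' := by
  ext f a
  simp [coadj_apply, add_mul]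

theorem coadj_smul_right (c : k) (x y : H) : coadj hS x (c • y) = c • coadj hS x y := by
  ext f a
  simp [coadj_apply]

theorem coadj_mul (x x' y y' : H) (f : ConvDual k H) :
    coadj hS (x * x') (y * y') f = coadj hS x y (coadj hS x' y' f) := by
  ext a
  simp only [coadj_apply, antipodeInv_mul, mul_assoc]

theorem coadj_one_one (f : ConvDual k H) : coadj hS 1 1 f = f := by
  ext a
  simp only [coadj_apply, antipodeInv_one, one_mul, mul_one]

theorem coadj_unit (x y : H) : coadj hS x y 1 = (counit (R := k) x * counit (R := k) y) • 1 := by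
  ext a
  change counit (R := k) (antipodeInv hS y * (a * x)) =
    (counit (R := k) x * counit (R := k) y) • counit (R := k) a
  simp only [Bialgebra.counit_mul, counit_antipodeInv, smul_eq_mul]
  ring

/-- The linear map `x ⊗ y ↦ (f ↦ f(S⁻¹(y) ? x))`. -/
noncomputable def coadjHom : H ⊗[k] H →ₗ[k] ConvDual k H →ₗ[k] ConvDual k H :=
  TensorProduct.lift (LinearMap.mk₂ k (coadj hS) (coadj_add_left hS) (coadj_smul_left hS)
    (coadj_add_right hS) (coadj_smul_right hS))

theorem coadjHom_tmul (x y : H) : coadjHom hS (x ⊗ₜ y) = coadj hS x y := rfl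

end Double

section Double

open Coalgebra HopfAlgebra WithConv

variable {k : Type u} [Field k] {H : Type v} [Ring H] [HopfAlgebra k H]
  (hS : Function.Bijective (antipode k (A := H)))

/-- `(x₁ ⊗ x₂) ⊗ (y₁ ⊗ y₂) ↦ f(S⁻¹(y₂) ? x₁) g(S⁻¹(y₁) ? x₂)`. -/
noncomputable def coadjMul (f g : ConvDual k H) : (H ⊗[k] H) ⊗[k] (H ⊗[k] H) →ₗ[k] ConvDual k H :=
  LinearMap.mul' k (ConvDual k H) ∘ₗ
    TensorProduct.map ((coadjHom hS).flip f) ((coadjHom hS).flip g) ∘ₗ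
    (TensorProduct.tensorTensorTensorComm k H H H H).toLinearMap ∘ₗ
    (TensorProduct.comm k H H).toLinearMap.lTensor (H ⊗[k] H)

theorem coadjMul_tmul (f g : ConvDual k H) (x₁ x₂ y₁ y₂ : H) :
    coadjMul hS f g ((x₁ ⊗ₜ x₂) ⊗ₜ (y₁ ⊗ₜ y₂)) = coadj hS x₁ y₂ f * coadj hS x₂ y₁ g := rfl

theorem coadj_convMul (x y : H) (f g : ConvDual k H) :
    coadj hS x y (f * g) = coadjMul hS f g (comul x ⊗ₜ comul y) := by
  ext a
  rw [coadj_apply, LinearMap.convMul_apply, Bialgebra.comul_mul, Bialgebra.comul_mul,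
    comul_antipodeInv]
  generalize comul (R := k) x = s
  generalize comul (R := k) y = t
  induction s with
  | zero => simp
  | add s s' hs hs' =>
    simp only [mul_add, map_add, TensorProduct.add_tmul, hs, hs']
    rfl
  | tmul x₁ x₂ =>
    induction t with
    | zero => simp
    | add t t' ht ht' =>
      simp only [add_mul, map_add, TensorProduct.tmul_add, ht, ht']
      rfl
    | tmul y₁ y₂ =>
      rw [coadjMul_tmul, LinearMap.convMul_apply]
      generalize comul (R := k) a = r
      induction r with
      | zero => simp
      | add r r' hr hr' => simp only [add_mul, mul_add, map_add, hr, hr']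
      | tmul a₁ a₂ =>
        simp only [TensorProduct.map_tmul, TensorProduct.comm_tmul,
          Algebra.TensorProduct.tmul_mul_tmul, LinearMap.mul'_apply]
        rfl

/-- The bilinear map `(x ⊗ y ⊗ z, g) ↦ g(S⁻¹(z) ? x) ⊗ y`. -/
noncomputable def twist :
    H ⊗[k] (H ⊗[k] H) →ₗ[k] ConvDual k H →ₗ[k] ConvDual k H ⊗[k] H :=
  LinearMap.mk₂ k (fun u g => TensorProduct.map ((coadjHom hS).flip g) LinearMap.id
    ((TensorProduct.assoc k H H H).symm
      ((TensorProduct.comm k H H).toLinearMap.lTensor H u)))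
    (fun u u' g => by simp only [map_add])
    (fun c u g => by simp only [map_smul])
    (fun u g g' => by simp only [map_add, TensorProduct.map_add_left, LinearMap.add_apply])
    (fun c u g => by simp only [map_smul, TensorProduct.map_smul_left, LinearMap.smul_apply])

theorem twist_tmul (x y z : H) (g : ConvDual k H) :
    twist hS (x ⊗ₜ (y ⊗ₜ z)) g = coadj hS x z g ⊗ₜ y := rfl

/-- The multiplication `(f ⊗ h)(g ⊗ t) = f g(S⁻¹(h₍₃₎) ? h₍₁₎) ⊗ h₍₂₎ t`. -/
noncomputable def doubleMul :
    ConvDual k H ⊗[k] H →ₗ[k] ConvDual k H ⊗[k] H →ₗ[k] ConvDual k H ⊗[k] H :=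
  TensorProduct.lift (LinearMap.mk₂ k
    (fun f h => TensorProduct.lift (LinearMap.mk₂ k
      (fun g t => TensorProduct.map (LinearMap.mul k (ConvDual k H) f) ((LinearMap.mul k H).flip t)
        (twist hS (comulTwo h) g))
      (fun g g' t => by simp only [map_add])
      (fun c g t => by simp only [map_smul])
      (fun g t t' => by simp only [map_add, TensorProduct.map_add_right, LinearMap.add_apply])
      (fun c g t => by
        simp only [map_smul, TensorProduct.map_smul_right, LinearMap.smul_apply])))
    (fun f f' h => by
      ext g t
      simp only [map_add, TensorProduct.map_add_left, LinearMap.add_apply,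
        TensorProduct.AlgebraTensorModule.curry_apply, LinearMap.restrictScalars_self,
        TensorProduct.curry_apply, TensorProduct.lift.tmul, LinearMap.mk₂_apply])
    (fun c f h => by
      ext g t
      simp only [map_smul, TensorProduct.map_smul_left, LinearMap.smul_apply,
        TensorProduct.AlgebraTensorModule.curry_apply, LinearMap.restrictScalars_self,
        TensorProduct.curry_apply, TensorProduct.lift.tmul, LinearMap.mk₂_apply])
    (fun f h h' => by
      ext g t
      simp only [map_add, LinearMap.add_apply,
        TensorProduct.AlgebraTensorModule.curry_apply, LinearMap.restrictScalars_self,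
        TensorProduct.curry_apply, TensorProduct.lift.tmul, LinearMap.mk₂_apply])
    (fun c f h => by
      ext g t
      simp only [map_smul, LinearMap.smul_apply,
        TensorProduct.AlgebraTensorModule.curry_apply, LinearMap.restrictScalars_self,
        TensorProduct.curry_apply, TensorProduct.lift.tmul, LinearMap.mk₂_apply]))

theorem doubleMul_tmul (f g : ConvDual k H) (h t : H) :
    doubleMul hS (f ⊗ₜ h) (g ⊗ₜ t) =
      TensorProduct.map (LinearMap.mul k (ConvDual k H) f) ((LinearMap.mul k H).flip t)
        (twist hS (comulTwo h) g) := rfl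

/-- `g ⊗ t ↦ Σ g(S⁻¹(z) ? x) ⊗ y t` for `u = Σ x ⊗ y ⊗ z`. -/
noncomputable def leftStep (u : H ⊗[k] (H ⊗[k] H)) :
    ConvDual k H ⊗[k] H →ₗ[k] ConvDual k H ⊗[k] H :=
  TensorProduct.lift (LinearMap.mk₂ k
    (fun g t => TensorProduct.map LinearMap.id ((LinearMap.mul k H).flip t) (twist hS u g))
    (fun g g' t => by simp only [map_add])
    (fun c g t => by simp only [map_smul])
    (fun g t t' => by simp only [map_add, TensorProduct.map_add_right, LinearMap.add_apply])
    (fun c g t => by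
      simp only [map_smul, TensorProduct.map_smul_right, LinearMap.smul_apply]))

theorem leftStep_tmul (u : H ⊗[k] (H ⊗[k] H)) (g : ConvDual k H) (t : H) :
    leftStep hS u (g ⊗ₜ t) =
      TensorProduct.map LinearMap.id ((LinearMap.mul k H).flip t) (twist hS u g) := rfl

/-- `f ⊗ h ↦ Σ f g(S⁻¹(h₍₃₎) ? h₍₁₎) ⊗ h₍₂₎`. -/
noncomputable def rightStep (g : ConvDual k H) :
    ConvDual k H ⊗[k] H →ₗ[k] ConvDual k H ⊗[k] H :=
  TensorProduct.lift (LinearMap.mk₂ k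
    (fun f h => TensorProduct.map (LinearMap.mul k (ConvDual k H) f) LinearMap.id
      (twist hS (comulTwo h) g))
    (fun f f' h => by simp only [map_add, TensorProduct.map_add_left, LinearMap.add_apply])
    (fun c f h => by simp only [map_smul, TensorProduct.map_smul_left, LinearMap.smul_apply])
    (fun f h h' => by simp only [map_add, LinearMap.add_apply])
    (fun c f h => by simp only [map_smul, LinearMap.smul_apply]))

theorem rightStep_tmul (f g : ConvDual k H) (h : H) :
    rightStep hS g (f ⊗ₜ h) =
      TensorProduct.map (LinearMap.mul k (ConvDual k H) f) LinearMap.id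
        (twist hS (comulTwo h) g) := rfl

theorem twist_mul (u v : H ⊗[k] (H ⊗[k] H)) (g : ConvDual k H) :
    twist hS (u * v) g = leftStep hS u (twist hS v g) := by
  induction v with
  | zero => simp
  | add v v' hv hv' => simp only [mul_add, map_add, LinearMap.add_apply, hv, hv']
  | tmul p v =>
    induction v with
    | zero => simp
    | add v v' hv hv' =>
      simp only [TensorProduct.tmul_add, mul_add, map_add, LinearMap.add_apply, hv, hv']
    | tmul q r =>
      rw [twist_tmul, leftStep_tmul]
      induction u with
      | zero => simp
      | add u u' hu hu' => simp only [add_mul, map_add, LinearMap.add_apply, hu, hu']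
      | tmul x u =>
        induction u with
        | zero => simp
        | add u u' hu hu' =>
          simp only [TensorProduct.tmul_add, add_mul, map_add, LinearMap.add_apply, hu, hu']
        | tmul y z =>
          rw [Algebra.TensorProduct.tmul_mul_tmul, Algebra.TensorProduct.tmul_mul_tmul, twist_tmul,
            twist_tmul, coadj_mul]
          rfl

/-- `x ⊗ ((p ⊗ (q ⊗ r)) ⊗ z) ↦ f(S⁻¹(z) ? x) g(S⁻¹(r) ? p) ⊗ q`. -/
noncomputable def twistTwo (f g : ConvDual k H) :
    H ⊗[k] ((H ⊗[k] (H ⊗[k] H)) ⊗[k] H) →ₗ[k] ConvDual k H ⊗[k] H :=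
  (LinearMap.mul' k (ConvDual k H)).rTensor H ∘ₗ
    (TensorProduct.assoc k _ _ _).symm.toLinearMap ∘ₗ
    TensorProduct.map ((coadjHom hS).flip f) ((twist hS).flip g) ∘ₗ
    (TensorProduct.assoc k _ _ _).symm.toLinearMap ∘ₗ
    (TensorProduct.comm k _ H).toLinearMap.lTensor H

theorem twistTwo_tmul (f g : ConvDual k H) (x p q r z : H) :
    twistTwo hS f g (x ⊗ₜ ((p ⊗ₜ (q ⊗ₜ r)) ⊗ₜ z)) = (coadj hS x z f * coadj hS p r g) ⊗ₜ q := rfl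

theorem twist_convMul_left (u : H ⊗[k] (H ⊗[k] H)) (f g : ConvDual k H) :
    twist hS u (f * g) = twistTwo hS f g
      ((TensorProduct.assoc k H (H ⊗[k] H) H).symm.toLinearMap.lTensor H
      (((TensorProduct.assoc k H H H).symm.toLinearMap.lTensor H).lTensor H
      ((TensorProduct.assoc k H H (H ⊗[k] (H ⊗[k] H))).toLinearMap
      (TensorProduct.map comul (TensorProduct.map LinearMap.id comul) u)))) := by
  induction u with
  | zero => simp
  | add u u' hu hu' => simp only [map_add, LinearMap.add_apply, hu, hu']
  | tmul x u =>
    induction u with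
    | zero => simp
    | add u u' hu hu' =>
      simp only [TensorProduct.tmul_add, map_add, LinearMap.add_apply, hu, hu']
    | tmul y z =>
      rw [twist_tmul, coadj_convMul, TensorProduct.map_tmul, TensorProduct.map_tmul]
      generalize comul (R := k) x = s
      generalize comul (R := k) z = t
      induction s with
      | zero => simp
      | add s s' hs hs' => simp only [TensorProduct.add_tmul, map_add, hs, hs']
      | tmul x₁ x₂ =>
        induction t with
        | zero => simp
        | add t t' ht ht' =>
          simp only [TensorProduct.add_tmul, TensorProduct.tmul_add, map_add, ht, ht']
        | tmul y₁ y₂ =>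
          rw [coadjMul_tmul, ← twistTwo_tmul]
          rfl

theorem rightStep_twist (u : H ⊗[k] (H ⊗[k] H)) (f g : ConvDual k H) :
    rightStep hS g (twist hS u f) = twistTwo hS f g
      (((comul.lTensor H ∘ₗ comul (R := k)).rTensor H).lTensor H u) := by
  induction u with
  | zero => simp
  | add u u' hu hu' => simp only [map_add, LinearMap.add_apply, hu, hu']
  | tmul x u =>
    induction u with
    | zero => simp
    | add u u' hu hu' =>
      simp only [TensorProduct.tmul_add, map_add, LinearMap.add_apply, hu, hu']
    | tmul y z =>
      rw [twist_tmul, rightStep_tmul, LinearMap.lTensor_tmul,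
        LinearMap.rTensor_tmul, LinearMap.comp_apply, ← comulTwo_apply]
      generalize comulTwo (k := k) y = v
      induction v with
      | zero => simp
      | add v v' hv hv' =>
        simp only [TensorProduct.add_tmul, TensorProduct.tmul_add, map_add, LinearMap.add_apply,
          hv, hv']
      | tmul p v =>
        induction v with
        | zero => simp
        | add v v' hv hv' =>
          simp only [TensorProduct.add_tmul, TensorProduct.tmul_add, map_add, LinearMap.add_apply,
            hv, hv']
        | tmul q r =>
          rw [twistTwo_tmul, twist_tmul]
          rfl

theorem twist_convMul (h : H) (f g : ConvDual k H) :
    twist hS (comulTwo h) (f * g) = rightStep hS g (twist hS (comulTwo h) f) := by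
  have h5 := LinearMap.congr_fun (coassoc_five (k := k) (H := H)) h
  simp only [LinearMap.comp_apply, ← comulTwo_apply] at h5
  rw [twist_convMul_left, h5, rightStep_twist]

theorem twist_comulTwo_one (g : ConvDual k H) :
    twist hS (comulTwo 1) g = g ⊗ₜ 1 := by
  rw [map_one]
  change twist hS (1 ⊗ₜ (1 ⊗ₜ 1)) g = _
  rw [twist_tmul, coadj_one_one]

theorem twist_comulTwo_unit (h : H) :
    twist hS (comulTwo h) 1 = 1 ⊗ₜ h := by
  have h1 : ∀ u : H ⊗[k] (H ⊗[k] H), twist hS u 1 = 1 ⊗ₜ (TensorProduct.rid k H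
      (TensorProduct.lid k (H ⊗[k] k) (TensorProduct.map counit
        (TensorProduct.map LinearMap.id counit) u))) := by
    intro u
    induction u with
    | zero => simp
    | add u u' hu hu' => simp only [map_add, LinearMap.add_apply, hu, hu', TensorProduct.tmul_add]
    | tmul x u =>
      induction u with
      | zero => simp
      | add u u' hu hu' =>
        simp only [TensorProduct.tmul_add, map_add, LinearMap.add_apply, hu, hu']
      | tmul y z =>
        rw [twist_tmul, coadj_unit]
        simp [TensorProduct.smul_tmul, smul_smul]
  rw [h1, comulTwo_apply]
  have h2 : ∀ t : H ⊗[k] H, TensorProduct.map (counit (R := k))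
      (TensorProduct.map LinearMap.id (counit (R := k))) ((comul (R := k)).lTensor H t) =
      ((TensorProduct.mk k H k).flip 1).lTensor k ((counit (R := k)).rTensor H t) := by
    intro t
    induction t with
    | zero => simp
    | add t t' ht ht' => simp only [map_add, ht, ht']
    | tmul x y =>
      have := Coalgebra.lTensor_counit_comul (R := k) y
      simp only [LinearMap.lTensor_tmul, TensorProduct.map_tmul, LinearMap.rTensor_tmul]
      rw [← LinearMap.lTensor_def, this]
      rfl
  rw [h2, Coalgebra.rTensor_counit_comul]
  simp

/-- `w ↦ (f ⊗ 1) w (1 ⊗ t)`. -/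
noncomputable def outer (f : ConvDual k H) (t : H) :
    ConvDual k H ⊗[k] H →ₗ[k] ConvDual k H ⊗[k] H :=
  TensorProduct.map (LinearMap.mul k (ConvDual k H) f) ((LinearMap.mul k H).flip t)

theorem outer_tmul (f g : ConvDual k H) (s t : H) : outer f t (g ⊗ₜ[k] s) = (f * g) ⊗ₜ (s * t) :=
  rfl

theorem doubleMul_tmul' (f g : ConvDual k H) (h t : H) :
    doubleMul hS (f ⊗ₜ h) (g ⊗ₜ t) = outer f t (twist hS (comulTwo h) g) := rfl

theorem outer_outer (f g : ConvDual k H) (s t : H) (w : ConvDual k H ⊗[k] H) :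
    outer f s (outer g t w) = outer (f * g) (t * s) w := by
  induction w with
  | zero => simp only [map_zero]
  | add w w' hw hw' => simp only [map_add, hw, hw']
  | tmul e x => simp only [outer_tmul, mul_assoc]

theorem doubleMul_outer_right (f g : ConvDual k H) (h s : H) (w : ConvDual k H ⊗[k] H) :
    doubleMul hS (f ⊗ₜ h) (outer g s w) =
      outer f s (doubleMul hS (1 ⊗ₜ h) (outer g 1 w)) := by
  induction w with
  | zero => simp only [map_zero]
  | add w w' hw hw' => simp only [map_add, hw, hw']
  | tmul e x =>
    rw [outer_tmul, outer_tmul, doubleMul_tmul', doubleMul_tmul', outer_outer, mul_one, mul_one]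

theorem doubleMul_outer_left (f e : ConvDual k H) (t s : H) (v : ConvDual k H ⊗[k] H) :
    doubleMul hS (outer f t v) (e ⊗ₜ s) =
      outer f s (doubleMul hS (outer 1 t v) (e ⊗ₜ 1)) := by
  induction v with
  | zero => simp only [map_zero, LinearMap.zero_apply]
  | add w w' hw hw' => simp only [map_add, LinearMap.add_apply, hw, hw']
  | tmul g x =>
    rw [outer_tmul, outer_tmul, doubleMul_tmul', doubleMul_tmul', outer_outer, one_mul, one_mul]

theorem doubleMul_leftStep (g : ConvDual k H) (h : H) (w : ConvDual k H ⊗[k] H) :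
    outer g 1 (leftStep hS (comulTwo h) w) = doubleMul hS (g ⊗ₜ h) w := by
  induction w with
  | zero => simp only [map_zero]
  | add w w' hw hw' => simp only [map_add, hw, hw']
  | tmul e t =>
    rw [leftStep_tmul, doubleMul_tmul']
    generalize twist hS (comulTwo h) e = y
    induction y with
    | zero => simp only [map_zero]
    | add y y' hy hy' => simp only [map_add, hy, hy']
    | tmul a b =>
      rw [TensorProduct.map_tmul, outer_tmul, outer_tmul, mul_one]
      rfl

theorem doubleMul_rightStep (e : ConvDual k H) (t : H) (v : ConvDual k H ⊗[k] H) :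
    outer 1 t (rightStep hS e v) = doubleMul hS v (e ⊗ₜ t) := by
  induction v with
  | zero => simp only [map_zero, LinearMap.zero_apply]
  | add w w' hw hw' => simp only [map_add, hw, hw', LinearMap.add_apply]
  | tmul g h =>
    rw [rightStep_tmul, doubleMul_tmul']
    generalize twist hS (comulTwo h) e = y
    induction y with
    | zero => simp only [map_zero]
    | add y y' hy hy' => simp only [map_add, hy, hy']
    | tmul a b =>
      rw [TensorProduct.map_tmul, outer_tmul, outer_tmul, one_mul]
      rfl

theorem doubleMul_key (h t : H) (g e : ConvDual k H) :
    doubleMul hS (outer 1 t (twist hS (comulTwo h) g)) (e ⊗ₜ 1) =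
      doubleMul hS (1 ⊗ₜ h) (outer g 1 (twist hS (comulTwo t) e)) := by
  have hL : ∀ v : ConvDual k H ⊗[k] H, doubleMul hS (outer 1 t v) (e ⊗ₜ 1) =
      doubleMul hS v (twist hS (comulTwo t) e) := by
    intro v
    induction v with
    | zero => simp only [map_zero, LinearMap.zero_apply]
    | add v v' hv hv' => simp only [map_add, LinearMap.add_apply, hv, hv']
    | tmul g' h' =>
      rw [outer_tmul, doubleMul_tmul', map_mul, twist_mul, one_mul, doubleMul_leftStep]
  rw [hL]
  generalize twist hS (comulTwo t) e = w
  induction w with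
  | zero => simp only [map_zero]
  | add w w' hw hw' => simp only [map_add, hw, hw']
  | tmul e' t' =>
    rw [outer_tmul, doubleMul_tmul', twist_convMul, mul_one, doubleMul_rightStep]

theorem doubleMul_assoc (a b c : ConvDual k H ⊗[k] H) :
    doubleMul hS (doubleMul hS a b) c = doubleMul hS a (doubleMul hS b c) := by
  induction a with
  | zero => simp only [map_zero, LinearMap.zero_apply]
  | add a a' ha ha' => simp only [map_add, LinearMap.add_apply, ha, ha']
  | tmul f h =>
  induction b with
  | zero => simp only [map_zero, LinearMap.zero_apply]
  | add b b' hb hb' => simp only [map_add, LinearMap.add_apply, hb, hb']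
  | tmul g t =>
  induction c with
  | zero => simp only [map_zero, LinearMap.zero_apply]
  | add c c' hc hc' => simp only [map_add, hc, hc']
  | tmul e s =>
  rw [doubleMul_tmul', doubleMul_tmul', doubleMul_outer_left, doubleMul_outer_right, doubleMul_key]

theorem doubleMul_one (a : ConvDual k H ⊗[k] H) : doubleMul hS a (1 ⊗ₜ 1) = a := by
  induction a with
  | zero => simp only [map_zero, LinearMap.zero_apply]
  | add a a' ha ha' => simp only [map_add, LinearMap.add_apply, ha, ha']
  | tmul f h => rw [doubleMul_tmul', twist_comulTwo_unit, outer_tmul, mul_one, mul_one]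

theorem one_doubleMul (a : ConvDual k H ⊗[k] H) : doubleMul hS (1 ⊗ₜ 1) a = a := by
  induction a with
  | zero => simp only [map_zero, LinearMap.zero_apply]
  | add a a' ha ha' => simp only [map_add, ha, ha']
  | tmul f h => rw [doubleMul_tmul', twist_comulTwo_one, outer_tmul, one_mul, one_mul]

end Double

section Double

open Coalgebra HopfAlgebra WithConv

variable {k : Type u} [Field k] {H : Type v} [Ring H] [HopfAlgebra k H]

/-- The Drinfeld double `D(H) = (H*)^cop ⋈ H` of a finite-dimensional Hopf algebra `H` with
bijective antipode: the space `H* ⊗ H` with the multiplication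
`(f ⊗ h)(g ⊗ t) = f g(S⁻¹(h₍₃₎) ? h₍₁₎) ⊗ h₍₂₎ t`, the unit `ε ⊗ 1`
and the tensor product coalgebra structure of `(H*)^cop ⊗ H`. -/
def DrinfeldDouble (_hS : Function.Bijective (antipode k (A := H))) : Type (max u v) :=
  ConvDual k H ⊗[k] H

namespace DrinfeldDouble

variable (hS : Function.Bijective (antipode k (A := H)))

noncomputable instance : AddCommGroup (DrinfeldDouble hS) :=
  inferInstanceAs (AddCommGroup (ConvDual k H ⊗[k] H))

noncomputable instance : Module k (DrinfeldDouble hS) :=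
  inferInstanceAs (Module k (ConvDual k H ⊗[k] H))

noncomputable instance : Ring (DrinfeldDouble hS) where
  mul a b := doubleMul hS a b
  one := (1 : ConvDual k H) ⊗ₜ[k] (1 : H)
  mul_assoc := doubleMul_assoc hS
  one_mul := one_doubleMul hS
  mul_one := doubleMul_one hS
  left_distrib a b c := map_add (doubleMul hS a) b c
  right_distrib a b c := LinearMap.map_add₂ (doubleMul hS) a b c
  zero_mul a := LinearMap.map_zero₂ (doubleMul hS) a
  mul_zero a := map_zero (doubleMul hS a)
  zsmul := (· • ·)
  zsmul_zero' a := SubNegMonoid.zsmul_zero' a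
  zsmul_succ' n a := SubNegMonoid.zsmul_succ' n a
  zsmul_neg' n a := SubNegMonoid.zsmul_neg' n a
  neg_add_cancel := neg_add_cancel
  sub_eq_add_neg := sub_eq_add_neg

noncomputable instance : Algebra k (DrinfeldDouble hS) :=
  Algebra.ofModule (fun c a b => LinearMap.map_smul₂ (doubleMul hS) c a b)
    (fun c a b => map_smul (doubleMul hS a) c b)

/-- The element `f ⊗ h` of the Drinfeld double. -/
noncomputable def mk (f : ConvDual k H) (h : H) : DrinfeldDouble hS := f ⊗ₜ[k] h

end DrinfeldDouble

variable [Module.Finite k H]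

variable (k H) in
/-- The comultiplication of `(H*)^cop`: `Δ(f)` is the element `f₍₁₎ ⊗ f₍₂₎` of `H* ⊗ H*` with
`f₍₁₎(a) f₍₂₎(b) = f(b a)` for all `a` and `b`. -/
noncomputable def dualComulCop : ConvDual k H →ₗ[k] ConvDual k H ⊗[k] ConvDual k H :=
  TensorProduct.map (WithConv.linearEquiv k (H →ₗ[k] k)).symm.toLinearMap
      (WithConv.linearEquiv k (H →ₗ[k] k)).symm.toLinearMap ∘ₗ
    (TensorProduct.dualDistribEquiv k H H).symm.toLinearMap ∘ₗ
    (LinearMap.mul' k H ∘ₗ (TensorProduct.comm k H H).toLinearMap).dualMap ∘ₗ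
    (WithConv.linearEquiv k (H →ₗ[k] k)).toLinearMap

/-- The defining property of `dualComulCop`. -/
theorem dualComulCop_apply (f : ConvDual k H) (a b : H) :
    TensorProduct.dualDistrib k H H
      (TensorProduct.map (WithConv.linearEquiv k (H →ₗ[k] k)).toLinearMap
        (WithConv.linearEquiv k (H →ₗ[k] k)).toLinearMap (dualComulCop k H f)) (a ⊗ₜ b) =
      f (b * a) := by
  simp only [dualComulCop, LinearMap.comp_apply]
  rw [← LinearMap.comp_apply (TensorProduct.map _ _) (TensorProduct.map _ _),
    ← TensorProduct.map_comp, LinearEquiv.comp_symm, TensorProduct.map_id, LinearMap.id_apply]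
  have := (TensorProduct.dualDistribEquiv k H H).apply_symm_apply
    ((LinearMap.mul' k H ∘ₗ (TensorProduct.comm k H H).toLinearMap).dualMap f.ofConv)
  exact LinearMap.congr_fun this (a ⊗ₜ b)

noncomputable instance (hS : Function.Bijective (antipode k (A := H))) :
    CoalgebraStruct k (DrinfeldDouble hS) where
  comul := (TensorProduct.tensorTensorTensorComm k (ConvDual k H) (ConvDual k H) H H).toLinearMap ∘ₗ
    TensorProduct.map (dualComulCop k H) comul
  counit := LinearMap.mul' k k ∘ₗ TensorProduct.map
    (LinearMap.applyₗ (1 : H) ∘ₗ (WithConv.linearEquiv k (H →ₗ[k] k)).toLinearMap) counit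

theorem DrinfeldDouble.mk_mul_mk (hS : Function.Bijective (antipode k (A := H)))
    (f g : ConvDual k H) (h t : H) :
    mk hS f h * mk hS g t = TensorProduct.map (LinearMap.mul k (ConvDual k H) f)
      ((LinearMap.mul k H).flip t) (twist hS (comul.lTensor H (comul h)) g) := rfl

theorem DrinfeldDouble.counit_mk (hS : Function.Bijective (antipode k (A := H)))
    (f : ConvDual k H) (h : H) : counit (R := k) (mk hS f h) = f 1 * counit (R := k) h := rfl

end Double

/-! ### Automorphism groups -/

section Aut

/-- Bialgebra automorphisms form a group under composition. As bialgebra maps between Hopf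
algebras commute with the antipodes, these are the Hopf algebra automorphisms. -/
instance bialgEquivGroup {k : Type u} [CommSemiring k] {A : Type v} [Semiring A] [Algebra k A]
    [CoalgebraStruct k A] : Group (A ≃ₐc[k] A) where
  mul f g := g.trans f
  one := BialgEquiv.refl k A
  inv f := f.symm
  mul_assoc _ _ _ := rfl
  one_mul _ := rfl
  mul_one _ := rfl
  inv_mul_cancel f := BialgEquiv.ext fun x => f.symm_apply_apply x

/-- The group of Hopf algebra automorphisms. -/
abbrev HopfAut (k : Type u) [CommSemiring k] (A : Type v) [Semiring A] [Algebra k A]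
    [CoalgebraStruct k A] : Type v :=
  A ≃ₐc[k] A

/-- The action of `ℤ/2` on a group by an automorphism `e` with `e² = 1`, where the class of `1`
acts as `e`. -/
def involutionAction {G : Type u} [Group G] (e : MulAut G) (he : e * e = 1) :
    Multiplicative (ZMod 2) →* MulAut G where
  toFun z := if z = 1 then 1 else e
  map_one' := if_pos rfl
  map_mul' a b := by
    have h2 : ∀ z : Multiplicative (ZMod 2), z = 1 ∨ z = Multiplicative.ofAdd 1 := by decide
    have h3 : (Multiplicative.ofAdd 1 : Multiplicative (ZMod 2)) ≠ 1 := by decide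
    have h4 : (Multiplicative.ofAdd 1 * Multiplicative.ofAdd 1 : Multiplicative (ZMod 2)) = 1 := by
      decide
    rcases h2 a with rfl | rfl <;> rcases h2 b with rfl | rfl <;> simp [h3, h4, he]

/-- The action `τ` of `ℤ/2` on `G × G` with `τ(1)(a, b) = (b, a)`. -/
def swapAction (G : Type u) [Group G] : Multiplicative (ZMod 2) →* MulAut (G × G) :=
  involutionAction (MulEquiv.prodComm : G × G ≃* G × G) (MulEquiv.ext fun _ => rfl)

/-- The action `κ` of `ℤ/2` on a commutative group `G` with `κ(1)(a) = a⁻¹`. -/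
def invAction (G : Type u) [CommGroup G] : Multiplicative (ZMod 2) →* MulAut G :=
  involutionAction (MulEquiv.inv G) (MulEquiv.ext fun a => inv_inv a)

theorem swapAction_one (G : Type u) [Group G] (a b : G) :
    swapAction G (Multiplicative.ofAdd 1) (a, b) = (b, a) := rfl

theorem invAction_one (G : Type u) [CommGroup G] (a : G) :
    invAction G (Multiplicative.ofAdd 1) a = a⁻¹ := rfl

end Aut

end TaftBicrossed

/-! Let A be one of the bicrossed products, T = ⟨h, x⟩ and T' = ⟨H, X⟩. The multiplication T' ⊗ T →
A is an isomorphism of coalgebras (`mulCoalgEquiv`), so the group-likes and skew primitives of A can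
be computed inside two Taft algebras. There they are controlled by the functional ξ dual to x: the
operator a ↦ a₍₁₎ ξ(a₍₂₎) is a q-differentiation with respect to x whose kernel is the group algebra
of h.

The outcome is `Bicross.skewPrimitive_cases`. Let g be group-like and y ≠ 0 a (g, 1)-primitive with
y g = r g y and r ≠ 1. Then g = h, r = q and y is a multiple of x, or g = H, r = q' and y is a
multiple of X. The skew primitives in the span of the group-likes are ruled out because they commute
with g.

A Hopf automorphism sends (h, x) and (H, X) to such pairs, so it either rescales x and X by scalars
a and b or exchanges the two pairs up to scalars (`hopfAut_cases`). Rescaling respects x X = σ X x +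
α (1 - H h) exactly when α a b = α: this is no condition for α = 0, and it says b = a⁻¹ for α = 1.
An exchange forces q = q' and σ² = 1; conversely it exists if in addition σ α = -α. This is
automatic for α = 0. For `TaftQ` one has σ = q and α = 1, so an exchange needs q² = 1, that is n = 2
and q = -1. Conjugating by the exchange swaps a and b, which on the pairs (a, a⁻¹) is inversion.

Injectivity of T' ⊗ T → A is the remaining point. For α = 0 it comes from an explicit representation
on T' ⊗ T. For `TaftQ hq 1` it comes from the Drinfeld double: T' is isomorphic to the dual of T
(`toDual_bijective`), the generators of the double satisfy the relations of `TaftQ hq 1`, and the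
composite T' ⊗ T → D(T) is `toDual` ⊗ id. The same computation shows that `TaftQ hq 1` is isomorphic
to D(T), so the statement on the double follows from the one on `TaftQ`. -/

namespace TaftBicrossed

universe u v w

/-! ### Group-likes and skew primitives of a Taft algebra. -/

namespace Taft

variable {k : Type u} [Field k] {m : ℕ} {q : k} (hq : IsPrimitiveRoot q m)

/-- The subalgebra generated by `h`. -/
noncomputable abbrev torus : Subalgebra k (Taft hq) := Algebra.adjoin k {h hq}

theorem h_mem_torus : h hq ∈ torus hq := Algebra.subset_adjoin rfl

-- The torus is spanned by the powers of h, so linear identities on it need checking only there.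
variable {hq} in
theorem linearMap_eq_of_mem_torus {M : Type w} [AddCommGroup M] [Module k M]
    {L L' : Taft hq →ₗ[k] M} (hL : ∀ i : ℕ, L (h hq ^ i) = L' (h hq ^ i)) {a : Taft hq}
    (ha : a ∈ torus hq) : L a = L' a := by
  rw [torus, Algebra.adjoin_singleton_eq_range_aeval] at ha
  obtain ⟨p, rfl⟩ := ha
  induction p using Polynomial.induction_on' with
  | add p r hp hr => simp only [RingHom.coe_coe, AlgHom.toRingHom_eq_coe, map_add] at *; rw [hp, hr]
  | monomial n c => simp [Polynomial.aeval_monomial, ← Algebra.smul_def, hL]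

variable {hq} in
theorem commute_of_mem_torus {a b : Taft hq} (ha : a ∈ torus hq) (hb : b ∈ torus hq) :
    a * b = b * a := by
  have h1 : a * h hq = h hq * a := linearMap_eq_of_mem_torus
    (L := LinearMap.mulRight k (h hq)) (L' := LinearMap.mulLeft k (h hq))
    (fun i => by simp [← pow_succ, ← pow_succ']) ha
  refine linearMap_eq_of_mem_torus (L := LinearMap.mulLeft k a) (L' := LinearMap.mulRight k a)
    (fun i => ?_) hb
  exact (Commute.pow_right (show Commute a (h hq) from h1) i).eq

section
variable [NeZero m]

theorem h_mul_x_pow (i : ℕ) : h hq * x hq ^ i = q⁻¹ ^ i • (x hq ^ i * h hq) := by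
  refine mul_pow_of_qcomm ?_ i
  rw [xh, smul_smul, inv_mul_cancel₀ (hq.ne_zero (NeZero.ne m)), one_smul]

/-- Sums of this shape contain 1 and are stable under left multiplication by the generators: h
passes x^l at the cost of q^{-l}, and x raises the exponent. Uniqueness of the coefficients is not
needed here; it follows from `eq_zero_of_derivR_stable`. -/
theorem exists_sum_x_pow (a : Taft hq) : ∃ u : ℕ → Taft hq, (∀ l, u l ∈ torus hq) ∧
    a = ∑ l ∈ Finset.range m, x hq ^ l * u l := by
  let P : Taft hq → Prop := fun a => ∃ u : ℕ → Taft hq, (∀ l, u l ∈ torus hq) ∧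
    a = ∑ l ∈ Finset.range m, x hq ^ l * u l
  have hadd : ∀ a b, P a → P b → P (a + b) := by
    rintro _ _ ⟨u, hu, rfl⟩ ⟨v, hv, rfl⟩
    exact ⟨fun l => u l + v l, fun l => add_mem (hu l) (hv l), by
      simp [mul_add, Finset.sum_add_distrib]⟩
  have step : ∀ a b, P b → P (a * b) := by
    intro a
    have ha : a ∈ Algebra.adjoin k {h hq, x hq} := adjoin_eq_top hq ▸ Algebra.mem_top
    induction ha using Algebra.adjoin_induction with
    | mem a ha =>
      rintro _ ⟨u, hu, rfl⟩
      rcases ha with rfl | rfl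
      · refine ⟨fun l => q⁻¹ ^ l • (h hq * u l),
          fun l => Subalgebra.smul_mem _ (mul_mem (h_mem_torus hq) (hu l)) _, ?_⟩
        rw [Finset.mul_sum]
        refine Finset.sum_congr rfl fun l _ => ?_
        rw [← mul_assoc, h_mul_x_pow, smul_mul_assoc, mul_smul_comm, mul_assoc]
      -- Multiplication by x shifts the coefficients by one; the term pushed to exponent m vanishes
      -- since x^m = 0.
      · refine ⟨fun l => Nat.casesOn l 0 u, ?_, ?_⟩
        · rintro (_ | l)
          · exact zero_mem _
          · exact hu l
        · have h1 := Finset.sum_range_succ'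
            (fun l => x hq ^ l * (Nat.casesOn l 0 u : Taft hq)) m
          rw [Finset.sum_range_succ, x_pow, zero_mul, add_zero] at h1
          rw [h1, Finset.mul_sum]
          simp [pow_succ', mul_assoc]
    | algebraMap r =>
      rintro _ ⟨u, hu, rfl⟩
      exact ⟨fun l => r • u l, fun l => Subalgebra.smul_mem _ (hu l) _, by
        simp [← Algebra.smul_def, Finset.smul_sum]⟩
    | add a a' _ _ ha ha' => intro b hb; rw [add_mul]; exact hadd _ _ (ha b hb) (ha' b hb)
    | mul a a' _ _ ha ha' => intro b hb; rw [mul_assoc]; exact ha _ (ha' b hb)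
  have h1 : P 1 := by
    refine ⟨fun l => if l = 0 then 1 else 0, fun l => ?_, ?_⟩
    · dsimp only
      split_ifs
      · exact one_mem _
      · exact zero_mem _
    · simp [NeZero.pos m]
  simpa using step a 1 h1

/-- The character with `h ↦ q⁻¹` and `x ↦ 0`. -/
noncomputable def character : Taft hq →ₐ[k] k :=
  lift q⁻¹ 0 (by rw [inv_pow, hq.pow_eq_one, inv_one]) (zero_pow (NeZero.ne m)) (by simp)

@[simp] theorem character_h : character hq (h hq) = q⁻¹ := lift_h ..

@[simp] theorem character_x : character hq (x hq) = 0 := lift_x ..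

variable (hm : 2 ≤ m)

/-- The representation by upper triangular matrices with `h ↦ diag(q⁻¹, 1)` and
`x ↦ E₁₂`. -/
noncomputable def triangular : Taft hq →ₐ[k] Matrix (Fin 2) (Fin 2) k :=
  lift (Matrix.diagonal ![q⁻¹, 1]) !![0, 1; 0, 0]
    (by
      rw [Matrix.diagonal_pow, ← Matrix.diagonal_one]
      congr 1
      ext i
      fin_cases i <;> simp [hq.pow_eq_one])
    -- The image of x squares to zero, so m ≥ 2 suffices for its m-th power to vanish.
    (pow_eq_zero_of_le hm (by ext i j; fin_cases i <;> fin_cases j <;> simp [pow_two]))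
    (by
      ext i j
      fin_cases i <;> fin_cases j <;> simp [Matrix.diagonal_apply, Matrix.mul_apply,
        hq.ne_zero (NeZero.ne m)])

/-- The diagonal entries of a triangular representation are characters, here χ and ε. The corner
entry is therefore a skew derivation between them, and this is what makes ξ computable on products.
-/
theorem triangular_apply (a : Taft hq) : triangular hq hm a 1 0 = 0 ∧
    triangular hq hm a 0 0 = character hq a ∧
    triangular hq hm a 1 1 = Coalgebra.counit (R := k) a := by
  have ha : a ∈ Algebra.adjoin k {h hq, x hq} := adjoin_eq_top hq ▸ Algebra.mem_top
  induction ha using Algebra.adjoin_induction with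
  | mem a ha =>
    rcases ha with rfl | rfl
    · simp [triangular, counit_h]
    · simp [triangular, counit_x]
  | algebraMap r => simp [Matrix.algebraMap_matrix_apply]
  | add a b _ _ ha hb => simp [ha, hb]
  | mul a b _ _ ha hb => simp [Matrix.mul_apply, Fin.sum_univ_two, ha, hb]

/-- The functional `ξ` with `ξ(a b) = χ(a) ξ(b) + ξ(a) ε(b)`, `ξ(h) = 0` and `ξ(x) = 1`. -/
noncomputable def skewForm : Taft hq →ₗ[k] k :=
  (Matrix.entryLinearMap k k 0 1) ∘ₗ (triangular hq hm).toLinearMap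

theorem skewForm_mul (a b : Taft hq) : skewForm hq hm (a * b) =
    character hq a * skewForm hq hm b + skewForm hq hm a * Coalgebra.counit (R := k) b := by
  have ha := triangular_apply hq hm a
  have hb := triangular_apply hq hm b
  simp [skewForm, Matrix.mul_apply, Fin.sum_univ_two, ha, hb]

@[simp] theorem skewForm_one : skewForm hq hm 1 = 0 := by
  simp [skewForm]

@[simp] theorem skewForm_h : skewForm hq hm (h hq) = 0 := by
  simp [skewForm, triangular]

@[simp] theorem skewForm_x : skewForm hq hm (x hq) = 1 := by
  simp [skewForm, triangular]

@[simp] theorem skewForm_h_pow (i : ℕ) : skewForm hq hm (h hq ^ i) = 0 := by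
  induction i with
  | zero => simp
  | succ i ih => simp [pow_succ, skewForm_mul, ih]

theorem skewForm_of_mem_torus {a : Taft hq} (ha : a ∈ torus hq) : skewForm hq hm a = 0 :=
  linearMap_eq_of_mem_torus (L' := 0) (by simp) ha

omit [NeZero m] in
/-- A functional with `D(a b) = χ(a) D(b) + D(a) ψ(b)` is determined by its values at `h`
and `x`. -/
theorem skew_ext {χ ψ : Taft hq →ₐ[k] k} {D D' : Taft hq →ₗ[k] k}
    (hD : ∀ a b, D (a * b) = χ a * D b + D a * ψ b)
    (hD' : ∀ a b, D' (a * b) = χ a * D' b + D' a * ψ b)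
    (eh : D (h hq) = D' (h hq)) (ex : D (x hq) = D' (x hq)) : D = D' := by
  have one : ∀ E : Taft hq →ₗ[k] k, (∀ a b, E (a * b) = χ a * E b + E a * ψ b) → E 1 = 0 := by
    intro E hE
    have := hE 1 1
    simpa using this
  ext a
  have ha : a ∈ Algebra.adjoin k {h hq, x hq} := adjoin_eq_top hq ▸ Algebra.mem_top
  induction ha using Algebra.adjoin_induction with
  | mem a ha =>
    rcases ha with rfl | rfl
    · exact eh
    · exact ex
  | algebraMap r => rw [Algebra.algebraMap_eq_smul_one, map_smul, map_smul, one D hD, one D' hD']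
  | add a b _ _ ha hb => rw [map_add, map_add, ha, hb]
  | mul a b _ _ ha hb => rw [hD, hD', ha, hb]

/-- The operator `a ↦ a₍₁₎ ξ(a₍₂₎)`. -/
noncomputable def derivR : Taft hq →ₗ[k] Taft hq :=
  (TensorProduct.rid k _).toLinearMap ∘ₗ (skewForm hq hm).lTensor _ ∘ₗ Coalgebra.comul

/-- The operator `a ↦ ξ(a₍₁₎) a₍₂₎`. -/
noncomputable def derivL : Taft hq →ₗ[k] Taft hq :=
  (TensorProduct.lid k _).toLinearMap ∘ₗ (skewForm hq hm).rTensor _ ∘ₗ Coalgebra.comul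

theorem derivR_h_pow (i : ℕ) : derivR hq hm (h hq ^ i) = 0 := by
  simp [derivR, comul_h, Bialgebra.comul_pow]

theorem derivL_h_pow (i : ℕ) : derivL hq hm (h hq ^ i) = 0 := by
  simp [derivL, comul_h, Bialgebra.comul_pow]

theorem derivL_of_mem_torus {a : Taft hq} (ha : a ∈ torus hq) : derivL hq hm a = 0 :=
  linearMap_eq_of_mem_torus (L' := 0) (by simp [derivL_h_pow]) ha

theorem derivR_of_mem_torus {a : Taft hq} (ha : a ∈ torus hq) : derivR hq hm a = 0 :=
  linearMap_eq_of_mem_torus (L' := 0) (by simp [derivR_h_pow]) ha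

theorem derivL_x : derivL hq hm (x hq) = h hq := by
  simp [derivL, comul_x]

/-- Multiply Δ(x) = x ⊗ h + 1 ⊗ x into Δ(a) and use ξ(h b) = q⁻¹ ξ(b) and ξ(x b) = ε(b). The second
term collapses to a by the counit axiom. -/
theorem derivR_x_mul (a : Taft hq) :
    derivR hq hm (x hq * a) = q⁻¹ • (x hq * derivR hq hm a) + a := by
  have h1 : TensorProduct.rid k _ ((Coalgebra.counit (R := k)).lTensor _
      (Coalgebra.comul (R := k) a)) = a := by
    rw [Coalgebra.lTensor_counit_comul]; simp
  refine Eq.trans ?_ (congrArg (q⁻¹ • (x hq * derivR hq hm a) + ·) h1)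
  simp only [derivR, LinearMap.comp_apply, Bialgebra.comul_mul, comul_x]
  induction Coalgebra.comul (R := k) a with
  | zero => simp
  | add s t hs ht => simp only [mul_add, map_add, hs, ht, smul_add]; abel
  | tmul b c => simp [skewForm_mul, add_mul, smul_smul]

/-- The element `1 + r + ⋯ + r^{l-1}` with `r = q⁻¹`. -/
noncomputable def qNat (q : k) (l : ℕ) : k := ∑ i ∈ Finset.range l, q⁻¹ ^ i

omit [NeZero m] in
include hq in
theorem qNat_ne_zero {l : ℕ} (h0 : 0 < l) (hl : l < m) : qNat q l ≠ 0 := by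
  intro h1
  have h2 := mul_geom_sum q⁻¹ l
  rw [show ∑ i ∈ Finset.range l, q⁻¹ ^ i = 0 from h1, mul_zero] at h2
  exact hq.inv.pow_ne_one_of_pos_of_lt (by omega) hl (sub_eq_zero.1 h2.symm)

/-- Over the torus the operator is differentiation in x with q⁻¹-integers in place of integers.
These are nonzero below m, so no power of x below x^m other than x^0 is lost. -/
theorem derivR_x_pow_succ_mul (l : ℕ) {a : Taft hq} (ha : a ∈ torus hq) :
    derivR hq hm (x hq ^ (l + 1) * a) = qNat q (l + 1) • (x hq ^ l * a) := by
  induction l with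
  | zero =>
    rw [zero_add, pow_one, derivR_x_mul, derivR_of_mem_torus hq hm ha]
    simp [qNat]
  | succ l ih =>
    rw [pow_succ', mul_assoc, derivR_x_mul, ih, mul_smul_comm, smul_smul, ← mul_assoc, ← pow_succ']
    rw [show qNat q (l + 1 + 1) = q⁻¹ * qNat q (l + 1) + 1 from geom_sum_succ, add_smul, one_smul]

theorem derivR_sum (l : ℕ) {a : ℕ → Taft hq} (ha : ∀ i, a i ∈ torus hq) :
    derivR hq hm (∑ i ∈ Finset.range (l + 1), x hq ^ i * a i) =
      ∑ i ∈ Finset.range l, x hq ^ i * (qNat q (i + 1) • a (i + 1)) := by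
  rw [Finset.sum_range_succ', map_add, map_sum, pow_zero, one_mul,
    derivR_of_mem_torus hq hm (ha 0), add_zero]
  simp only [derivR_x_pow_succ_mul hq hm _ (ha _), mul_smul_comm]

/-- A property of subspaces stable under `a ↦ a₍₁₎ ξ(a₍₂₎)` and containing no nonzero element
of the torus. -/
theorem eq_zero_of_derivR_stable (V : Submodule k (Taft hq))
    (hV : ∀ a ∈ V, derivR hq hm a ∈ V) (h0 : ∀ a ∈ V, a ∈ torus hq → a = 0)
    {l : ℕ} (hl : l ≤ m) {a : ℕ → Taft hq} (ha : ∀ i, a i ∈ torus hq)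
    (hs : ∑ i ∈ Finset.range l, x hq ^ i * a i ∈ V) : ∀ i < l, a i = 0 := by
  induction l generalizing a with
  | zero => intro i hi; omega
  | succ l ih =>
    -- Differentiating stays in V and shortens the sum by one term, so induction kills every
    -- coefficient except the constant one. What is left of the sum is a torus element of V.
    have h1 := hV _ hs
    rw [derivR_sum hq hm l ha] at h1
    have h2 := ih (by omega) (fun i => Subalgebra.smul_mem _ (ha _) _) h1
    have h3 : ∀ i < l, a (i + 1) = 0 := fun i hi =>
      (smul_eq_zero.1 (h2 i hi)).resolve_left (qNat_ne_zero hq (by omega) (by omega))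
    rw [Finset.sum_range_succ', Finset.sum_eq_zero fun i hi => by
      rw [h3 i (Finset.mem_range.1 hi), mul_zero], zero_add, pow_zero, one_mul] at hs
    rintro (_ | i) hi
    · exact h0 _ hs (ha 0)
    · exact h3 i (by omega)

/-- Expand a in powers of x. With V = ⊥, `eq_zero_of_derivR_stable` says that the powers of x below
x^m are independent over the torus, so a vanishing derivative leaves only the constant term. -/
theorem mem_torus_of_derivR_eq_zero {a : Taft hq} (ha : derivR hq hm a = 0) : a ∈ torus hq := by
  obtain ⟨u, hu, rfl⟩ := exists_sum_x_pow hq a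
  have hl : Finset.range m = Finset.range (m - 1 + 1) := by rw [Nat.sub_add_cancel (by omega)]
  rw [hl] at ha ⊢
  rw [derivR_sum hq hm (m - 1) hu] at ha
  have h1 := eq_zero_of_derivR_stable hq hm ⊥ (by simp) (by simp) (l := m - 1) (by omega)
    (a := fun i => qNat q (i + 1) • u (i + 1)) (fun i => Subalgebra.smul_mem _ (hu _) _)
    (by rw [ha]; exact zero_mem _)
  rw [Finset.sum_range_succ', Finset.sum_eq_zero fun i hi => ?_, zero_add, pow_zero, one_mul]
  · exact hu 0
  · have hi := Finset.mem_range.1 hi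
    rw [(smul_eq_zero.1 (h1 i hi)).resolve_left (qNat_ne_zero hq (by omega) (by omega)),
      mul_zero]

/-- Each application lowers the degree in x, which starts below m. -/
theorem derivR_iterate (a : Taft hq) : (derivR hq hm)^[m] a = 0 := by
  have key : ∀ (l : ℕ) (u : ℕ → Taft hq), (∀ i, u i ∈ torus hq) →
      (derivR hq hm)^[l] (∑ i ∈ Finset.range l, x hq ^ i * u i) = 0 := by
    intro l
    induction l with
    | zero => simp
    | succ l ih =>
      intro u hu
      rw [Function.iterate_succ_apply, derivR_sum hq hm l hu]
      exact ih _ fun i => Subalgebra.smul_mem _ (hu _) _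
  obtain ⟨u, hu, rfl⟩ := exists_sum_x_pow hq a
  exact key m u hu

/-- A group-like g is an eigenvector of `derivR` with eigenvalue ξ(g), and a nilpotent operator has
no nonzero eigenvalue. -/
theorem skewForm_of_isGroupLike {g : Taft hq} (h0 : g ≠ 0)
    (hg : Coalgebra.comul (R := k) g = g ⊗ₜ g) : skewForm hq hm g = 0 := by
  have h1 : derivR hq hm g = skewForm hq hm g • g := by simp [derivR, hg]
  have h2 : ∀ l : ℕ, (derivR hq hm)^[l] g = skewForm hq hm g ^ l • g := by
    intro l
    induction l with
    | zero => simp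
    | succ l ih =>
      rw [Function.iterate_succ_apply', ih, map_smul, h1, smul_smul, pow_succ]
  have h3 := h2 m
  rw [derivR_iterate] at h3
  exact pow_eq_zero_iff (NeZero.ne m) |>.1 ((smul_eq_zero.1 h3.symm).resolve_right h0)

include hm in
theorem mem_torus_of_isGroupLike {g : Taft hq} (h0 : g ≠ 0)
    (hg : Coalgebra.comul (R := k) g = g ⊗ₜ g) : g ∈ torus hq := by
  apply mem_torus_of_derivR_eq_zero hq hm
  simp [derivR, hg, skewForm_of_isGroupLike hq hm h0 hg]

/-- For a group-like `g`, a `(g, 1)`-primitive element differs from a multiple of `x` by an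
element of the torus, and it lies in the torus if `g ≠ h`. -/
theorem skewPrimitive_cases {g y : Taft hq} (h0 : g ≠ 0)
    (hg : Coalgebra.comul (R := k) g = g ⊗ₜ g)
    (hy : Coalgebra.comul (R := k) y = y ⊗ₜ g + 1 ⊗ₜ y) :
    y - skewForm hq hm y • x hq ∈ torus hq ∧ (skewForm hq hm y ≠ 0 → g = h hq) := by
  -- The term y ξ(g) drops out because ξ vanishes on group-likes. Hence y and ξ(y) x have the same
  -- derivative and differ by a torus element.
  have h1 : derivR hq hm y = skewForm hq hm y • 1 := by
    simp [derivR, hy, skewForm_of_isGroupLike hq hm h0 hg]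
  have h2 : derivL hq hm y = skewForm hq hm y • g := by
    simp [derivL, hy]
  have hx : derivR hq hm (x hq) = 1 := by
    simpa [derivR_of_mem_torus hq hm (one_mem _)] using derivR_x_mul hq hm 1
  have h3 : y - skewForm hq hm y • x hq ∈ torus hq := by
    apply mem_torus_of_derivR_eq_zero hq hm
    rw [map_sub, map_smul, h1, hx, sub_self]
  refine ⟨h3, fun hne => ?_⟩
  -- The left-hand operator sends y to ξ(y) g and x to h, and it kills the torus; so ξ(y) (g - h) =
  -- 0.
  have h4 := derivL_of_mem_torus hq hm h3
  rw [map_sub, map_smul, h2, derivL_x, ← smul_sub] at h4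
  exact sub_eq_zero.1 ((smul_eq_zero.1 h4).resolve_left hne)

include hm in
theorem h_ne_one : h hq ≠ 1 := fun h1 => by
  have := congrArg (character hq) h1
  rw [character_h, map_one, inv_eq_one] at this
  exact hq.ne_one (by omega) this

end

end Taft

/-! ### Group-likes and skew primitives in a tensor product of coalgebras. -/

section TensorCoalgebra

open Coalgebra

variable {k : Type u} [Field k] {C : Type v} {D : Type w} [AddCommGroup C] [Module k C]
  [Coalgebra k C] [AddCommGroup D] [Module k D] [Coalgebra k D]

variable (k C D) in
/-- The coalgebra map `c ⊗ d ↦ ε(d) c`. -/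
noncomputable def tensorFst : C ⊗[k] D →ₗc[k] C :=
  (Coalgebra.TensorProduct.rid k k C : C ⊗[k] k →ₗc[k] C).comp
    (Coalgebra.TensorProduct.map (CoalgHom.id k C) (counitCoalgHom k D))

variable (k C D) in
/-- The coalgebra map `c ⊗ d ↦ ε(c) d`. -/
noncomputable def tensorSnd : C ⊗[k] D →ₗc[k] D :=
  (Coalgebra.TensorProduct.lid k D : k ⊗[k] D →ₗc[k] D).comp
    (Coalgebra.TensorProduct.map (counitCoalgHom k C) (CoalgHom.id k D))

@[simp] theorem tensorFst_tmul (c : C) (d : D) :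
    tensorFst k C D (c ⊗ₜ d) = counit (R := k) d • c := rfl

@[simp] theorem tensorSnd_tmul (c : C) (d : D) :
    tensorSnd k C D (c ⊗ₜ d) = counit (R := k) c • d := rfl

/-- The two projections apply the counit to one leg of each factor of Δ(c ⊗ d). Thus z can be
rebuilt from Δ(z), and in particular a group-like is a pure tensor of its projections. -/
theorem map_fst_snd_comul (z : C ⊗[k] D) :
    TensorProduct.map (tensorFst k C D).toLinearMap (tensorSnd k C D).toLinearMap (comul z) =
      z := by
  induction z with
  | zero => simp
  | add z w hz hw => rw [map_add, map_add, hz, hw]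
  | tmul c d =>
    have key : ∀ (s : C ⊗[k] C) (t : D ⊗[k] D),
        TensorProduct.map (tensorFst k C D).toLinearMap (tensorSnd k C D).toLinearMap
          (TensorProduct.AlgebraTensorModule.tensorTensorTensorComm k k k k C C D D (s ⊗ₜ t)) =
        TensorProduct.rid k C (counit.lTensor C s) ⊗ₜ
          TensorProduct.lid k D (counit.rTensor D t) := by
      intro s t
      induction s with
      | zero => simp
      | add s s' hs hs' => simp only [TensorProduct.add_tmul, map_add, hs, hs']
      | tmul s s' =>
        induction t with
        | zero => simp
        | add t t' ht ht' => simp only [TensorProduct.tmul_add, map_add, ht, ht']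
        | tmul t t' =>
          simp [TensorProduct.smul_tmul, TensorProduct.tmul_smul, smul_smul, mul_comm]
    rw [TensorProduct.comul_tmul, key, lTensor_counit_comul, rTensor_counit_comul]
    simp

theorem map_snd_fst_comul (z : C ⊗[k] D) :
    TensorProduct.map (tensorSnd k C D).toLinearMap (tensorFst k C D).toLinearMap (comul z) =
      TensorProduct.comm k C D z := by
  induction z with
  | zero => simp
  | add z w hz hw => rw [map_add, map_add, hz, hw, map_add]
  | tmul c d =>
    have key : ∀ (s : C ⊗[k] C) (t : D ⊗[k] D),
        TensorProduct.map (tensorSnd k C D).toLinearMap (tensorFst k C D).toLinearMap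
          (TensorProduct.AlgebraTensorModule.tensorTensorTensorComm k k k k C C D D (s ⊗ₜ t)) =
        TensorProduct.rid k D (counit.lTensor D t) ⊗ₜ
          TensorProduct.lid k C (counit.rTensor C s) := by
      intro s t
      induction s with
      | zero => simp
      | add s s' hs hs' => simp only [TensorProduct.add_tmul, TensorProduct.tmul_add, map_add, hs, hs']
      | tmul s s' =>
        induction t with
        | zero => simp
        | add t t' ht ht' => simp only [TensorProduct.tmul_add, TensorProduct.add_tmul, map_add, ht, ht']
        | tmul t t' =>
          simp [TensorProduct.smul_tmul, TensorProduct.tmul_smul, smul_smul, mul_comm]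
    rw [TensorProduct.comul_tmul, key, lTensor_counit_comul, rTensor_counit_comul]
    simp

theorem tmul_of_isGroupLike {g : C ⊗[k] D} (hg : IsGroupLikeElem k g) :
    g = tensorFst k C D g ⊗ₜ tensorSnd k C D g := by
  have h1 := map_fst_snd_comul g
  rw [hg.comul_eq_tmul_self] at h1
  exact h1.symm

theorem comul_tensorFst {z g e : C ⊗[k] D} (hz : comul (R := k) z = z ⊗ₜ g + e ⊗ₜ z) :
    comul (R := k) (tensorFst k C D z) = tensorFst k C D z ⊗ₜ tensorFst k C D g +
      tensorFst k C D e ⊗ₜ tensorFst k C D z := by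
  rw [← CoalgHomClass.map_comp_comul_apply, hz]
  simp

theorem comul_tensorSnd {z g e : C ⊗[k] D} (hz : comul (R := k) z = z ⊗ₜ g + e ⊗ₜ z) :
    comul (R := k) (tensorSnd k C D z) = tensorSnd k C D z ⊗ₜ tensorSnd k C D g +
      tensorSnd k C D e ⊗ₜ tensorSnd k C D z := by
  rw [← CoalgHomClass.map_comp_comul_apply, hz]
  simp

theorem eq_of_skewPrimitive {z g e : C ⊗[k] D} (hz : comul (R := k) z = z ⊗ₜ g + e ⊗ₜ z) :
    z = tensorFst k C D z ⊗ₜ tensorSnd k C D g + tensorFst k C D e ⊗ₜ tensorSnd k C D z := by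
  have h1 := map_fst_snd_comul z
  rw [hz] at h1
  simpa using h1.symm

/-- Projecting in the opposite order gives a second formula for z. Equating it with that of
`eq_of_skewPrimitive` constrains the components of z and g. -/
theorem eq_of_skewPrimitive' {z g e : C ⊗[k] D} (hz : comul (R := k) z = z ⊗ₜ g + e ⊗ₜ z) :
    z = tensorFst k C D g ⊗ₜ tensorSnd k C D z + tensorFst k C D z ⊗ₜ tensorSnd k C D e := by
  have h1 := map_snd_fst_comul z
  rw [hz] at h1
  have h2 := congrArg (TensorProduct.comm k C D).symm h1
  simpa using h2.symm

end TensorCoalgebra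

/-! ### The coalgebra map from the tensor product of the two Taft algebras, and its surjectivity. -/

namespace Bicross

open Coalgebra

variable {k : Type u} [Field k] {m n : ℕ} {q q' : k} (hq' : IsPrimitiveRoot q' n)
  (hq : IsPrimitiveRoot q m) (σ α : k)

local notation "γ" => gen hq' hq σ α

/-- The algebra map from `⟨h, x⟩`. -/
noncomputable def inrAlgHom : Taft hq →ₐ[k] Bicross hq' hq σ α :=
  Taft.lift (γ .h) (γ .x) (relations hq' hq σ α).h_pow (relations hq' hq σ α).x_pow
    (relations hq' hq σ α).xh

/-- The algebra map from `⟨H, X⟩`. -/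
noncomputable def inlAlgHom : Taft hq' →ₐ[k] Bicross hq' hq σ α :=
  Taft.lift (γ .H) (γ .X) (relations hq' hq σ α).H_pow (relations hq' hq σ α).X_pow
    (relations hq' hq σ α).XH

variable [NeZero m] [NeZero n]

/-- The embedding of the Taft algebra `⟨h, x⟩`. -/
noncomputable def inr : Taft hq →ₐc[k] Bicross hq' hq σ α :=
  BialgHom.ofAlgHom (inrAlgHom hq' hq σ α)
    (Taft.algHom_ext (by simp [inrAlgHom, Taft.counit_h, counit_h])
      (by simp [inrAlgHom, Taft.counit_x, counit_x]))
    (Taft.algHom_ext (by simp [inrAlgHom, Taft.comul_h, comul_h])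
      (by simp [inrAlgHom, Taft.comul_x, comul_x]))

/-- The embedding of the Taft algebra `⟨H, X⟩`. -/
noncomputable def inl : Taft hq' →ₐc[k] Bicross hq' hq σ α :=
  BialgHom.ofAlgHom (inlAlgHom hq' hq σ α)
    (Taft.algHom_ext (by simp [inlAlgHom, Taft.counit_h, counit_H])
      (by simp [inlAlgHom, Taft.counit_x, counit_X]))
    (Taft.algHom_ext (by simp [inlAlgHom, Taft.comul_h, comul_H])
      (by simp [inlAlgHom, Taft.comul_x, comul_X]))

@[simp] theorem inr_h : inr hq' hq σ α (Taft.h hq) = γ .h := Taft.lift_h ..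
@[simp] theorem inr_x : inr hq' hq σ α (Taft.x hq) = γ .x := Taft.lift_x ..
@[simp] theorem inl_h : inl hq' hq σ α (Taft.h hq') = γ .H := Taft.lift_h ..
@[simp] theorem inl_x : inl hq' hq σ α (Taft.x hq') = γ .X := Taft.lift_x ..

/-- The linear map `a ⊗ b ↦ a b` from the tensor product of the two Taft algebras. -/
noncomputable def mulLinear : Taft hq' ⊗[k] Taft hq →ₗ[k] Bicross hq' hq σ α :=
  LinearMap.mul' k _ ∘ₗ TensorProduct.map (inl hq' hq σ α : Taft hq' →ₗ[k] _)
    (inr hq' hq σ α : Taft hq →ₗ[k] _)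

@[simp] theorem mulLinear_tmul (a : Taft hq') (b : Taft hq) :
    mulLinear hq' hq σ α (a ⊗ₜ b) = inl hq' hq σ α a * inr hq' hq σ α b := rfl

/-- `a ⊗ b ↦ a b` as a coalgebra map. -/
noncomputable def mulCoalgHom : Taft hq' ⊗[k] Taft hq →ₗc[k] Bicross hq' hq σ α where
  toLinearMap := mulLinear hq' hq σ α
  counit_comp := by
    ext a b
    simp [mul_comm]
  map_comp_comul := by
    refine TensorProduct.ext' fun a b => ?_
    simp only [LinearMap.comp_apply, mulLinear_tmul, Bialgebra.comul_mul, TensorProduct.comul_tmul]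
    rw [← CoalgHomClass.map_comp_comul_apply, ← CoalgHomClass.map_comp_comul_apply]
    generalize comul (R := k) a = s
    generalize comul (R := k) b = t
    induction s with
    | zero => simp
    | add s s' hs hs' => simp only [TensorProduct.add_tmul, map_add, hs, hs', add_mul]
    | tmul s s' =>
      induction t with
      | zero => simp
      | add t t' ht ht' => simp only [TensorProduct.tmul_add, map_add, ht, ht', mul_add]
      | tmul t t' => simp

theorem exists_h_mul_inl (a : Taft hq') : ∃ b, γ .h * inl hq' hq σ α a =
    inl hq' hq σ α b * γ .h := by
  have r := relations hq' hq σ α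
  have ha : a ∈ Algebra.adjoin k {Taft.h hq', Taft.x hq'} :=
    Taft.adjoin_eq_top hq' ▸ Algebra.mem_top
  induction ha using Algebra.adjoin_induction with
  | mem a ha =>
    rcases ha with rfl | rfl
    · exact ⟨Taft.h hq', by simp [r.hH]⟩
    · exact ⟨σ • Taft.x hq', by simp [r.hX]⟩
  | algebraMap c => exact ⟨algebraMap k _ c, by simp [Algebra.algebraMap_eq_smul_one]⟩
  | add a b _ _ ha hb =>
    obtain ⟨a', ha⟩ := ha
    obtain ⟨b', hb⟩ := hb
    exact ⟨a' + b', by simp [mul_add, add_mul, ha, hb]⟩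
  | mul a b _ _ ha hb =>
    obtain ⟨a', ha⟩ := ha
    obtain ⟨b', hb⟩ := hb
    exact ⟨a' * b', by rw [map_mul, ← mul_assoc, ha, mul_assoc, hb, map_mul, mul_assoc]⟩

/-- Moving x past X leaves the correction α (1 - H h), which contributes a term free of h and x and
a term ending in h. Since h also moves past T', this shape is stable under products in a. -/
theorem exists_x_mul_inl (a : Taft hq') : ∃ b c d, γ .x * inl hq' hq σ α a =
    inl hq' hq σ α b * γ .x + inl hq' hq σ α c + inl hq' hq σ α d * γ .h := by
  have r := relations hq' hq σ α
  have ha : a ∈ Algebra.adjoin k {Taft.h hq', Taft.x hq'} :=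
    Taft.adjoin_eq_top hq' ▸ Algebra.mem_top
  induction ha using Algebra.adjoin_induction with
  | mem a ha =>
    rcases ha with rfl | rfl
    · exact ⟨σ • Taft.h hq', 0, 0, by simp [r.xH]⟩
    · refine ⟨σ • Taft.x hq', α • 1, -(α • Taft.h hq'), ?_⟩
      simp [r.xX, sub_eq_add_neg, add_assoc]
  | algebraMap c =>
    exact ⟨algebraMap k _ c, 0, 0, by
      simp [Algebra.algebraMap_eq_smul_one]⟩
  | add a b _ _ ha hb =>
    obtain ⟨a₁, a₂, a₃, ha⟩ := ha
    obtain ⟨b₁, b₂, b₃, hb⟩ := hb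
    refine ⟨a₁ + b₁, a₂ + b₂, a₃ + b₃, ?_⟩
    simp only [map_add, mul_add, add_mul, ha, hb]
    abel
  | mul a b _ _ ha hb =>
    obtain ⟨a₁, a₂, a₃, ha⟩ := ha
    obtain ⟨b₁, b₂, b₃, hb⟩ := hb
    obtain ⟨b', hb'⟩ := exists_h_mul_inl hq' hq σ α b
    refine ⟨a₁ * b₁, a₁ * b₂ + a₂ * b, a₁ * b₃ + a₃ * b', ?_⟩
    rw [map_mul, ← mul_assoc, ha, add_mul, add_mul, mul_assoc, hb, mul_assoc (inl _ _ _ _ a₃), hb']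
    simp only [map_mul, map_add, mul_add, add_mul, mul_assoc]
    abel

/-- The image contains 1 and is stable under left multiplication by the four generators, by the two
straightening lemmas. -/
theorem mulLinear_surjective : Function.Surjective (mulLinear hq' hq σ α) := by
  let M := LinearMap.range (mulLinear hq' hq σ α)
  have hM : ∀ a b, inl hq' hq σ α a * inr hq' hq σ α b ∈ M := fun a b => ⟨a ⊗ₜ b, rfl⟩
  have step : ∀ w v : Bicross hq' hq σ α, v ∈ M → w * v ∈ M := by
    intro w
    have hw : w ∈ Algebra.adjoin k (Set.range γ) := adjoin_eq_top hq' hq σ α ▸ Algebra.mem_top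
    induction hw using Algebra.adjoin_induction with
    | mem w hw =>
      rintro _ ⟨z, rfl⟩
      obtain ⟨i, rfl⟩ := hw
      induction z with
      | zero => simp
      | add z z' hz hz' => rw [map_add, mul_add]; exact M.add_mem hz hz'
      | tmul a b =>
        rw [mulLinear_tmul, ← mul_assoc]
        cases i with
        | h =>
          obtain ⟨a', ha⟩ := exists_h_mul_inl hq' hq σ α a
          rw [ha, mul_assoc, ← inr_h, ← map_mul]
          exact hM _ _
        | x =>
          obtain ⟨a₁, a₂, a₃, ha⟩ := exists_x_mul_inl hq' hq σ α a
          rw [ha, add_mul, add_mul, mul_assoc, mul_assoc, ← inr_h, ← inr_x, ← map_mul, ← map_mul]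
          exact M.add_mem (M.add_mem (hM _ _) (hM _ _)) (hM _ _)
        | H => rw [← inl_h, ← map_mul]; exact hM _ _
        | X => rw [← inl_x, ← map_mul]; exact hM _ _
    | algebraMap c => intro v hv; rw [← Algebra.smul_def]; exact M.smul_mem _ hv
    | add a a' _ _ ha ha' => intro b hb; rw [add_mul]; exact M.add_mem (ha b hb) (ha' b hb)
    | mul a a' _ _ ha ha' => intro b hb; rw [mul_assoc]; exact ha _ (ha' b hb)
  intro w
  have h1 := step w 1 (by simpa using hM 1 1)
  rwa [mul_one] at h1

theorem inl_mul_inr_comm {a : Taft hq'} {b : Taft hq} (ha : a ∈ Taft.torus hq')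
    (hb : b ∈ Taft.torus hq) :
    inl hq' hq σ α a * inr hq' hq σ α b = inr hq' hq σ α b * inl hq' hq σ α a := by
  refine Taft.linearMap_eq_of_mem_torus
    (L := LinearMap.mulLeft k (inl hq' hq σ α a) ∘ₗ (inr hq' hq σ α : Taft hq →ₗ[k] _))
    (L' := LinearMap.mulRight k (inl hq' hq σ α a) ∘ₗ (inr hq' hq σ α : Taft hq →ₗ[k] _))
    (fun i => ?_) hb
  refine Taft.linearMap_eq_of_mem_torus
    (L := LinearMap.mulRight k (inr hq' hq σ α (Taft.h hq ^ i)) ∘ₗ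
      (inl hq' hq σ α : Taft hq' →ₗ[k] _))
    (L' := LinearMap.mulLeft k (inr hq' hq σ α (Taft.h hq ^ i)) ∘ₗ
      (inl hq' hq σ α : Taft hq' →ₗ[k] _)) (fun j => ?_) ha
  have h1 : Commute (γ .h) (γ .H) := (relations hq' hq σ α).hH
  simpa using (h1.pow_pow i j).eq.symm

/-- Comparing both sides of `hc` and cancelling h gives β (q - r) x + (1 - r) v = 0. The functional
L isolates the first coefficient, so r = q, and then r ≠ 1 kills v. It serves to remove the toral
part v of a skew primitive element. -/
theorem eq_zero_of_qcomm {R : Type v} [Ring R] [Algebra k R] {q r β : k} {h g x v : R}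
    (hg : g * h = 1) (hx : x * h = q • (h * x)) (hv : v * h = h * v) (L : R →ₗ[k] k)
    (Lx : L x = 1) (Lv : L v = 0) (hβ : β ≠ 0) (hr : r ≠ 1)
    (hc : (β • x + v) * h = r • (h * (β • x + v))) : r = q ∧ v = 0 := by
  have h1 : h * ((β * (q - r)) • x + (1 - r) • v) = 0 := by
    rw [add_mul, smul_mul_assoc, hx, hv, mul_add, mul_smul_comm] at hc
    rw [mul_add, mul_smul_comm, mul_smul_comm]
    rw [← sub_eq_zero] at hc
    rw [← hc]
    module
  have h2 : (β * (q - r)) • x + (1 - r) • v = 0 := by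
    have := congrArg (g * ·) h1
    simpa [← mul_assoc, hg] using this
  have h3 := congrArg L h2
  rw [map_add, map_smul, map_smul, Lx, Lv, map_zero, smul_zero, add_zero, smul_eq_mul, mul_one]
    at h3
  have h4 : r = q := (sub_eq_zero.1 ((mul_eq_zero.1 h3).resolve_left hβ)).symm
  refine ⟨h4, ?_⟩
  rw [h4, sub_self, mul_zero, zero_smul, zero_add, ← h4] at h2
  exact (smul_eq_zero.1 h2).resolve_left (sub_ne_zero.2 hr.symm)

end Bicross

/-! ### Classification of the relevant skew primitive elements of a bicrossed product. -/

namespace Bicross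

open Coalgebra

section
variable {k : Type u} [Field k] {m n : ℕ} {q q' : k} {hq' : IsPrimitiveRoot q' n}
  {hq : IsPrimitiveRoot q m} {σ α : k} [NeZero m] [NeZero n]

local notation "γ" => gen hq' hq σ α

/-- If products of the basis elements of the two Taft algebras are linearly independent, the
multiplication is an isomorphism of coalgebras. -/
noncomputable def mulCoalgEquiv (hi : Function.Injective (mulLinear hq' hq σ α)) :
    Taft hq' ⊗[k] Taft hq ≃ₗc[k] Bicross hq' hq σ α :=
  CoalgEquiv.ofBijective (f := mulCoalgHom hq' hq σ α) ⟨hi, mulLinear_surjective hq' hq σ α⟩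

theorem mulCoalgEquiv_apply (hi : Function.Injective (mulLinear hq' hq σ α))
    (z : Taft hq' ⊗[k] Taft hq) : mulCoalgEquiv hi z = mulLinear hq' hq σ α z := rfl

/-- The functional `a b ↦ ε(a) ξ(b)`. -/
noncomputable def skewFormR (hm : 2 ≤ m) (hi : Function.Injective (mulLinear hq' hq σ α)) :
    Bicross hq' hq σ α →ₗ[k] k :=
  Taft.skewForm hq hm ∘ₗ (tensorSnd k (Taft hq') (Taft hq)).toLinearMap ∘ₗ
    (mulCoalgEquiv hi).symm.toLinearEquiv.toLinearMap

/-- The functional `a b ↦ ξ(a) ε(b)`. -/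
noncomputable def skewFormL (hn : 2 ≤ n) (hi : Function.Injective (mulLinear hq' hq σ α)) :
    Bicross hq' hq σ α →ₗ[k] k :=
  Taft.skewForm hq' hn ∘ₗ (tensorFst k (Taft hq') (Taft hq)).toLinearMap ∘ₗ
    (mulCoalgEquiv hi).symm.toLinearEquiv.toLinearMap

theorem skewFormR_mul (hm : 2 ≤ m) (hi : Function.Injective (mulLinear hq' hq σ α))
    (a : Taft hq') (b : Taft hq) :
    skewFormR hm hi (inl hq' hq σ α a * inr hq' hq σ α b) =
      counit (R := k) a * Taft.skewForm hq hm b := by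
  have h1 : (mulCoalgEquiv hi).symm (inl hq' hq σ α a * inr hq' hq σ α b) = a ⊗ₜ b :=
    (mulCoalgEquiv hi).symm_apply_apply (a ⊗ₜ b)
  change Taft.skewForm hq hm (tensorSnd k (Taft hq') (Taft hq) ((mulCoalgEquiv hi).symm _)) = _
  rw [h1, tensorSnd_tmul, map_smul, smul_eq_mul]

theorem skewFormL_mul (hn : 2 ≤ n) (hi : Function.Injective (mulLinear hq' hq σ α))
    (a : Taft hq') (b : Taft hq) :
    skewFormL hn hi (inl hq' hq σ α a * inr hq' hq σ α b) =
      Taft.skewForm hq' hn a * counit (R := k) b := by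
  have h1 : (mulCoalgEquiv hi).symm (inl hq' hq σ α a * inr hq' hq σ α b) = a ⊗ₜ b :=
    (mulCoalgEquiv hi).symm_apply_apply (a ⊗ₜ b)
  change Taft.skewForm hq' hn (tensorFst k (Taft hq') (Taft hq) ((mulCoalgEquiv hi).symm _)) = _
  rw [h1, tensorFst_tmul, map_smul, smul_eq_mul, mul_comm]

theorem skewFormR_inr (hm : 2 ≤ m) (hi : Function.Injective (mulLinear hq' hq σ α))
    (b : Taft hq) : skewFormR hm hi (inr hq' hq σ α b) = Taft.skewForm hq hm b := by
  simpa using skewFormR_mul hm hi 1 b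

theorem skewFormR_inl (hm : 2 ≤ m) (hi : Function.Injective (mulLinear hq' hq σ α))
    (a : Taft hq') : skewFormR hm hi (inl hq' hq σ α a) = 0 := by
  simpa using skewFormR_mul hm hi a 1

theorem skewFormL_inl (hn : 2 ≤ n) (hi : Function.Injective (mulLinear hq' hq σ α))
    (a : Taft hq') : skewFormL hn hi (inl hq' hq σ α a) = Taft.skewForm hq' hn a := by
  simpa using skewFormL_mul hn hi a 1

/-- A nonzero `(g, 1)`-primitive element which does not commute with `g` but `r`-commutes with
it is a multiple of `x` or of `X`. -/
theorem skewPrimitive_cases (hm : 2 ≤ m) (hn : 2 ≤ n)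
    (hi : Function.Injective (mulLinear hq' hq σ α)) {g y : Bicross hq' hq σ α} {r : k}
    (hg : IsGroupLikeElem k g) (hy : comul (R := k) y = y ⊗ₜ g + 1 ⊗ₜ y) (hy0 : y ≠ 0)
    (hr : r ≠ 1) (hc : y * g = r • (g * y)) :
    (g = γ .h ∧ r = q ∧ ∃ β : k, y = β • γ .x) ∨ (g = γ .H ∧ r = q' ∧ ∃ β : k, y = β • γ .X) := by
  have hr' := relations hq' hq σ α
  let e := mulCoalgEquiv hi
  have heg : IsGroupLikeElem k (e.symm g) := hg.map e.symm
  have hey : comul (R := k) (e.symm y) = e.symm y ⊗ₜ e.symm g + (1 : Taft hq') ⊗ₜ (1 : Taft hq) ⊗ₜ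
      e.symm y := by
    have h1 : e.symm (1 : Bicross hq' hq σ α) = (1 : Taft hq') ⊗ₜ[k] (1 : Taft hq) := by
      have h2 : e ((1 : Taft hq') ⊗ₜ[k] (1 : Taft hq)) = 1 := by simp [e, mulCoalgEquiv_apply]
      rw [← h2, CoalgEquiv.symm_apply_apply]
    rw [← CoalgHomClass.map_comp_comul_apply, hy, map_add, TensorProduct.map_tmul,
      TensorProduct.map_tmul]
    simp only [LinearMap.coe_coe, h1]
  have e1 := tmul_of_isGroupLike heg
  have hc' := heg.map (tensorFst k (Taft hq') (Taft hq))
  have hd' := heg.map (tensorSnd k (Taft hq') (Taft hq))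
  have e2 := eq_of_skewPrimitive hey
  have e3 := eq_of_skewPrimitive' hey
  have ha' := comul_tensorFst hey
  have hb' := comul_tensorSnd hey
  simp only [tensorFst_tmul, tensorSnd_tmul, Bialgebra.counit_one, one_smul] at e2 e3 ha' hb'
  have eg : g = inl hq' hq σ α (tensorFst k _ _ (e.symm g)) *
      inr hq' hq σ α (tensorSnd k _ _ (e.symm g)) := by
    have := congrArg e e1
    rwa [CoalgEquiv.apply_symm_apply] at this
  have ey : y = inl hq' hq σ α (tensorFst k _ _ (e.symm g)) *
      inr hq' hq σ α (tensorSnd k _ _ (e.symm y)) +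
      inl hq' hq σ α (tensorFst k _ _ (e.symm y)) := by
    have := congrArg e e3
    rw [CoalgEquiv.apply_symm_apply, map_add] at this
    simpa [e, mulCoalgEquiv_apply] using this
  -- With g = c ⊗ d and components a, b of y, the two formulas read a ⊗ d + 1 ⊗ b = c ⊗ b + a ⊗ 1.
  have e4 := e2.symm.trans e3
  generalize tensorFst k _ _ (e.symm g) = c at *
  generalize tensorSnd k _ _ (e.symm g) = d at *
  generalize tensorFst k _ _ (e.symm y) = a at *
  generalize tensorSnd k _ _ (e.symm y) = b at *
  obtain ⟨a1, a2⟩ := Taft.skewPrimitive_cases hq' hn hc'.ne_zero hc'.comul_eq_tmul_self ha'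
  obtain ⟨b1, b2⟩ := Taft.skewPrimitive_cases hq hm hd'.ne_zero hd'.comul_eq_tmul_self hb'
  have cT := Taft.mem_torus_of_isGroupLike hq' hn hc'.ne_zero hc'.comul_eq_tmul_self
  have dT := Taft.mem_torus_of_isGroupLike hq hm hd'.ne_zero hd'.comul_eq_tmul_self
  by_cases hb0 : Taft.skewForm hq hm b = 0
  · by_cases ha0 : Taft.skewForm hq' hn a = 0
    -- When both ξ-values vanish, a, b, c, d all lie in the tori, which commute with each other; so
    -- y g = g y, against r ≠ 1 and y ≠ 0.
    · exfalso
      rw [ha0, zero_smul, sub_zero] at a1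
      rw [hb0, zero_smul, sub_zero] at b1
      have comm : y * g = g * y := by
        have k1 : Commute (inl hq' hq σ α c) (inr hq' hq σ α b) := inl_mul_inr_comm _ _ _ _ cT b1
        have k2 : Commute (inl hq' hq σ α c) (inr hq' hq σ α d) := inl_mul_inr_comm _ _ _ _ cT dT
        have k3 : Commute (inl hq' hq σ α a) (inr hq' hq σ α d) := inl_mul_inr_comm _ _ _ _ a1 dT
        have k4 : Commute (inl hq' hq σ α a) (inl hq' hq σ α c) := by
          rw [commute_iff_eq, ← map_mul, Taft.commute_of_mem_torus a1 cT, map_mul]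
        have k5 : Commute (inr hq' hq σ α b) (inr hq' hq σ α d) := by
          rw [commute_iff_eq, ← map_mul, Taft.commute_of_mem_torus b1 dT, map_mul]
        rw [ey, eg]
        exact Commute.add_left (((Commute.refl _).mul_left k1.symm).mul_right (k2.mul_left k5))
          (k4.mul_right k3)
      rw [comm] at hc
      have h1 : (1 - r) • (g * y) = 0 := by rw [sub_smul, one_smul, ← hc, sub_self]
      have h2 := (smul_eq_zero.1 h1).resolve_left (sub_ne_zero.2 hr.symm)
      exact hy0 ((hg.isUnit.mul_right_eq_zero).1 h2)
    · right
      obtain rfl := a2 ha0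
      have hd1 : d = 1 := by
        -- Applying ξ to the left tensor factor of `e4`, where now c is the group-like generator and
        -- ξ(c) = ξ(1) = 0, leaves ξ(a) d = ξ(a).
        have := congrArg (TensorProduct.lid k _ ∘ (Taft.skewForm hq' hn).rTensor _) e4
        simp [ha0] at this
        exact this
      rw [hb0, zero_smul, sub_zero] at b1
      subst hd1
      have hg1 : g = γ .H := by simpa using eg
      -- This splits y into a multiple of X and an element that commutes with H and is killed by the
      -- functional dual to X.
      have ey' : y = Taft.skewForm hq' hn a • γ .X +
          (inl hq' hq σ α (a - Taft.skewForm hq' hn a • Taft.x hq') +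
            inl hq' hq σ α (Taft.h hq') * inr hq' hq σ α b) := by
        rw [ey, map_sub, map_smul, inl_x]
        abel
      rw [ey', hg1] at hc
      have := eq_zero_of_qcomm (inv_mul_H hq' hq σ α) hr'.XH (by
          rw [← inl_h, add_mul, mul_add, ← map_mul,
            Taft.commute_of_mem_torus a1 (Taft.h_mem_torus hq'), map_mul, mul_assoc,
            inl_mul_inr_comm _ _ _ _ (Taft.h_mem_torus hq') b1]) (skewFormL hn hi)
        (by rw [← inl_x, skewFormL_inl, Taft.skewForm_x])
        (by rw [map_add, skewFormL_mul, skewFormL_inl, Taft.skewForm_of_mem_torus hq' hn a1,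
          Taft.skewForm_h]; simp) ha0 hr hc
      exact ⟨hg1, this.1, Taft.skewForm hq' hn a, by rw [ey', this.2, add_zero]⟩
  · left
    obtain rfl := b2 hb0
    have hc1 : c = 1 := by
      -- The mirror argument: ξ on the right tensor factor of `e4` gives ξ(b) = ξ(b) c.
      have := congrArg (TensorProduct.rid k _ ∘ (Taft.skewForm hq hm).lTensor _) e4
      simp [hb0] at this
      exact this.symm
    -- Otherwise c would be both 1 and the generator H of the left torus, so y has no X-component.
    have ha0 : Taft.skewForm hq' hn a = 0 := by
      by_contra h1
      exact Taft.h_ne_one hq' hn ((a2 h1).symm.trans hc1)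
    rw [ha0, zero_smul, sub_zero] at a1
    subst hc1
    have hg1 : g = γ .h := by simpa using eg
    have ey' : y = Taft.skewForm hq hm b • γ .x +
        (inl hq' hq σ α a + inr hq' hq σ α (b - Taft.skewForm hq hm b • Taft.x hq)) := by
      rw [ey, map_sub, map_smul, inr_x, map_one, one_mul]
      abel
    rw [ey', hg1] at hc
    have := eq_zero_of_qcomm (inv_mul_h hq' hq σ α) hr'.xh (by
        rw [← inr_h, add_mul, mul_add, ← map_mul,
          Taft.commute_of_mem_torus b1 (Taft.h_mem_torus hq), map_mul,
          inl_mul_inr_comm _ _ _ _ a1 (Taft.h_mem_torus hq)]) (skewFormR hm hi)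
      (by rw [← inr_x, skewFormR_inr, Taft.skewForm_x])
      (by rw [map_add, skewFormR_inl, skewFormR_inr, Taft.skewForm_of_mem_torus hq hm b1,
        add_zero]) hb0 hr hc
    exact ⟨hg1, this.1, Taft.skewForm hq hm b, by rw [ey', this.2, add_zero]⟩

end

end Bicross

/-- The homomorphism from `ℤ/2` sending the class of `1` to an element `s` with `s² = 1`. -/
def involutionHom {G : Type u} [Group G] (s : G) (hs : s * s = 1) :
    Multiplicative (ZMod 2) →* G where
  toFun z := if z = 1 then 1 else s
  map_one' := if_pos rfl
  map_mul' a b := by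
    have h2 : ∀ z : Multiplicative (ZMod 2), z = 1 ∨ z = Multiplicative.ofAdd 1 := by decide
    have h3 : (Multiplicative.ofAdd 1 : Multiplicative (ZMod 2)) ≠ 1 := by decide
    have h4 : (Multiplicative.ofAdd 1 * Multiplicative.ofAdd 1 : Multiplicative (ZMod 2)) = 1 := by
      decide
    rcases h2 a with rfl | rfl <;> rcases h2 b with rfl | rfl <;> simp [h3, h4, hs]

theorem involutionHom_ofAdd_one {G : Type u} [Group G] (s : G) (hs : s * s = 1) :
    involutionHom s hs (Multiplicative.ofAdd 1) = s := rfl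

theorem involutionAction_ofAdd_one {G : Type u} [Group G] (e : MulAut G) (he : e * e = 1) :
    involutionAction e he (Multiplicative.ofAdd 1) = e := rfl

/-! ### The explicit automorphisms: rescaling and exchange. -/

namespace Bicross

open Coalgebra

variable {k : Type u} [Field k] {m n : ℕ} {q q' : k} {hq' : IsPrimitiveRoot q' n}
  {hq : IsPrimitiveRoot q m} {σ α : k} [NeZero m] [NeZero n]

local notation "B" => Bicross hq' hq σ α
local notation "γ" => gen hq' hq σ α

theorem hopfAut_ext {f g : HopfAut k B} (hfg : ∀ i, f (γ i) = g (γ i)) : f = g := by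
  have h1 : ((f : B ≃ₐ[k] B) : B →ₐ[k] B) = ((g : B ≃ₐ[k] B) : B →ₐ[k] B) := algHom_ext hfg
  exact BialgEquiv.ext fun x => DFunLike.congr_fun h1 x

theorem hopfAut_mul_apply (f g : HopfAut k B) (x : B) : (f * g) x = f (g x) := rfl

theorem hopfAut_one_apply (x : B) : (1 : HopfAut k B) x = x := rfl

-- All relations are homogeneous in x and in X except the one for x X, whose term α (1 - H h) is not
-- scaled; hence the condition on α a b.
omit [NeZero m] [NeZero n] in
theorem scale_relations {a b : k} (hab : α * (a * b) = α) :
    BicrossRelations m n q q' σ α (γ .h) (a • γ .x) (γ .H) (b • γ .X) := by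
  have r := relations hq' hq σ α
  refine ⟨r.h_pow, r.H_pow, ?_, ?_, ?_, ?_, ?_, ?_, ?_, r.hH⟩
  · rw [smul_pow, r.x_pow, smul_zero]
  · rw [smul_pow, r.X_pow, smul_zero]
  · rw [smul_mul_assoc, r.xh, mul_smul_comm, smul_comm]
  · rw [smul_mul_assoc, r.XH, mul_smul_comm, smul_comm]
  · rw [smul_mul_assoc, r.xH, mul_smul_comm, smul_comm]
  · rw [smul_mul_assoc, mul_smul_comm, r.hX, smul_comm]
  · rw [smul_mul_smul_comm, smul_mul_smul_comm, r.xX, smul_add, smul_smul, smul_smul, smul_smul,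
      mul_comm (a * b) α, hab]
    congr 2
    ring

/-- The endomorphism `x ↦ a x`, `X ↦ b X`. -/
noncomputable def scaleAlgHom {a b : k} (hab : α * (a * b) = α) : B →ₐ[k] B :=
  lift (scale_relations hab)

variable (hq' hq σ α) in
/-- The automorphism `x ↦ a x`, `X ↦ b X`. -/
noncomputable def scale (a b : kˣ) (hab : α * (a * b) = α) : HopfAut k B :=
  BialgEquiv.ofAlgEquiv
    (AlgEquiv.ofAlgHom (scaleAlgHom hab) (scaleAlgHom (a := ↑a⁻¹) (b := ↑b⁻¹) (by
        conv_lhs => rw [← hab]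
        rw [mul_assoc, mul_mul_mul_comm, Units.mul_inv, Units.mul_inv, mul_one, mul_one]))
      (algHom_ext (by rintro (_ | _ | _ | _) <;> simp [scaleAlgHom, smul_smul]))
      (algHom_ext (by rintro (_ | _ | _ | _) <;> simp [scaleAlgHom, smul_smul])))
    (algHom_ext (by
      rintro (_ | _ | _ | _) <;> simp [scaleAlgHom, counit_h, counit_x, counit_H, counit_X]))
    (algHom_ext (by
      rintro (_ | _ | _ | _) <;> simp [scaleAlgHom, comul_h, comul_x, comul_H, comul_X,
        TensorProduct.smul_tmul']))

section
variable {a b : kˣ} {hab : α * (a * b) = α}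

@[simp] theorem scale_h : scale hq' hq σ α a b hab (γ .h) = γ .h := lift_h ..
@[simp] theorem scale_x : scale hq' hq σ α a b hab (γ .x) = (a : k) • γ .x := lift_x ..
@[simp] theorem scale_H : scale hq' hq σ α a b hab (γ .H) = γ .H := lift_H ..
@[simp] theorem scale_X : scale hq' hq σ α a b hab (γ .X) = (b : k) • γ .X := lift_X ..

end

section
variable {N : Type u} [Group N] (f : N →* kˣ × kˣ)

variable (hq' hq σ α) in
/-- The action of a group by automorphisms `x ↦ a x`, `X ↦ b X`. -/
noncomputable def scaleHom (hf : ∀ c, α * ((f c).1 * (f c).2) = α) : N →* HopfAut k B where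
  toFun c := scale hq' hq σ α (f c).1 (f c).2 (hf c)
  map_one' := hopfAut_ext (by rintro (_ | _ | _ | _) <;> simp [hopfAut_one_apply])
  map_mul' c d := hopfAut_ext (by
    rintro (_ | _ | _ | _) <;> simp [hopfAut_mul_apply, smul_smul, mul_comm])

theorem scaleHom_apply (hf : ∀ c, α * ((f c).1 * (f c).2) = α) (c : N) :
    scaleHom hq' hq σ α f hf c = scale hq' hq σ α (f c).1 (f c).2 (hf c) := rfl

end

section Swap

variable {q q' : k} {hq' : IsPrimitiveRoot q' n} {hq : IsPrimitiveRoot q n}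

local notation "𝓑" => Bicross hq' hq σ α
local notation "δ" => gen hq' hq σ α

-- Exchanging the pairs turns σ into σ⁻¹ in the cross relations for x H and h X, hence σ² = 1.
-- Solving the relation for x X for X x changes α into -σ⁻¹ α, hence σ α = -α. The equality q' = q
-- is a hypothesis because in `TaftQ` the root q' is the expression q^{n-1}.
omit [NeZero n] in
theorem swap_relations (e : q' = q) (hσ : σ ^ 2 = 1) (hα : σ * α = -α) :
    BicrossRelations n n q q' σ α (δ .H) (δ .X) (δ .h) (δ .x) := by
  have r := relations hq' hq σ α
  have hσ' : σ * σ = 1 := by rw [← pow_two, hσ]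
  refine ⟨r.H_pow, r.h_pow, r.X_pow, r.x_pow, ?_, ?_, ?_, ?_, ?_, r.hH.symm⟩
  · exact r.XH.trans (congrArg (· • _) e)
  · exact r.xh.trans (congrArg (· • _) e.symm)
  · rw [r.hX, smul_smul, hσ', one_smul]
  · rw [r.xH, smul_smul, hσ', one_smul]
  · rw [r.xX, smul_add, smul_smul, smul_smul, hσ', hα, one_smul, neg_smul, r.hH]
    abel

/-- The automorphism which exchanges `h` with `H` and `x` with `X`. -/
noncomputable def swap (e : q' = q) (hσ : σ ^ 2 = 1) (hα : σ * α = -α) : HopfAut k 𝓑 :=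
  BialgEquiv.ofAlgEquiv
    (AlgEquiv.ofAlgHom (lift (swap_relations e hσ hα)) (lift (swap_relations e hσ hα))
      (algHom_ext (by rintro (_ | _ | _ | _) <;> simp))
      (algHom_ext (by rintro (_ | _ | _ | _) <;> simp)))
    (algHom_ext (by
      rintro (_ | _ | _ | _) <;> simp [counit_h, counit_x, counit_H, counit_X]))
    (algHom_ext (by
      rintro (_ | _ | _ | _) <;> simp [comul_h, comul_x, comul_H, comul_X]))

variable {e : q' = q} {hσ : σ ^ 2 = 1} {hα : σ * α = -α}

@[simp] theorem swap_h : (swap e hσ hα : HopfAut k 𝓑) (δ .h) = δ .H := lift_h ..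
@[simp] theorem swap_x : (swap e hσ hα : HopfAut k 𝓑) (δ .x) = δ .X := lift_x ..
@[simp] theorem swap_H : (swap e hσ hα : HopfAut k 𝓑) (δ .H) = δ .h := lift_H ..
@[simp] theorem swap_X : (swap e hσ hα : HopfAut k 𝓑) (δ .X) = δ .x := lift_X ..

theorem swap_mul_swap : (swap e hσ hα * swap e hσ hα : HopfAut k 𝓑) = 1 :=
  hopfAut_ext (by rintro (_ | _ | _ | _) <;> simp [hopfAut_mul_apply, hopfAut_one_apply])

end Swap

/-! ### Every Hopf automorphism rescales or exchanges. -/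

section Classification

variable (hm : 2 ≤ m) (hn : 2 ≤ n) (hi : Function.Injective (mulLinear hq' hq σ α))

include hm hi

theorem x_ne_zero : γ .x ≠ 0 := fun h0 => by
  have h1 := skewFormR_inr hm hi (Taft.x hq)
  rw [inr_x, h0, map_zero, Taft.skewForm_x] at h1
  exact zero_ne_one h1

theorem h_ne_H : γ .h ≠ γ .H := fun h0 => by
  have h1 : (1 : Taft hq') ⊗ₜ[k] Taft.h hq = Taft.h hq' ⊗ₜ[k] (1 : Taft hq) := hi (by simp [h0])
  have h2 := congrArg (tensorSnd k _ _) h1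
  simp only [tensorSnd_tmul, Taft.counit_h, Bialgebra.counit_one, one_smul] at h2
  exact Taft.h_ne_one hq hm h2

theorem one_sub_Hh_ne_zero : 1 - γ .H * γ .h ≠ 0 := fun h0 => by
  have h1 : (1 : Taft hq') ⊗ₜ[k] (1 : Taft hq) = Taft.h hq' ⊗ₜ[k] Taft.h hq :=
    hi (by simpa using sub_eq_zero.1 h0)
  have h2 := congrArg (tensorSnd k _ _) h1
  simp only [tensorSnd_tmul, Taft.counit_h, Bialgebra.counit_one, one_smul] at h2
  exact Taft.h_ne_one hq hm h2.symm

omit hm in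
include hn in
theorem X_ne_zero : γ .X ≠ 0 := fun h0 => by
  have h1 := skewFormL_inl hn hi (Taft.x hq')
  rw [inl_x, h0, map_zero, Taft.skewForm_x] at h1
  exact zero_ne_one h1

include hn

theorem scale_injective {a b c d : kˣ} {hab : α * (a * b) = α} {hcd : α * (c * d) = α}
    (hs : scale hq' hq σ α a b hab = scale hq' hq σ α c d hcd) : (a, b) = (c, d) := by
  have h1 := DFunLike.congr_fun hs (γ .x)
  have h2 := DFunLike.congr_fun hs (γ .X)
  rw [scale_x, scale_x] at h1
  rw [scale_X, scale_X] at h2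
  exact Prod.ext (Units.ext (smul_left_injective k (x_ne_zero hm hi) h1))
    (Units.ext (smul_left_injective k (X_ne_zero hn hi) h2))

/-- A Hopf automorphism fixing `h` is `x ↦ a x`, `X ↦ b X`. -/
theorem eq_scale_of_apply_h {φ : HopfAut k B} (hφ : φ (γ .h) = γ .h) (hφ' : φ (γ .H) = γ .H)
    {a b : k} (hx : φ (γ .x) = a • γ .x) (hX : φ (γ .X) = b • γ .X) :
    ∃ (a b : kˣ) (hab : α * (a * b) = α), φ = scale hq' hq σ α a b hab := by
  have r := relations hq' hq σ α
  have ha : a ≠ 0 := by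
    rintro rfl
    rw [zero_smul, map_eq_zero_iff φ (EquivLike.injective φ)] at hx
    exact x_ne_zero hm hi hx
  have hb : b ≠ 0 := by
    rintro rfl
    rw [zero_smul, map_eq_zero_iff φ (EquivLike.injective φ)] at hX
    exact X_ne_zero hn hi hX
  refine ⟨Units.mk0 a ha, Units.mk0 b hb, ?_, hopfAut_ext ?_⟩
  -- Applying φ to the relation for x X and cancelling the quadratic part compares α with α a b as
  -- coefficients of 1 - H h, which is nonzero.
  · have h1 := congrArg φ r.xX
    simp only [map_mul, map_add, map_smul, map_sub, map_one, hφ, hφ', hx, hX] at h1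
    rw [smul_mul_smul_comm, smul_mul_smul_comm, r.xX, smul_add, mul_comm b a,
      smul_comm (a * b) σ, add_right_inj, smul_smul, ← sub_eq_zero, ← sub_smul] at h1
    have h2 := (smul_eq_zero.1 h1).resolve_right (one_sub_Hh_ne_zero hm hi)
    simp only [Units.val_mk0]
    linear_combination h2
  · rintro (_ | _ | _ | _) <;> simp [hφ, hφ', hx, hX]

/-- A Hopf automorphism preserves or exchanges the skew primitive generators up to scalars. -/
theorem hopfAut_cases (φ : HopfAut k B) :
    (φ (γ .h) = γ .h ∧ φ (γ .H) = γ .H ∧ ∃ a b : k, φ (γ .x) = a • γ .x ∧ φ (γ .X) = b • γ .X) ∨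
    (q = q' ∧ φ (γ .h) = γ .H ∧ φ (γ .H) = γ .h ∧
      ∃ a b : k, φ (γ .x) = a • γ .X ∧ φ (γ .X) = b • γ .x) := by
  have r := relations hq' hq σ α
  have inj := EquivLike.injective φ
  have gh : IsGroupLikeElem k (γ .h) := ⟨counit_h .., comul_h ..⟩
  have gH : IsGroupLikeElem k (γ .H) := ⟨counit_H .., comul_H ..⟩
  -- An automorphism preserves group-likeness, skew primitivity and the q-commutation, and q ≠ 1
  -- because m ≥ 2; so the classification applies to the image of (h, x).
  have c1 := skewPrimitive_cases hm hn hi (g := φ (γ .h)) (y := φ (γ .x)) (r := q)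
    (gh.map φ)
    (by rw [← CoalgHomClass.map_comp_comul_apply, comul_x]; simp)
    (by rw [Ne, map_eq_zero_iff φ inj]; exact x_ne_zero hm hi)
    (hq.ne_one (by omega))
    (by rw [← map_mul, r.xh, map_smul, map_mul])
  have c2 := skewPrimitive_cases hm hn hi (g := φ (γ .H)) (y := φ (γ .X)) (r := q')
    (gH.map φ)
    (by rw [← CoalgHomClass.map_comp_comul_apply, comul_X]; simp)
    (by rw [Ne, map_eq_zero_iff φ inj]; exact X_ne_zero hn hi)
    (hq'.ne_one (by omega))
    (by rw [← map_mul, r.XH, map_smul, map_mul])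
  -- Of the four combinations, two send h and H to the same group-like and contradict injectivity.
  rcases c1 with ⟨h1, -, a, ha⟩ | ⟨h1, e1, a, ha⟩ <;>
    rcases c2 with ⟨h2, e2, b, hb⟩ | ⟨h2, -, b, hb⟩
  · exact absurd (inj (h1.trans h2.symm)) (h_ne_H hm hi)
  · exact Or.inl ⟨h1, h2, a, b, ha, hb⟩
  · exact Or.inr ⟨e1, h1, h2, a, b, ha, hb⟩
  · exact absurd (inj (h1.trans h2.symm)) (h_ne_H hm hi)

/-- The image of x H = σ H x is a X h = σ a h X = σ² a X h, with a ≠ 0 and X h ≠ 0 as h is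
invertible. -/
theorem sq_eq_one_of_exchange {φ : HopfAut k B} (hφ' : φ (γ .H) = γ .h)
    {a : k} (hx : φ (γ .x) = a • γ .X) : σ ^ 2 = 1 := by
  have r := relations hq' hq σ α
  have ha : a ≠ 0 := by
    rintro rfl
    rw [zero_smul, map_eq_zero_iff φ (EquivLike.injective φ)] at hx
    exact x_ne_zero hm hi hx
  have h1 := congrArg φ r.xH
  simp only [map_mul, map_smul, hφ', hx] at h1
  rw [smul_mul_assoc, mul_smul_comm, r.hX, smul_smul, smul_smul, ← sub_eq_zero] at h1
  have h2 : (a * (1 - σ ^ 2)) • (γ .X * γ .h) = 0 := by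
    rw [← h1]
    module
  have h3 : γ .X * γ .h ≠ 0 := fun h0 => by
    have := congrArg (· * γ .h ^ (m - 1)) h0
    simp only [mul_assoc, h_mul_inv, mul_one, zero_mul] at this
    exact X_ne_zero hn hi this
  have h4 := ((mul_eq_zero.1 ((smul_eq_zero.1 h2).resolve_right h3)).resolve_left ha)
  exact (sub_eq_zero.1 h4).symm

variable {N : Type u} [Group N] (f : N →* kˣ × kˣ)

/-- The homomorphism f parametrizes the admissible pairs (a, b), so that the groups k* × k* and k*
are treated together: f is the identity for α = 0 and a ↦ (a, a⁻¹) for α = 1. -/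
theorem scaleHom_injective (hf : ∀ c, α * ((f c).1 * (f c).2) = α)
    (hinj : Function.Injective f) : Function.Injective (scaleHom hq' hq σ α f hf) := by
  intro c d hcd
  exact hinj (scale_injective hm hn hi hcd)

/-- If no automorphism exchanges `h` and `H`, the automorphisms only rescale `x` and `X`. -/
theorem nonempty_hopfAut_mulEquiv (hf : ∀ c, α * ((f c).1 * (f c).2) = α)
    (hinj : Function.Injective f) (hsurj : ∀ a b : kˣ, α * (a * b) = α → ∃ c, f c = (a, b))
    (hne : q ≠ q' ∨ σ ^ 2 ≠ 1) : Nonempty (HopfAut k B ≃* N) := by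
  refine ⟨(MulEquiv.ofBijective (scaleHom hq' hq σ α f hf)
    ⟨scaleHom_injective hm hn hi f hf hinj, fun φ => ?_⟩).symm⟩
  rcases hopfAut_cases hm hn hi φ with ⟨h1, h2, a, b, ha, hb⟩ | ⟨e, h1, h2, a, b, ha, hb⟩
  · obtain ⟨a, b, hab, rfl⟩ := eq_scale_of_apply_h hm hn hi h1 h2 ha hb
    obtain ⟨c, hc⟩ := hsurj a b hab
    refine ⟨c, hopfAut_ext ?_⟩
    rintro (_ | _ | _ | _) <;> simp [scaleHom_apply, hc]
  · exact (hne.elim (· e) (· (sq_eq_one_of_exchange hm hn hi h2 ha))).elim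

end Classification

/-! ### The semidirect product when the exchange exists. -/

section SwapClassification

variable {q q' : k} {hq' : IsPrimitiveRoot q' n} {hq : IsPrimitiveRoot q n}

local notation "𝓑" => Bicross hq' hq σ α
local notation "δ" => gen hq' hq σ α

variable (hn : 2 ≤ n) (hi : Function.Injective (mulLinear hq' hq σ α))
  {N : Type u} [Group N] (f : N →* kˣ × kˣ)

include hn hi in
/-- If `h` and `H` can be exchanged, the automorphism group is a semidirect product. -/
theorem nonempty_hopfAut_mulEquiv_semidirect (hf : ∀ c, α * ((f c).1 * (f c).2) = α)
    (hinj : Function.Injective f) (hsurj : ∀ a b : kˣ, α * (a * b) = α → ∃ c, f c = (a, b))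
    (e : q' = q) (hσ : σ ^ 2 = 1) (hα : σ * α = -α) (ε : MulAut N) (hε : ε * ε = 1)
    (hεf : ∀ c, f (ε c) = (f c).swap) :
    Nonempty (HopfAut k 𝓑 ≃* N ⋊[involutionAction ε hε] Multiplicative (ZMod 2)) := by
  let s : HopfAut k 𝓑 := swap e hσ hα
  have hs : s * s = 1 := swap_mul_swap
  have hz : ∀ z : Multiplicative (ZMod 2), z = 1 ∨ z = Multiplicative.ofAdd 1 := by decide
  have s1 := involutionHom_ofAdd_one s hs
  have i1 := involutionAction_ofAdd_one ε hε
  -- Conjugation by the exchange swaps the two scalars, and ε is the automorphism of N that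
  -- corresponds to this swap.
  have conj : ∀ c, scaleHom hq' hq σ α f hf (ε c) = s * scaleHom hq' hq σ α f hf c * s := by
    intro c
    apply hopfAut_ext
    rintro (_ | _ | _ | _) <;> simp [scaleHom_apply, hopfAut_mul_apply, hεf, s]
  let F : N ⋊[involutionAction ε hε] Multiplicative (ZMod 2) →* HopfAut k 𝓑 :=
    SemidirectProduct.lift (scaleHom hq' hq σ α f hf) (involutionHom s hs) (by
      intro z
      ext1 c
      rcases hz z with rfl | rfl
      · rw [map_one, map_one, map_one]
        rfl
      · change scaleHom hq' hq σ α f hf (involutionAction ε hε (Multiplicative.ofAdd 1) c) =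
          involutionHom s hs (Multiplicative.ofAdd 1) * scaleHom hq' hq σ α f hf c *
            (involutionHom s hs (Multiplicative.ofAdd 1))⁻¹
        rw [s1, i1, conj, inv_eq_of_mul_eq_one_left hs])
  have Fapp : ∀ c z, F ⟨c, z⟩ = scaleHom hq' hq σ α f hf c * involutionHom s hs z := fun c z => rfl
  refine ⟨(MulEquiv.ofBijective F ⟨?_, fun φ => ?_⟩).symm⟩
  · rw [injective_iff_map_eq_one]
    rintro ⟨c, z⟩ hcz
    rw [Fapp] at hcz
    rcases hz z with rfl | rfl
    · rw [map_one, mul_one] at hcz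
      have := scaleHom_injective hn hn hi f hf hinj (hcz.trans (map_one _).symm)
      rw [this]
      rfl
    · rw [s1] at hcz
      -- An element with nontrivial ℤ/2-component sends h to H ≠ h, so it is not in the kernel.
      have h1 := DFunLike.congr_fun hcz (δ .h)
      rw [hopfAut_mul_apply, hopfAut_one_apply, swap_h, scaleHom_apply, scale_H] at h1
      exact absurd h1.symm (h_ne_H hn hi)
  · have main : ∀ ψ : HopfAut k 𝓑, (ψ (δ .h) = δ .h ∧ ψ (δ .H) = δ .H ∧
        ∃ a b : k, ψ (δ .x) = a • δ .x ∧ ψ (δ .X) = b • δ .X) →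
        ∃ c, scaleHom hq' hq σ α f hf c = ψ := by
      rintro ψ ⟨h1, h2, a, b, ha, hb⟩
      obtain ⟨a, b, hab, rfl⟩ := eq_scale_of_apply_h hn hn hi h1 h2 ha hb
      obtain ⟨c, hc⟩ := hsurj a b hab
      refine ⟨c, hopfAut_ext ?_⟩
      rintro (_ | _ | _ | _) <;> simp [scaleHom_apply, hc]
    rcases hopfAut_cases hn hn hi φ with h | ⟨-, h1, h2, a, b, ha, hb⟩
    · obtain ⟨c, hc⟩ := main φ h
      exact ⟨⟨c, 1⟩, by rw [Fapp, map_one, mul_one, hc]⟩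
    -- Composing an exchanging automorphism with s gives one that fixes h and H, which is a
    -- rescaling.
    · obtain ⟨c, hc⟩ := main (φ * s) ⟨by simp [hopfAut_mul_apply, s, h2],
        by simp [hopfAut_mul_apply, s, h1], b, a, by simp [hopfAut_mul_apply, s, hb],
        by simp [hopfAut_mul_apply, s, ha]⟩
      exact ⟨⟨c, Multiplicative.ofAdd 1⟩, by rw [Fapp, s1, hc, mul_assoc, hs, mul_one]⟩

end SwapClassification

end Bicross

/-! ### Independence of the ordered products when α = 0. -/

namespace Taft

variable {k : Type u} [Field k] {m : ℕ} {q : k} (hq : IsPrimitiveRoot q m)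

/-- The endomorphism `h ↦ a h`, `x ↦ b x`, where `a^m = 1`. -/
noncomputable def rescale (a b : k) (ha : a ^ m = 1) : Taft hq →ₐ[k] Taft hq :=
  lift (a • h hq) (b • x hq) (by rw [smul_pow, h_pow, ha, one_smul])
    (by rw [smul_pow, x_pow, smul_zero])
    (by rw [smul_mul_smul_comm, smul_mul_smul_comm, xh, smul_comm, mul_comm b])

variable {a b : k} (ha : a ^ m = 1)

@[simp] theorem rescale_h : rescale hq a b ha (h hq) = a • h hq := lift_h ..

@[simp] theorem rescale_x : rescale hq a b ha (x hq) = b • x hq := lift_x ..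

theorem rescale_pow (j : ℕ) : rescale hq a b ha ^ j =
    rescale hq (a ^ j) (b ^ j) (by rw [← pow_mul, mul_comm, pow_mul, ha, one_pow]) := by
  induction j with
  | zero => exact algHom_ext (by simp) (by simp)
  | succ j ih =>
    rw [pow_succ, ih]
    exact algHom_ext (by simp [smul_smul, pow_succ, mul_comm]) (by simp [smul_smul, pow_succ, mul_comm])

theorem rescale_one_one : rescale hq 1 1 (one_pow m) = 1 :=
  algHom_ext (by simp) (by simp)

end Taft

namespace Bicross

variable {k : Type u} [Field k] {m n : ℕ} {q q' : k} (hq' : IsPrimitiveRoot q' n)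
  (hq : IsPrimitiveRoot q m) {σ : k}

/-- These operators are left multiplication written in the coordinates T' ⊗ T. Moving h to the right
of T' twists by X ↦ σ X, and moving x twists by H ↦ σ H, X ↦ σ X. The second twist is well defined
since σ^n = 1, and σ^m = 1 gives h^m = 1. -/
theorem tensor_relations (hσm : σ ^ m = 1) (hσn : σ ^ n = 1) :
    BicrossRelations (B := Module.End k (Taft hq' ⊗[k] Taft hq)) m n q q' σ 0
    (TensorProduct.map (Taft.rescale hq' 1 σ (one_pow n)).toLinearMap
      (LinearMap.mulLeft k (Taft.h hq)))
    (TensorProduct.map (Taft.rescale hq' σ σ hσn).toLinearMap (LinearMap.mulLeft k (Taft.x hq)))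
    (TensorProduct.map (LinearMap.mulLeft k (Taft.h hq')) 1)
    (TensorProduct.map (LinearMap.mulLeft k (Taft.x hq')) 1) := by
  have pow_toLinearMap : ∀ (f : Taft hq' →ₐ[k] Taft hq') (j : ℕ),
      f.toLinearMap ^ j = (f ^ j).toLinearMap := by
    intro f j
    induction j with
    | zero => rfl
    | succ j ih => rw [pow_succ, pow_succ, ih]; rfl
  constructor
  · rw [TensorProduct.map_pow, pow_toLinearMap, Taft.rescale_pow, LinearMap.pow_mulLeft, Taft.h_pow]
    refine TensorProduct.ext' fun a b => ?_
    have : Taft.rescale hq' (1 ^ m) (σ ^ m) (by simp) = 1 := by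
      simp only [one_pow, hσm]
      exact Taft.rescale_one_one hq'
    rw [TensorProduct.map_tmul, AlgHom.toLinearMap_apply, this]
    simp
  · rw [TensorProduct.map_pow, LinearMap.pow_mulLeft, Taft.h_pow, one_pow]
    refine TensorProduct.ext' fun a b => ?_
    simp
  · rw [TensorProduct.map_pow, LinearMap.pow_mulLeft, Taft.x_pow, LinearMap.mulLeft_zero_eq_zero,
      TensorProduct.map_zero_right]
  · rw [TensorProduct.map_pow, LinearMap.pow_mulLeft, Taft.x_pow, LinearMap.mulLeft_zero_eq_zero,
      TensorProduct.map_zero_left]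
  · refine TensorProduct.ext' fun a b => ?_
    have h1 : (Taft.rescale hq' σ σ hσn).comp (Taft.rescale hq' 1 σ (one_pow n)) =
        (Taft.rescale hq' 1 σ (one_pow n)).comp (Taft.rescale hq' σ σ hσn) :=
      Taft.algHom_ext (by simp) (by simp)
    have h2 := DFunLike.congr_fun h1 a
    simp only [AlgHom.comp_apply] at h2
    simp [h2, ← mul_assoc, Taft.xh, TensorProduct.tmul_smul]
  · refine TensorProduct.ext' fun a b => ?_
    simp [← mul_assoc, Taft.xh, TensorProduct.smul_tmul']
  · refine TensorProduct.ext' fun a b => ?_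
    simp [TensorProduct.smul_tmul']
  · refine TensorProduct.ext' fun a b => ?_
    simp [TensorProduct.smul_tmul']
  · refine TensorProduct.ext' fun a b => ?_
    simp [TensorProduct.smul_tmul']
  · refine TensorProduct.ext' fun a b => ?_
    simp

variable [NeZero m] [NeZero n]

/-- The ordered products of basis elements are linearly independent if `α = 0`. -/
theorem mulLinear_injective (hσm : σ ^ m = 1) (hσn : σ ^ n = 1) :
    Function.Injective (mulLinear hq' hq σ 0) := by
  let ρ : Bicross hq' hq σ 0 →ₐ[k] Module.End k (Taft hq' ⊗[k] Taft hq) :=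
    lift (tensor_relations hq' hq hσm hσn)
  have hl : ∀ (a : Taft hq') (z : Taft hq' ⊗[k] Taft hq), ρ (inl hq' hq σ 0 a) z =
      TensorProduct.map (LinearMap.mulLeft k a) LinearMap.id z := by
    intro a
    have ha : a ∈ Algebra.adjoin k {Taft.h hq', Taft.x hq'} :=
      Taft.adjoin_eq_top hq' ▸ Algebra.mem_top
    induction ha using Algebra.adjoin_induction with
    | mem a ha =>
      intro z
      rcases ha with rfl | rfl
      · rw [inl_h]; exact LinearMap.congr_fun (lift_H _) z
      · rw [inl_x]; exact LinearMap.congr_fun (lift_X _) z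
    | algebraMap c =>
      intro z
      induction z with
      | zero => simp
      | add z w hz hw => rw [map_add, map_add, hz, hw]
      | tmul b d =>
        simp [Algebra.algebraMap_eq_smul_one, TensorProduct.smul_tmul']
    | add a b _ _ ha hb =>
      intro z
      rw [map_add, map_add, LinearMap.add_apply, ha, hb, ← LinearMap.add_apply,
        ← TensorProduct.map_add_left]
      congr 2
      ext
      simp [add_mul]
    | mul a b _ _ ha hb =>
      intro z
      rw [map_mul, map_mul, Module.End.mul_apply, ha, hb, ← LinearMap.comp_apply,
        ← TensorProduct.map_comp, LinearMap.mulLeft_mul, LinearMap.id_comp]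
  -- Only vectors 1 ⊗ d are considered, because the twists on the left factor fix 1.
  have hr : ∀ (b d : Taft hq), ρ (inr hq' hq σ 0 b) (1 ⊗ₜ d) = 1 ⊗ₜ (b * d) := by
    intro b
    have hb : b ∈ Algebra.adjoin k {Taft.h hq, Taft.x hq} :=
      Taft.adjoin_eq_top hq ▸ Algebra.mem_top
    induction hb using Algebra.adjoin_induction with
    | mem b hb =>
      intro d
      rcases hb with rfl | rfl
      · rw [inr_h]
        refine (LinearMap.congr_fun (lift_h _) _).trans ?_
        simp
      · rw [inr_x]
        refine (LinearMap.congr_fun (lift_x _) _).trans ?_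
        simp
    | algebraMap c =>
      intro d
      simp [Algebra.algebraMap_eq_smul_one]
    | add a b _ _ ha hb =>
      intro d
      rw [map_add, map_add, LinearMap.add_apply, ha, hb, add_mul, TensorProduct.tmul_add]
    | mul a b _ _ ha hb =>
      intro d
      rw [map_mul, map_mul, Module.End.mul_apply, hb, ha, mul_assoc]
  -- Evaluation of the representation at 1 ⊗ 1 is a left inverse of the multiplication map.
  have key : ∀ z, ρ (mulLinear hq' hq σ 0 z) (1 ⊗ₜ 1) = z := by
    intro z
    induction z with
    | zero => simp
    | add z w hz hw => rw [map_add, map_add, LinearMap.add_apply, hz, hw]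
    | tmul a b => rw [mulLinear_tmul, map_mul, Module.End.mul_apply, hr, hl]; simp
  exact Function.LeftInverse.injective (g := fun w => ρ w (1 ⊗ₜ 1)) key

end Bicross

open Coalgebra WithConv

/-! ### The dual of a Taft algebra is a Taft algebra. -/

namespace Taft

variable {k : Type u} [Field k] {n : ℕ} {q : k} (hq : IsPrimitiveRoot q n) [NeZero n]

/-- The character with `h ↦ q^{-j}` and `x ↦ 0`. -/
noncomputable def characterPow (j : ℕ) : Taft hq →ₐ[k] k :=
  lift (q⁻¹ ^ j) 0
    (by rw [← pow_mul, mul_comm, pow_mul, inv_pow, hq.pow_eq_one, inv_one, one_pow])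
    (zero_pow (NeZero.ne n)) (by simp)

@[simp] theorem characterPow_h (j : ℕ) : characterPow hq j (h hq) = q⁻¹ ^ j := lift_h ..

@[simp] theorem characterPow_x (j : ℕ) : characterPow hq j (x hq) = 0 := lift_x ..

/-- The character `h ↦ q⁻¹`, `x ↦ 0` as an element of the dual algebra. -/
noncomputable def dualH : ConvDual k (Taft hq) := toConv (character hq).toLinearMap

theorem algHom_convMul (φ ψ : Taft hq →ₐ[k] k) :
    (toConv φ.toLinearMap * toConv ψ.toLinearMap : ConvDual k (Taft hq)) =
      toConv (((Algebra.TensorProduct.lmul' k).comp (Algebra.TensorProduct.map φ ψ)).comp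
        (Bialgebra.comulAlgHom k _)).toLinearMap := by
  ext a
  rw [LinearMap.convMul_apply]
  rfl

theorem dualH_pow (j : ℕ) : dualH hq ^ j = toConv (characterPow hq j).toLinearMap := by
  induction j with
  | zero =>
    have : characterPow hq 0 = Bialgebra.counitAlgHom k _ :=
      algHom_ext (by simp [counit_h]) (by simp [counit_x])
    rw [this, pow_zero]
    rfl
  | succ j ih =>
    rw [pow_succ, ih, dualH, algHom_convMul]
    congr 2
    exact algHom_ext (by simp [comul_h, pow_succ]) (by simp [comul_x])

variable (hn : 2 ≤ n)

/-- The functional `- q⁻¹ ξ` as an element of the dual algebra. -/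
noncomputable def dualX : ConvDual k (Taft hq) := toConv (-q⁻¹ • skewForm hq hn)

/-- Right convolution by ξ is the transpose of `derivR`. This carries the nilpotency of `derivR` to
the dual and makes annihilators of right ideals stable under `derivR`. -/
theorem convMul_skewForm (f : ConvDual k (Taft hq)) :
    f * toConv (skewForm hq hn) = toConv (f.ofConv ∘ₗ derivR hq hn) := by
  ext a
  rw [LinearMap.convMul_apply]
  simp only [derivR, LinearMap.comp_apply]
  induction Coalgebra.comul (R := k) a with
  | zero => simp
  | add s t hs ht => simp only [map_add, hs, ht]
  | tmul b c => simp [mul_comm]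

theorem skewForm_convPow (j : ℕ) (a : Taft hq) :
    (toConv (skewForm hq hn) ^ j : ConvDual k (Taft hq)) a =
      counit (R := k) ((derivR hq hn)^[j] a) := by
  induction j generalizing a with
  | zero => rfl
  | succ j ih =>
    rw [pow_succ, convMul_skewForm]
    exact ih _

theorem dualX_pow : dualX hq hn ^ n = 0 := by
  have h1 : (toConv (skewForm hq hn) ^ n : ConvDual k (Taft hq)) = 0 := by
    ext a
    exact (skewForm_convPow hq hn n a).trans (by rw [derivR_iterate, map_zero]; rfl)
  rw [dualX, toConv_smul, smul_pow, h1, smul_zero]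

include hq in
theorem inv_eq_pow_sub_one : q⁻¹ = q ^ (n - 1) := by
  apply inv_eq_of_mul_eq_one_right
  rw [← pow_succ', Nat.sub_add_cancel NeZero.one_le, hq.pow_eq_one]

/-- Both ξ * χ and χ * ξ are skew derivations between the characters χ² and χ, so by `skew_ext` they
are compared on h and x: both vanish at h, and at x they are q⁻¹ and 1. -/
theorem dualX_mul_dualH : dualX hq hn * dualH hq = q ^ (n - 1) • (dualH hq * dualX hq hn) := by
  rw [← inv_eq_pow_sub_one hq, dualX, toConv_smul, smul_mul_assoc, mul_smul_comm, smul_comm]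
  congr 1
  have e2 : ∀ a, (dualH hq * dualH hq) a = characterPow hq 2 a := fun a => by
    rw [← pow_two, dualH_pow]; rfl
  apply WithConv.ofConv_injective
  apply skew_ext hq (χ := characterPow hq 2) (ψ := character hq)
  · intro a b
    rw [← e2]
    -- The unit is inserted so that every term in b is expressed through Δ(b); the identity then
    -- reduces to pure tensors.
    have e1 : character hq b = ((1 : ConvDual k (Taft hq)) * dualH hq) b := by rw [one_mul]; rfl
    rw [e1, LinearMap.convMul_apply, LinearMap.convMul_apply, LinearMap.convMul_apply,
      LinearMap.convMul_apply, LinearMap.convMul_apply, Bialgebra.comul_mul]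
    generalize comul (R := k) a = s
    generalize comul (R := k) b = t
    induction s with
    | zero => simp
    | add s s' hs hs' => simp only [add_mul, map_add, hs, hs']; ring
    | tmul s s' =>
      induction t with
      | zero => simp
      | add t t' ht ht' => simp only [mul_add, map_add, ht, ht']; ring
      | tmul t t' =>
        simp [dualH, skewForm_mul]
        ring
  · intro a b
    rw [← e2]
    have e1 : character hq b = (dualH hq * (1 : ConvDual k (Taft hq))) b := by rw [mul_one]; rfl
    simp only [ofConv_smul, LinearMap.smul_apply]
    rw [e1, LinearMap.convMul_apply, LinearMap.convMul_apply, LinearMap.convMul_apply,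
      LinearMap.convMul_apply, LinearMap.convMul_apply, Bialgebra.comul_mul]
    generalize comul (R := k) a = s
    generalize comul (R := k) b = t
    induction s with
    | zero => simp
    | add s s' hs hs' => simp only [add_mul, map_add, smul_add, hs, hs']; ring
    | tmul s s' =>
      induction t with
      | zero => simp
      | add t t' ht ht' => simp only [mul_add, map_add, smul_add, ht, ht']; ring
      | tmul t t' =>
        simp [dualH, skewForm_mul]
        ring
  · simp [LinearMap.convMul_apply, comul_h, dualH]
  · simp [LinearMap.convMul_apply, comul_x, dualH]

/-- The algebra map from `⟨H, X⟩` to the dual of `⟨h, x⟩`. -/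
noncomputable def toDual : Taft (isPrimitiveRoot_pow_sub_one hq) →ₐ[k] ConvDual k (Taft hq) :=
  lift (dualH hq) (dualX hq hn)
    (by
      rw [dualH_pow, ← dualH_pow, dualH_pow]
      have : characterPow hq n = Bialgebra.counitAlgHom k _ :=
        algHom_ext (by simp [counit_h, hq.pow_eq_one]) (by simp [counit_x])
      rw [this]
      rfl)
    (dualX_pow hq hn) (dualX_mul_dualH hq hn)

@[simp] theorem toDual_h : toDual hq hn (h _) = dualH hq := lift_h ..

@[simp] theorem toDual_x : toDual hq hn (x _) = dualX hq hn := lift_x ..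

/-- An element of the torus is a polynomial in h, and it may be reduced modulo X^n - 1. The
remainder has degree below n and the n distinct roots q^{-j}, so it is zero. -/
theorem eq_zero_of_characterPow {a : Taft hq} (ha : a ∈ torus hq)
    (h0 : ∀ j, characterPow hq j a = 0) : a = 0 := by
  rw [torus, Algebra.adjoin_singleton_eq_range_aeval] at ha
  obtain ⟨p, rfl⟩ := ha
  let P : Polynomial k := Polynomial.X ^ n - 1
  have hP : P.Monic := Polynomial.monic_X_pow_sub_C 1 (NeZero.ne n)
  have hPh : Polynomial.aeval (h hq) P = 0 := by simp [P, h_pow]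
  have e1 : ∀ j, (p %ₘ P).eval (q⁻¹ ^ j) = 0 := by
    intro j
    have h1 := h0 j
    simp only [RingHom.coe_coe, AlgHom.toRingHom_eq_coe] at h1
    have h2 := Polynomial.modByMonic_add_div p P
    have h3 : P.eval (q⁻¹ ^ j) = 0 := by
      simp [P, ← pow_mul, mul_comm j n]
      simp [pow_mul, hq.pow_eq_one]
    have h4 : p.eval (q⁻¹ ^ j) = 0 := by
      rw [← Polynomial.aeval_algHom_apply, characterPow_h] at h1
      simpa [Polynomial.coe_aeval_eq_eval] using h1
    rw [← h2, Polynomial.eval_add, Polynomial.eval_mul, h3, zero_mul, add_zero] at h4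
    exact h4
  have e2 : p %ₘ P = 0 := by
    refine Polynomial.eq_zero_of_natDegree_lt_card_of_eval_eq_zero _
      (f := fun j : Fin n => q⁻¹ ^ (j : ℕ)) ?_ (fun j => e1 j) ?_
    · intro i j hij
      exact Fin.ext (hq.inv.pow_inj i.2 j.2 hij)
    · rw [Fintype.card_fin]
      have hd : P.natDegree = n := Polynomial.natDegree_X_pow_sub_C (r := (1 : k))
      rw [← hd]
      exact Polynomial.natDegree_modByMonic_lt p hP (by
        intro h1
        rw [h1, Polynomial.natDegree_one] at hd
        exact NeZero.ne n hd.symm)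
  have h2 := Polynomial.modByMonic_add_div p P
  rw [e2, zero_add] at h2
  simp only [RingHom.coe_coe, AlgHom.toRingHom_eq_coe]
  rw [← h2, map_mul, hPh, zero_mul]

/-- The common kernel of the functionals in the image is stable under `derivR`, because the image is
closed under right multiplication by X. It meets the torus trivially, because the image contains the
powers of χ. By `eq_zero_of_derivR_stable` it is zero, so in finite dimension the image is
everything. -/
theorem toDual_surjective : Function.Surjective (toDual hq hn) := by
  let e := WithConv.linearEquiv k (Taft hq →ₗ[k] k)
  let W : Submodule k (Module.Dual k (Taft hq)) :=
    LinearMap.range (e.toLinearMap ∘ₗ (toDual hq hn).toLinearMap)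
  have hV : ∀ a ∈ W.dualCoannihilator, derivR hq hn a ∈ W.dualCoannihilator := by
    intro a ha
    rw [Submodule.mem_dualCoannihilator] at ha ⊢
    rintro _ ⟨b, rfl⟩
    have h1 := ha _ ⟨b * x _, rfl⟩
    simp only [LinearMap.comp_apply, AlgHom.toLinearMap_apply, map_mul, toDual_x, dualX,
      toConv_smul, mul_smul_comm, convMul_skewForm] at h1
    have h2 : -q⁻¹ • (toDual hq hn b) (derivR hq hn a) = 0 := h1
    exact (smul_eq_zero.1 h2).resolve_left
      (neg_ne_zero.2 (inv_ne_zero (hq.ne_zero (NeZero.ne n))))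
  have h0 : ∀ a ∈ W.dualCoannihilator, a ∈ torus hq → a = 0 := by
    intro a ha hT
    rw [Submodule.mem_dualCoannihilator] at ha
    refine eq_zero_of_characterPow hq hT fun j => ?_
    have h1 := ha _ ⟨h _ ^ j, rfl⟩
    simp only [LinearMap.comp_apply, AlgHom.toLinearMap_apply, map_pow, toDual_h, dualH_pow] at h1
    exact h1
  have hbot : W.dualCoannihilator = ⊥ := by
    rw [Submodule.eq_bot_iff]
    intro a ha
    obtain ⟨c, hc, rfl⟩ := exists_sum_x_pow hq a
    have := eq_zero_of_derivR_stable hq hn _ hV h0 le_rfl hc ha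
    exact Finset.sum_eq_zero fun i hi => by rw [this i (Finset.mem_range.1 hi), mul_zero]
  have htop : W = ⊤ := by
    rw [← Subspace.dualCoannihilator_dualAnnihilator_eq (W := W), hbot,
      Submodule.dualAnnihilator_bot]
  intro f
  have hf : e f ∈ W := htop ▸ Submodule.mem_top
  obtain ⟨a, ha⟩ := hf
  exact ⟨a, e.injective ha⟩

include hn in
theorem finrank_le : Module.finrank k (Taft hq) ≤
    Module.finrank k (Taft (isPrimitiveRoot_pow_sub_one hq)) := by
  rw [← Subspace.dual_finrank_eq (K := k) (V := Taft hq),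
    ← (WithConv.linearEquiv k (Taft hq →ₗ[k] k)).finrank_eq]
  exact LinearMap.finrank_le_finrank_of_surjective (f := (toDual hq hn).toLinearMap)
    (toDual_surjective hq hn)

/-- Surjectivity bounds the dimension of the Taft algebra at q by the one at q⁻¹. The same bound
with q⁻¹ for q gives equality, so no basis of the Taft algebra is needed. -/
theorem toDual_bijective : Function.Bijective (toDual hq hn) := by
  -- Applying the construction twice gives the root (q^{n-1})^{n-1}, which equals q but is a
  -- different expression; the dimensions have to be transported along this equality.
  have h1 : ∀ {r s : k} (hr : IsPrimitiveRoot r n) (hs : IsPrimitiveRoot s n), r = s →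
      Module.finrank k (Taft hr) = Module.finrank k (Taft hs) := by
    rintro r _ hr hs rfl
    rfl
  have h2 : Module.finrank k (Taft (isPrimitiveRoot_pow_sub_one hq)) =
      Module.finrank k (ConvDual k (Taft hq)) := by
    rw [(WithConv.linearEquiv k (Taft hq →ₗ[k] k)).finrank_eq]
    refine le_antisymm ?_ ?_
    · refine (finrank_le (isPrimitiveRoot_pow_sub_one hq) hn).trans (le_of_eq ?_)
      refine (h1 _ hq ?_).trans (Subspace.dual_finrank_eq (K := k) (V := Taft hq)).symm
      rw [← inv_eq_pow_sub_one (isPrimitiveRoot_pow_sub_one hq), ← inv_eq_pow_sub_one hq, inv_inv]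
    · exact (Subspace.dual_finrank_eq (K := k) (V := Taft hq)).le.trans (finrank_le hq hn)
  have : Module.Finite k (ConvDual k (Taft hq)) :=
    Module.Finite.equiv (WithConv.linearEquiv k (Taft hq →ₗ[k] k)).symm
  exact ⟨(LinearMap.injective_iff_surjective_of_finrank_eq_finrank h2
    (f := (toDual hq hn).toLinearMap)).2 (toDual_surjective hq hn), toDual_surjective hq hn⟩

end Taft

open HopfAlgebra

/-! ### Straightening products in the Drinfeld double. -/

namespace DrinfeldDouble

variable {k : Type u} [Field k] {H : Type v} [Ring H] [HopfAlgebra k H]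
  (hS : Function.Bijective (antipode k (A := H)))

theorem mk_mul_mk' (f g : ConvDual k H) (a b : H) :
    mk hS f a * mk hS g b = outer f b (twist hS (comulTwo a) g) := rfl

theorem mk_one_right_mul (f g : ConvDual k H) (b : H) :
    mk hS f 1 * mk hS g b = mk hS (f * g) b := by
  rw [mk_mul_mk', twist_comulTwo_one, outer_tmul, one_mul]
  rfl

theorem mul_mk_one_left (f : ConvDual k H) (a b : H) :
    mk hS f a * mk hS 1 b = mk hS f (a * b) := by
  rw [mk_mul_mk', twist_comulTwo_unit, outer_tmul, mul_one]
  rfl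

theorem one_def : (1 : DrinfeldDouble hS) = mk hS 1 1 := rfl

theorem mk_add_left (f g : ConvDual k H) (a : H) : mk hS (f + g) a = mk hS f a + mk hS g a :=
  TensorProduct.add_tmul ..

theorem mk_add_right (f : ConvDual k H) (a b : H) : mk hS f (a + b) = mk hS f a + mk hS f b :=
  TensorProduct.tmul_add ..

theorem smul_mk (c : k) (f : ConvDual k H) (a : H) : c • mk hS f a = mk hS (c • f) a :=
  TensorProduct.smul_tmul' ..

theorem smul_mk' (c : k) (f : ConvDual k H) (a : H) : c • mk hS f a = mk hS f (c • a) :=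
  (TensorProduct.tmul_smul ..).symm

/-- The embedding of the dual algebra. -/
noncomputable def inl : ConvDual k H →ₐ[k] DrinfeldDouble hS :=
  AlgHom.ofLinearMap
    { toFun := fun f => mk hS f 1
      map_add' := fun f g => mk_add_left hS f g 1
      map_smul' := fun c f => (smul_mk hS c f 1).symm }
    rfl (fun f g => (mk_one_right_mul hS f g 1).symm)

/-- The embedding of the Hopf algebra. -/
noncomputable def inr : H →ₐ[k] DrinfeldDouble hS :=
  AlgHom.ofLinearMap
    { toFun := fun a => mk hS 1 a
      map_add' := fun a b => mk_add_right hS 1 a b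
      map_smul' := fun c a => (smul_mk' hS c 1 a).symm }
    rfl (fun a b => (mul_mk_one_left hS 1 a b).symm)

theorem inl_apply (f : ConvDual k H) : inl hS f = mk hS f 1 := rfl

theorem inr_apply (a : H) : inr hS a = mk hS 1 a := rfl

theorem inl_mul_inr (f : ConvDual k H) (a : H) : inl hS f * inr hS a = mk hS f a := by
  rw [inl_apply, inr_apply, mul_mk_one_left, one_mul]

/-- Straightening a product of group-likes. -/
theorem inr_mul_inl_of_groupLike {g : H} (hg : comul (R := k) g = g ⊗ₜ g) (f : ConvDual k H) :
    inr hS g * inl hS f = mk hS (coadj hS g g f) g := by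
  rw [inl_apply, inr_apply, mk_mul_mk', comulTwo_apply, hg, LinearMap.lTensor_tmul, hg, twist_tmul,
    outer_tmul, mul_one, one_mul]
  rfl

/-- The three terms are those of Δ²(x) = x ⊗ g ⊗ g + 1 ⊗ x ⊗ g + 1 ⊗ 1 ⊗ x. -/
theorem inr_mul_inl_of_skewPrimitive {g x : H} (hg : comul (R := k) g = g ⊗ₜ g)
    (hx : comul (R := k) x = x ⊗ₜ g + 1 ⊗ₜ x) (f : ConvDual k H) :
    inr hS x * inl hS f = mk hS (coadj hS x g f) g + mk hS (coadj hS 1 g f) x +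
      mk hS (coadj hS 1 x f) 1 := by
  have h1 : comulTwo (k := k) x = x ⊗ₜ (g ⊗ₜ g) + (1 ⊗ₜ (x ⊗ₜ g) + 1 ⊗ₜ (1 ⊗ₜ x)) := by
    rw [comulTwo_apply, hx, map_add, LinearMap.lTensor_tmul, LinearMap.lTensor_tmul, hg, hx,
      TensorProduct.tmul_add]
  rw [inl_apply, inr_apply, mk_mul_mk', h1, map_add, map_add, LinearMap.add_apply,
    LinearMap.add_apply, twist_tmul, twist_tmul, twist_tmul, map_add, map_add, outer_tmul,
    outer_tmul, outer_tmul, mul_one, mul_one, mul_one, one_mul, one_mul, one_mul, add_assoc]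
  rfl

end DrinfeldDouble

/-! ### The comultiplication of the dual, tested on H ⊗ H. -/

section DualComul

variable {k : Type u} [Field k] {H : Type v} [Ring H] [HopfAlgebra k H]

variable (k H) in
/-- The functional on `H ⊗ H` given by an element of `H* ⊗ H*`. -/
noncomputable def dualPairing : ConvDual k H ⊗[k] ConvDual k H →ₗ[k] WithConv (H ⊗[k] H →ₗ[k] k) :=
  (WithConv.linearEquiv k _).symm.toLinearMap ∘ₗ TensorProduct.dualDistrib k H H ∘ₗ
    TensorProduct.map (WithConv.linearEquiv k (H →ₗ[k] k)).toLinearMap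
      (WithConv.linearEquiv k (H →ₗ[k] k)).toLinearMap

theorem dualPairing_tmul (f g : ConvDual k H) (a b : H) :
    dualPairing k H (f ⊗ₜ g) (a ⊗ₜ b) = f a * g b := rfl

theorem convMul_tensor_apply (U V : WithConv (H ⊗[k] H →ₗ[k] k)) (a b : H) :
    (U * V) (a ⊗ₜ b) = LinearMap.mul' k k (TensorProduct.map U.ofConv V.ofConv
      (TensorProduct.AlgebraTensorModule.tensorTensorTensorComm k k k k H H H H
        (comul (R := k) a ⊗ₜ comul (R := k) b))) := by
  rw [LinearMap.convMul_apply, TensorProduct.comul_tmul]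

/-- Together with `oppositeMul_mul` this makes both sides of `dualComulCop_eq_iff` multiplicative,
so that formulas for the comultiplication need checking only on algebra generators. -/
theorem dualPairing_mul (w w' : ConvDual k H ⊗[k] ConvDual k H) :
    dualPairing k H (w * w') = dualPairing k H w * dualPairing k H w' := by
  induction w with
  | zero =>
    have e : 0 * w' = 0 := zero_mul w'
    rw [e, map_zero, zero_mul]
  | add w v hw hv =>
    have e : (w + v) * w' = w * w' + v * w' :=
      LinearMap.map_add₂ (Algebra.TensorProduct.mul (R := k)) w v w'
    rw [e, map_add, map_add, hw, hv, add_mul]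
  | tmul f g =>
    induction w' with
    | zero =>
      have e : f ⊗ₜ[k] g * 0 = 0 := mul_zero (f ⊗ₜ[k] g)
      rw [e, map_zero, mul_zero]
    | add w v hw hv =>
      have e : f ⊗ₜ[k] g * (w + v) = f ⊗ₜ[k] g * w + f ⊗ₜ[k] g * v :=
        map_add (Algebra.TensorProduct.mul (R := k) (f ⊗ₜ[k] g)) w v
      rw [e, map_add, map_add, hw, hv, mul_add]
    | tmul f' g' =>
      apply WithConv.ofConv_injective
      refine TensorProduct.ext' fun a b => ?_
      rw [Algebra.TensorProduct.tmul_mul_tmul, convMul_tensor_apply]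
      change (f * f') a * (g * g') b = _
      rw [LinearMap.convMul_apply, LinearMap.convMul_apply]
      generalize comul (R := k) a = s
      generalize comul (R := k) b = t
      induction s with
      | zero => simp
      | add s s' hs hs' => simp only [TensorProduct.add_tmul, map_add, hs, hs', add_mul]
      | tmul s s' =>
        induction t with
        | zero => simp
        | add t t' ht ht' => simp only [TensorProduct.tmul_add, map_add, ht, ht', mul_add]
        | tmul t t' =>
          simp only [TensorProduct.map_tmul, LinearMap.mul'_apply,
            TensorProduct.AlgebraTensorModule.tensorTensorTensorComm_tmul]
          change _ = (f s * g t) * (f' s' * g' t')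
          ring

/-- The functional `a ⊗ b ↦ f(b a)`. -/
noncomputable def oppositeMul (f : ConvDual k H) : WithConv (H ⊗[k] H →ₗ[k] k) :=
  toConv (f.ofConv ∘ₗ LinearMap.mul' k H ∘ₗ (TensorProduct.comm k H H).toLinearMap)

theorem oppositeMul_apply (f : ConvDual k H) (a b : H) : oppositeMul f (a ⊗ₜ b) = f (b * a) := rfl

/-- The comultiplication of H is multiplicative, so f ↦ f(b a) respects convolution. -/
theorem oppositeMul_mul (f g : ConvDual k H) :
    oppositeMul (f * g) = oppositeMul f * oppositeMul g := by
  apply WithConv.ofConv_injective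
  refine TensorProduct.ext' fun a b => ?_
  rw [convMul_tensor_apply, oppositeMul_apply, LinearMap.convMul_apply, Bialgebra.comul_mul]
  generalize comul (R := k) a = s
  generalize comul (R := k) b = t
  induction s with
  | zero => simp
  | add s s' hs hs' => simp only [TensorProduct.add_tmul, map_add, hs, hs', mul_add]
  | tmul s s' =>
    induction t with
    | zero => simp
    | add t t' ht ht' => simp only [TensorProduct.tmul_add, map_add, ht, ht', add_mul]
    | tmul t t' =>
      rw [Algebra.TensorProduct.tmul_mul_tmul]
      rfl

/-- In finite dimension the pairing is injective, so elements of H* ⊗ H* may be compared as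
functionals on H ⊗ H. -/
theorem dualComulCop_eq_iff [Module.Finite k H] (f : ConvDual k H)
    (w : ConvDual k H ⊗[k] ConvDual k H) :
    dualComulCop k H f = w ↔ dualPairing k H w = oppositeMul f := by
  have h1 : dualPairing k H (dualComulCop k H f) = oppositeMul f := by
    apply WithConv.ofConv_injective
    exact TensorProduct.ext' fun a b => dualComulCop_apply f a b
  have h2 : Function.Injective (dualPairing k H) := by
    let L := WithConv.linearEquiv k (H →ₗ[k] k)
    have h3 : Function.Injective (TensorProduct.map L.toLinearMap L.toLinearMap) :=
      (TensorProduct.congr L L).injective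
    have h4 : Function.Injective (TensorProduct.dualDistrib k H H) :=
      (TensorProduct.dualDistribEquiv k H H).injective
    exact (WithConv.linearEquiv k _).symm.injective.comp (h4.comp h3)
  exact ⟨fun h => h ▸ h1, fun h => h2 (h1.trans h.symm)⟩

end DualComul

/-! ### The Drinfeld double satisfies the relations of `TaftQ hq 1`. -/

namespace Taft

variable {k : Type u} [Field k] {n : ℕ} {q : k} (hq : IsPrimitiveRoot q n) [NeZero n]
  (hn : 2 ≤ n)

/-- By multiplicativity only H and X matter. For H it says that χ is a character. For X it is the
rule ξ(b a) = χ(b) ξ(a) + ξ(b) ε(a), whose order of factors matches the co-opposite structure and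
makes X an (H, 1)-primitive element. -/
theorem dualComulCop_toDual (a : Taft (isPrimitiveRoot_pow_sub_one hq)) :
    dualComulCop k (Taft hq) (toDual hq hn a) =
      TensorProduct.map (toDual hq hn).toLinearMap (toDual hq hn).toLinearMap (comul a) := by
  rw [dualComulCop_eq_iff]
  have ha : a ∈ Algebra.adjoin k {h (isPrimitiveRoot_pow_sub_one hq),
      x (isPrimitiveRoot_pow_sub_one hq)} :=
    adjoin_eq_top (isPrimitiveRoot_pow_sub_one hq) ▸ Algebra.mem_top
  induction ha using Algebra.adjoin_induction with
  | mem a ha =>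
    rcases ha with rfl | rfl
    · apply WithConv.ofConv_injective
      refine TensorProduct.ext' fun a b => ?_
      rw [comul_h, TensorProduct.map_tmul, AlgHom.toLinearMap_apply, toDual_h, dualPairing_tmul,
        oppositeMul_apply]
      simp [dualH, mul_comm]
    · apply WithConv.ofConv_injective
      refine TensorProduct.ext' fun a b => ?_
      rw [comul_x, map_add, map_add, TensorProduct.map_tmul, TensorProduct.map_tmul]
      simp only [AlgHom.toLinearMap_apply, toDual_h, toDual_x, map_one, ofConv_add,
        LinearMap.add_apply]
      rw [dualPairing_tmul, dualPairing_tmul, oppositeMul_apply]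
      simp [dualH, dualX, skewForm_mul]
      ring
  | algebraMap c =>
    apply WithConv.ofConv_injective
    refine TensorProduct.ext' fun a b => ?_
    rw [Algebra.algebraMap_eq_smul_one, map_smul, map_smul, map_smul, map_smul, Bialgebra.comul_one,
      Algebra.TensorProduct.one_def, TensorProduct.map_tmul]
    simp only [AlgHom.toLinearMap_apply, map_one, ofConv_smul, LinearMap.smul_apply]
    rw [dualPairing_tmul, oppositeMul_apply]
    simp [mul_comm]
  | add a b _ _ ha hb =>
    rw [map_add, map_add, map_add, map_add, ha, hb]
    rfl
  | mul a b _ _ ha hb =>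
    have h1 : ∀ s t, TensorProduct.map (toDual hq hn).toLinearMap (toDual hq hn).toLinearMap (s * t)
        = TensorProduct.map (toDual hq hn).toLinearMap (toDual hq hn).toLinearMap s *
          TensorProduct.map (toDual hq hn).toLinearMap (toDual hq hn).toLinearMap t :=
      map_mul (Algebra.TensorProduct.map (toDual hq hn) (toDual hq hn))
    rw [Bialgebra.comul_mul, h1, dualPairing_mul, ha, hb, map_mul, oppositeMul_mul]

theorem toDual_apply_one (a : Taft (isPrimitiveRoot_pow_sub_one hq)) :
    toDual hq hn a 1 = counit (R := k) a := by
  have ha : a ∈ Algebra.adjoin k {h (isPrimitiveRoot_pow_sub_one hq),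
      x (isPrimitiveRoot_pow_sub_one hq)} :=
    adjoin_eq_top (isPrimitiveRoot_pow_sub_one hq) ▸ Algebra.mem_top
  induction ha using Algebra.adjoin_induction with
  | mem a ha =>
    rcases ha with rfl | rfl
    · simp [dualH, counit_h]
    · simp [dualX, counit_x]
  | algebraMap c => simp [Algebra.algebraMap_eq_smul_one]
  | add a b _ _ ha hb => rw [map_add, map_add, ← ha, ← hb]; rfl
  | mul a b _ _ ha hb =>
    rw [map_mul, LinearMap.convMul_apply, Bialgebra.counit_mul, ← ha, ← hb, Bialgebra.comul_one,
      Algebra.TensorProduct.one_def]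
    rfl

theorem antipodeInv_h : antipodeInv (antipode_bijective hq) (h hq) = h hq ^ (n - 1) := by
  have h1 : antipodeInv (antipode_bijective hq) (h hq ^ (n - 1)) = h hq := by
    rw [← antipode_h, antipodeInv_antipode]
  have h2 := antipodeInv_mul (antipode_bijective hq) (h hq ^ (n - 1)) (h hq)
  rw [inv_mul_h, antipodeInv_one, h1] at h2
  exact left_inv_eq_right_inv h2.symm (h_mul_inv hq)

theorem antipodeInv_x :
    antipodeInv (antipode_bijective hq) (x hq) = -(h hq ^ (n - 1) * x hq) := by
  have h1 : antipodeInv (antipode_bijective hq) (h hq ^ (n - 1)) = h hq := by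
    rw [← antipode_h, antipodeInv_antipode]
  have h2 := antipodeInv_antipode (antipode_bijective hq) (x hq)
  rw [antipode_x, map_neg, antipodeInv_mul, h1] at h2
  rw [← h2, mul_neg, neg_neg, ← mul_assoc, inv_mul_h, one_mul, h2]

theorem character_h_pow_sub_one : character hq (h hq ^ (n - 1)) = q := by
  rw [map_pow, character_h, inv_pow, ← inv_eq_pow_sub_one hq, inv_inv]

/-- The generators of the Drinfeld double satisfy the relations of `Q^1_n(q)`. -/
theorem double_relations :
    BicrossRelations (B := DrinfeldDouble (antipode_bijective hq)) n n q (q ^ (n - 1)) q 1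
      (DrinfeldDouble.inr (antipode_bijective hq) (h hq))
      (DrinfeldDouble.inr (antipode_bijective hq) (x hq))
      (DrinfeldDouble.inl (antipode_bijective hq) (dualH hq))
      (DrinfeldDouble.inl (antipode_bijective hq) (dualX hq hn)) := by
  have hq0 : q ≠ 0 := hq.ne_zero (NeZero.ne n)
  have hχ := character_h_pow_sub_one hq
  have hξ : skewForm hq hn (h hq ^ (n - 1)) = 0 := skewForm_h_pow ..
  have H1 : dualH hq ^ n = 1 := by
    have := congrArg (toDual hq hn) (h_pow (isPrimitiveRoot_pow_sub_one hq))
    simpa using this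
  constructor
  · rw [← map_pow, h_pow, map_one]
  · rw [← map_pow, H1, map_one]
  · rw [← map_pow, x_pow, map_zero]
  · rw [← map_pow, dualX_pow, map_zero]
  · rw [← map_mul, xh, map_smul, map_mul]
  · rw [← map_mul, dualX_mul_dualH, map_smul, map_mul]
  · rw [DrinfeldDouble.inr_mul_inl_of_skewPrimitive _ (comul_h hq) (comul_x hq)]
    -- The character χ kills x, so only the middle term of the straightening formula survives; its
    -- factor q is χ(h⁻¹).
    have e1 : coadj (antipode_bijective hq) (x hq) (h hq) (dualH hq) = 0 := by
      ext a
      simp [coadj_apply, dualH]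
    have e2 : coadj (antipode_bijective hq) 1 (h hq) (dualH hq) = q • dualH hq := by
      ext a
      simp only [coadj_apply, dualH, antipodeInv_h]
      simp [-map_pow, hχ]
    have e3 : coadj (antipode_bijective hq) 1 (x hq) (dualH hq) = 0 := by
      ext a
      simp [coadj_apply, dualH, antipodeInv_x]
    rw [e1, e2, e3, DrinfeldDouble.inl_mul_inr, DrinfeldDouble.smul_mk]
    have e4 : ∀ a, DrinfeldDouble.mk (antipode_bijective hq) 0 a = 0 :=
      fun a => TensorProduct.zero_tmul ..
    rw [e4, e4, zero_add, add_zero]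
  · rw [DrinfeldDouble.inr_mul_inl_of_groupLike _ (comul_h hq)]
    have e2 : coadj (antipode_bijective hq) (h hq) (h hq) (dualX hq hn) = q • dualX hq hn := by
      ext a
      simp only [coadj_apply, dualX, antipodeInv_h]
      simp [-map_pow, hχ, hξ, skewForm_mul, counit_h]
      ring
    rw [e2, DrinfeldDouble.inl_mul_inr, DrinfeldDouble.smul_mk]
  · rw [DrinfeldDouble.inr_mul_inl_of_skewPrimitive _ (comul_h hq) (comul_x hq)]
    -- The factor -q⁻¹ in `dualX` is chosen for this relation: the outer terms become exactly -H h
    -- and 1, and the middle one q X x.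
    have e1 : coadj (antipode_bijective hq) (x hq) (h hq) (dualX hq hn) = -dualH hq := by
      ext a
      simp only [coadj_apply, dualX, dualH, antipodeInv_h]
      simp [-map_pow, hχ, hξ, skewForm_mul, counit_x]
      field_simp
    have e2 : coadj (antipode_bijective hq) 1 (h hq) (dualX hq hn) = q • dualX hq hn := by
      ext a
      simp only [coadj_apply, dualX, antipodeInv_h]
      simp [-map_pow, hχ, hξ, skewForm_mul]
      ring
    have e3 : coadj (antipode_bijective hq) 1 (x hq) (dualX hq hn) = 1 := by
      ext a
      simp only [coadj_apply, dualX, antipodeInv_x]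
      simp [-map_pow, hχ, hξ, skewForm_mul, hq0]
    rw [e1, e2, e3, DrinfeldDouble.inl_mul_inr, DrinfeldDouble.inl_mul_inr, DrinfeldDouble.smul_mk,
      one_smul]
    have e4 : ∀ f a, DrinfeldDouble.mk (antipode_bijective hq) (-f) a =
      -DrinfeldDouble.mk (antipode_bijective hq) f a := fun f a => TensorProduct.neg_tmul ..
    rw [e4, DrinfeldDouble.one_def]
    abel
  · rw [DrinfeldDouble.inr_mul_inl_of_groupLike _ (comul_h hq)]
    have e2 : coadj (antipode_bijective hq) (h hq) (h hq) (dualH hq) = dualH hq := by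
      ext a
      simp only [coadj_apply, dualH, antipodeInv_h]
      simp [-map_pow, hχ, hq0, mul_comm]
    rw [e2, DrinfeldDouble.inl_mul_inr]

end Taft

/-! ### Transport of automorphism groups along an isomorphism. -/

section Conjugation

variable {k : Type u} [CommSemiring k] {A : Type v} [Semiring A] [Algebra k A]
  [CoalgebraStruct k A] {B : Type w} [Semiring B] [Algebra k B] [CoalgebraStruct k B]

/-- Isomorphic Hopf algebras have isomorphic automorphism groups. -/
def hopfAutCongr (e : A ≃ₐc[k] B) : HopfAut k A ≃* HopfAut k B where
  toFun f := (e.symm.trans f).trans e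
  invFun f := (e.trans f).trans e.symm
  left_inv f := BialgEquiv.ext fun a => by
    simp
    rfl
  right_inv f := BialgEquiv.ext fun a => by
    simp
    rfl
  map_mul' f g := BialgEquiv.ext fun a => by
    change e (f (g (e.symm a))) = e (f (e.symm (e (g (e.symm a)))))
    simp

end Conjugation

/-! ### The isomorphism of `TaftQ hq 1` with the Drinfeld double. -/

namespace Taft

variable {k : Type u} [Field k] {n : ℕ} {q : k} (hq : IsPrimitiveRoot q n) [NeZero n]
  (hn : 2 ≤ n)

/-- The algebra map from `Q^1_n(q)` to the Drinfeld double. -/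
noncomputable def toDouble : TaftQ hq 1 →ₐ[k] DrinfeldDouble (antipode_bijective hq) :=
  Bicross.lift (double_relations hq hn)

theorem toDouble_inl (a : Taft (isPrimitiveRoot_pow_sub_one hq)) :
    toDouble hq hn (Bicross.inl (isPrimitiveRoot_pow_sub_one hq) hq q 1 a) =
      DrinfeldDouble.inl (antipode_bijective hq) (toDual hq hn a) := by
  have h1 : (toDouble hq hn).comp
        (Bicross.inl (isPrimitiveRoot_pow_sub_one hq) hq q 1 : _ →ₐ[k] _) =
      (DrinfeldDouble.inl (antipode_bijective hq)).comp (toDual hq hn) := by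
    apply algHom_ext
    · simp only [AlgHom.comp_apply, toDual_h]
      exact (congrArg (toDouble hq hn) (Bicross.inl_h ..)).trans (Bicross.lift_H ..)
    · simp only [AlgHom.comp_apply, toDual_x]
      exact (congrArg (toDouble hq hn) (Bicross.inl_x ..)).trans (Bicross.lift_X ..)
  exact DFunLike.congr_fun h1 a

theorem toDouble_inr (b : Taft hq) :
    toDouble hq hn (Bicross.inr (isPrimitiveRoot_pow_sub_one hq) hq q 1 b) =
      DrinfeldDouble.inr (antipode_bijective hq) b := by
  have h1 : (toDouble hq hn).comp
        (Bicross.inr (isPrimitiveRoot_pow_sub_one hq) hq q 1 : _ →ₐ[k] _) =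
      DrinfeldDouble.inr (antipode_bijective hq) := by
    apply algHom_ext
    · exact (congrArg (toDouble hq hn) (Bicross.inr_h ..)).trans (Bicross.lift_h ..)
    · exact (congrArg (toDouble hq hn) (Bicross.inr_x ..)).trans (Bicross.lift_x ..)
  exact DFunLike.congr_fun h1 b

/-- In the coordinates T' ⊗ T the map to the double is `toDual` ⊗ id, hence bijective. This yields
injectivity of the multiplication map for α = 1 and, as that map is surjective, bijectivity of
`toDouble`. -/
theorem toDouble_mulLinear
    (z : Taft (isPrimitiveRoot_pow_sub_one hq) ⊗[k] Taft hq) :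
    toDouble hq hn (Bicross.mulLinear (isPrimitiveRoot_pow_sub_one hq) hq q 1 z) =
      TensorProduct.map (toDual hq hn).toLinearMap LinearMap.id z := by
  induction z with
  | zero => rw [map_zero, map_zero, map_zero]; rfl
  | add z w hz hw => rw [map_add, map_add, map_add, hz, hw]; rfl
  | tmul a b =>
    rw [Bicross.mulLinear_tmul, map_mul, toDouble_inl, toDouble_inr, DrinfeldDouble.inl_mul_inr]
    rfl

theorem map_toDual_bijective : Function.Bijective
    (TensorProduct.map (toDual hq hn).toLinearMap (LinearMap.id : Taft hq →ₗ[k] Taft hq)) :=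
  (TensorProduct.congr (LinearEquiv.ofBijective (toDual hq hn).toLinearMap
    (toDual_bijective hq hn)) (LinearEquiv.refl k _)).bijective

include hn in
theorem mulLinear_one_injective :
    Function.Injective (Bicross.mulLinear (isPrimitiveRoot_pow_sub_one hq) hq q 1) := by
  intro z w hzw
  apply (map_toDual_bijective hq hn).1
  rw [← toDouble_mulLinear, ← toDouble_mulLinear, hzw]

theorem toDouble_bijective : Function.Bijective (toDouble hq hn) := by
  constructor
  · intro z w hzw
    obtain ⟨z, rfl⟩ := Bicross.mulLinear_surjective _ _ _ _ z
    obtain ⟨w, rfl⟩ := Bicross.mulLinear_surjective _ _ _ _ w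
    rw [toDouble_mulLinear, toDouble_mulLinear] at hzw
    rw [(map_toDual_bijective hq hn).1 hzw]
  · intro w
    obtain ⟨z, hz⟩ := (map_toDual_bijective hq hn).2 w
    exact ⟨_, (toDouble_mulLinear hq hn z).trans hz⟩

theorem counit_toDouble (z : TaftQ hq 1) :
    counit (R := k) (toDouble hq hn z) = counit (R := k) z := by
  obtain ⟨z, rfl⟩ := Bicross.mulLinear_surjective _ _ _ _ z
  induction z with
  | zero => simp only [map_zero]
  | add z w hz hw => simp only [map_add, hz, hw]
  | tmul a b =>
    rw [Bicross.mulLinear_tmul, map_mul, toDouble_inl, toDouble_inr, DrinfeldDouble.inl_mul_inr,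
      DrinfeldDouble.counit_mk, toDual_apply_one, Bialgebra.counit_mul,
      CoalgHomClass.counit_comp_apply, CoalgHomClass.counit_comp_apply]

theorem comul_double_mk (f : ConvDual k (Taft hq)) (b : Taft hq) :
    comul (R := k) (DrinfeldDouble.mk (antipode_bijective hq) f b) =
      TensorProduct.tensorTensorTensorComm k _ _ _ _
        (dualComulCop k (Taft hq) f ⊗ₜ comul (R := k) b) := rfl

/-- Both coalgebras are tensor products in these coordinates, so the claim reduces to the
compatibility of `toDual` with the comultiplications. -/
theorem comul_toDouble (z : TaftQ hq 1) :
    comul (R := k) (toDouble hq hn z) =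
      TensorProduct.map (toDouble hq hn).toLinearMap (toDouble hq hn).toLinearMap
        (comul (R := k) z) := by
  obtain ⟨z, rfl⟩ := Bicross.mulLinear_surjective _ _ _ _ z
  induction z with
  | zero => simp only [map_zero]
  | add z w hz hw => simp only [map_add, hz, hw]
  | tmul a b =>
    have h1 := CoalgHomClass.map_comp_comul_apply
      (Bicross.mulCoalgHom (isPrimitiveRoot_pow_sub_one hq) hq q 1) (a ⊗ₜ b)
    change _ = comul (Bicross.mulLinear (isPrimitiveRoot_pow_sub_one hq) hq q 1 (a ⊗ₜ b)) at h1
    rw [← h1, Bicross.mulLinear_tmul, map_mul, toDouble_inl, toDouble_inr,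
      DrinfeldDouble.inl_mul_inr, comul_double_mk, dualComulCop_toDual, TensorProduct.comul_tmul]
    generalize comul (R := k) a = s
    generalize comul (R := k) b = t
    induction s with
    | zero =>
      simp only [map_zero, TensorProduct.zero_tmul]
      rfl
    | add s s' hs hs' =>
      simp only [map_add, TensorProduct.add_tmul, hs, hs']
      rfl
    | tmul a a' =>
      induction t with
      | zero =>
        simp only [map_zero, TensorProduct.tmul_zero]
        rfl
      | add t t' ht ht' =>
        simp only [map_add, TensorProduct.tmul_add, ht, ht']
        rfl
      | tmul b b' =>
        have h2 : ∀ a b, toDouble hq hn (Bicross.mulCoalgHom (isPrimitiveRoot_pow_sub_one hq) hq q 1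
            (a ⊗ₜ b)) = toDual hq hn a ⊗ₜ b := fun a b => toDouble_mulLinear hq hn (a ⊗ₜ b)
        change _ = toDouble hq hn (Bicross.mulCoalgHom (isPrimitiveRoot_pow_sub_one hq) hq q 1
            (a ⊗ₜ b)) ⊗ₜ toDouble hq hn (Bicross.mulCoalgHom (isPrimitiveRoot_pow_sub_one hq) hq q 1
            (a' ⊗ₜ b'))
        rw [h2, h2]
        rfl

/-- The Drinfeld double of a Taft algebra is `Q^1_n(q)`. -/
noncomputable def doubleEquiv :
    TaftQ hq 1 ≃ₐc[k] DrinfeldDouble (antipode_bijective hq) where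
  toCoalgEquiv :=
    { LinearEquiv.ofBijective (toDouble hq hn).toLinearMap (toDouble_bijective hq hn) with
      counit_comp := LinearMap.ext (counit_toDouble hq hn)
      map_comp_comul := LinearMap.ext fun z => (comul_toDouble hq hn z).symm }
  map_mul' := map_mul (toDouble hq hn)

end Taft

/-! ### The automorphism groups in the individual cases. -/

namespace Bicross

variable {k : Type u} [Field k]

theorem nonempty_hopfAut_taftT {m n : ℕ} [NeZero m] [NeZero n] (hm : 2 ≤ m) (hn : 2 ≤ n)
    {q q' σ : k} (hq : IsPrimitiveRoot q m) (hq' : IsPrimitiveRoot q' n) (hσm : σ ^ m = 1)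
    (hσn : σ ^ n = 1) (hne : q ≠ q' ∨ σ ^ 2 ≠ 1) :
    Nonempty (HopfAut k (TaftT hq' hq σ) ≃* kˣ × kˣ) :=
  nonempty_hopfAut_mulEquiv hm hn (mulLinear_injective hq' hq hσm hσn) (MonoidHom.id _)
    (fun _ => zero_mul _) Function.injective_id (fun a b _ => ⟨(a, b), rfl⟩) hne

theorem nonempty_hopfAut_taftT_semidirect {n : ℕ} [NeZero n] (hn : 2 ≤ n)
    {q σ : k} (hq : IsPrimitiveRoot q n) (hσn : σ ^ n = 1) (hσ : σ ^ 2 = 1) :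
    Nonempty (HopfAut k (TaftT hq hq σ) ≃*
      (kˣ × kˣ) ⋊[swapAction kˣ] Multiplicative (ZMod 2)) :=
  nonempty_hopfAut_mulEquiv_semidirect hn (mulLinear_injective hq hq hσn hσn) (MonoidHom.id _)
    (fun _ => zero_mul _) Function.injective_id (fun a b _ => ⟨(a, b), rfl⟩) rfl hσ (by simp)
    MulEquiv.prodComm _ (fun _ => rfl)

theorem units_inv_hom_surj (a b : kˣ) (hab : (1 : k) * (a * b) = 1) :
    ∃ c, ((MonoidHom.id kˣ).prod invMonoidHom) c = (a, b) := by
  refine ⟨a, Prod.ext rfl ?_⟩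
  rw [one_mul] at hab
  exact inv_eq_of_mul_eq_one_right (Units.ext hab)

/-- Here σ = q has order n ≥ 3, so σ² ≠ 1 and no exchange is possible. -/
theorem nonempty_hopfAut_taftQ {n : ℕ} [NeZero n] (hn : 3 ≤ n) {q : k}
    (hq : IsPrimitiveRoot q n) : Nonempty (HopfAut k (TaftQ hq 1) ≃* kˣ) :=
  nonempty_hopfAut_mulEquiv (by omega) (by omega) (Taft.mulLinear_one_injective hq (by omega))
    ((MonoidHom.id _).prod invMonoidHom) (fun c => by simp)
    (fun a b hab => congrArg Prod.fst hab) units_inv_hom_surj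
    (Or.inr (hq.pow_ne_one_of_pos_of_lt two_ne_zero (by omega)))

/-- For n = 2 the root is q = -1, so q^{n-1} = q, σ² = 1 and σ α = -α: all conditions for the
exchange hold. -/
theorem nonempty_hopfAut_taftQ_semidirect {n : ℕ} [NeZero n] (hn : n = 2) {q : k}
    (hq : IsPrimitiveRoot q n) :
    Nonempty (HopfAut k (TaftQ hq 1) ≃* kˣ ⋊[invAction kˣ] Multiplicative (ZMod 2)) := by
  have h2 : q ^ 2 = 1 := hn ▸ hq.pow_eq_one
  have h3 : q = -1 := (mul_self_eq_one_iff.mp (by rwa [← sq])).resolve_left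
    (hq.ne_one (by omega))
  exact nonempty_hopfAut_mulEquiv_semidirect (by omega)
    (Taft.mulLinear_one_injective hq (by omega))
    ((MonoidHom.id _).prod invMonoidHom) (fun c => by simp)
    (fun a b hab => congrArg Prod.fst hab) units_inv_hom_surj
    (by rw [hn, pow_one]) h2 (by rw [h3, mul_one])
    (MulEquiv.inv kˣ) _ (fun c => Prod.ext rfl (inv_inv c))

end Bicross

end TaftBicrossed

theorem mainTheorem5 {k : Type*} [Field k] [CharZero k] :
    (∀ (m n : ℕ) [NeZero m] [NeZero n], 2 ≤ m → 2 ≤ n → m ≠ n →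
      ∀ (q q' σ : k) (hq : IsPrimitiveRoot q m) (hq' : IsPrimitiveRoot q' n),
        σ ^ Nat.gcd m n = 1 →
          Nonempty (TaftBicrossed.HopfAut k (TaftBicrossed.TaftT hq' hq σ) ≃* kˣ × kˣ)) ∧
    (∀ (n : ℕ) [NeZero n], 2 ≤ n →
      ∀ (q q' σ : k) (hq : IsPrimitiveRoot q n) (hq' : IsPrimitiveRoot q' n),
        σ ^ n = 1 → q ≠ q' →
          Nonempty (TaftBicrossed.HopfAut k (TaftBicrossed.TaftT hq' hq σ) ≃* kˣ × kˣ)) ∧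
    (∀ (n : ℕ) [NeZero n], 2 ≤ n →
      ∀ (q σ : k) (hq : IsPrimitiveRoot q n), σ ^ n = 1 →
        (σ ^ 2 ≠ 1 →
          Nonempty (TaftBicrossed.HopfAut k (TaftBicrossed.TaftT hq hq σ) ≃* kˣ × kˣ)) ∧
        (σ ^ 2 = 1 →
          Nonempty (TaftBicrossed.HopfAut k (TaftBicrossed.TaftT hq hq σ) ≃*
            (kˣ × kˣ) ⋊[TaftBicrossed.swapAction kˣ] Multiplicative (ZMod 2)))) ∧
    (∀ (n : ℕ) [NeZero n], 2 ≤ n → ∀ (q : k) (hq : IsPrimitiveRoot q n),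
        (3 ≤ n →
          Nonempty (TaftBicrossed.HopfAut k (TaftBicrossed.TaftQ hq 1) ≃* kˣ)) ∧
        (n = 2 →
          Nonempty (TaftBicrossed.HopfAut k (TaftBicrossed.TaftQ hq 1) ≃*
            kˣ ⋊[TaftBicrossed.invAction kˣ] Multiplicative (ZMod 2)))) ∧
    (∀ (n : ℕ) [NeZero n], 2 ≤ n → ∀ (q : k) (hq : IsPrimitiveRoot q n),
        (3 ≤ n →
          Nonempty (TaftBicrossed.HopfAut k
            (TaftBicrossed.DrinfeldDouble (TaftBicrossed.Taft.antipode_bijective hq)) ≃* kˣ)) ∧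
        (n = 2 →
          Nonempty (TaftBicrossed.HopfAut k
            (TaftBicrossed.DrinfeldDouble (TaftBicrossed.Taft.antipode_bijective hq)) ≃*
              kˣ ⋊[TaftBicrossed.invAction kˣ] Multiplicative (ZMod 2)))) := by
  refine ⟨?_, ?_, ?_, ?_, ?_⟩
  · intro m n _ _ hm hn hmn q q' σ hq hq' hσ
    -- The condition on the gcd is used through σ^m = σ^n = 1, which the representation on T' ⊗ T
    -- requires.
    have hd : ∀ d, Nat.gcd m n ∣ d → σ ^ d = 1 := by
      rintro _ ⟨c, rfl⟩
      rw [pow_mul, hσ, one_pow]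
    refine TaftBicrossed.Bicross.nonempty_hopfAut_taftT hm hn hq hq' (hd m (Nat.gcd_dvd_left m n))
      (hd n (Nat.gcd_dvd_right m n)) (Or.inl ?_)
    -- Primitive roots of different orders are different, which excludes an exchange.
    rintro rfl
    exact hmn (hq.unique hq')
  · intro n _ hn q q' σ hq hq' hσ hne
    exact TaftBicrossed.Bicross.nonempty_hopfAut_taftT hn hn hq hq' hσ hσ (Or.inl hne)
  · intro n _ hn q σ hq hσ
    exact ⟨fun h2 => TaftBicrossed.Bicross.nonempty_hopfAut_taftT hn hn hq hq hσ hσ (Or.inr h2),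
      fun h2 => TaftBicrossed.Bicross.nonempty_hopfAut_taftT_semidirect hn hq hσ h2⟩
  · intro n _ hn q hq
    exact ⟨fun h3 => TaftBicrossed.Bicross.nonempty_hopfAut_taftQ h3 hq,
      fun h2 => TaftBicrossed.Bicross.nonempty_hopfAut_taftQ_semidirect h2 hq⟩
  · intro n _ hn q hq
    let e := (TaftBicrossed.hopfAutCongr (TaftBicrossed.Taft.doubleEquiv hq hn)).symm
    exact ⟨fun h3 => (TaftBicrossed.Bicross.nonempty_hopfAut_taftQ h3 hq).map e.trans,
      fun h2 => (TaftBicrossed.Bicross.nonempty_hopfAut_taftQ_semidirect h2 hq).map e.trans⟩
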